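/- Let $\mathcal C$ and $\mathcal D$ be rigid C*-tensor categories (semisimple C*-tensor categories with duals and simple tensor unit), and let $\mathbf I_{\mathcal C}$, $\mathbf I_{\mathcal D}$ be sets of representatives of the isomorphism classes of simple objects of $\mathcal C$, $\mathcal D$ other than the class of the tensor unit. Let $\mathcal C*\mathcal D$ be the free product, i.e. the projection category of the category whose objects are the words $\sigma$ with letters in $\mathrm{Obj}\,\mathcal C\cup\mathrm{Obj}\,\mathcal D$ and whose morphism spaces are spanned by the morphisms $Z_T=Z_{T_+}\otimes Z_{T_-}\in\mathcal C(t(\sigma_+),t(\tau_+))\otimes\mathcal D(t(\sigma_-),t(\tau_-))$ of non-crossing partitions $T$ with monochromatic blocks labelled by morphisms of $\mathcal C$ or $\mathcal D$. Here $\sigma_+$ and $\sigma_-$ are the subwords of the letters from $\mathcal C$ and from $\mathcal D$, $t$ is the tensor product of the letters, and $Z_{T_\pm}$ is the value of the $\mathcal C$- resp. $\mathcal D$-coloured part of $T$ in the graphical calculus. The simple objects of $\mathcal C*\mathcal D$ are represented by $\mathrm{Irr}(\mathcal C*\mathcal D)$, the set of alternating words in $\mathbf I_{\mathcal C}$ and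 $\mathbf I_{\mathcal D}$, the empty word being the tensor unit. Let $w\in\mathrm{Irr}(\mathcal C*\mathcal D)$ be an alternating word of positive even length whose first letter lies in $\mathbf I_{\mathcal C}$. The weight $w$ centralizer algebra is $$\mathcal A\Lambda_{w,w}=\bigoplus_{a\in \mathrm{Irr}(\mathcal C*\mathcal D)}(\mathcal C*\mathcal D)(a\otimes w,\,w\otimes a),$$ where for $f$ in the summand of $a_1$ and $g$ in the summand of $a_2$, $$f\cdot g=\sum_{c\in\mathrm{Irr}(\mathcal C*\mathcal D)}\ \sum_{u}(1_w\otimes u^*)(f\otimes 1_{a_2})(1_{a_1}\otimes g)(u\otimes 1_w),$$ $u$ running over an orthonormal basis of $(\mathcal C*\mathcal D)(c,a_1\otimes a_2)$ for the inner product given by $v^*u=\langle u,v\rangle 1_c$, and where for $f$ in the summand of $a$, with $\bar a\in\mathrm{Irr}(\mathcal C*\mathcal D)$ the conjugate of $a$ and $(R_a,\bar R_a)$ a solution of the duality equations with $R_a:\mathbb 1\to\bar a\otimes a$ and $\bar R_a:\mathbb 1\to a\otimes\bar a$, the element $$f^\#=(R_a^*\otimes 1_w\otimes 1_{\bar a})(1_{\bar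 a}\otimes f^*\otimes 1_{\bar a})(1_{\bar a}\otimes 1_w\otimes\bar R_a)$$ lies in the summand of $\bar a$. Write $w=v^k$ with a word $v$ and the largest possible positive integer $k$. Then $v\in\mathrm{Irr}(\mathcal C*\mathcal D)$, $vw=wv$, and there is an isomorphism of $*$-algebras from the group algebra $\mathbb C[\mathbb Z]$ (with $n^*=-n$ on group elements, extended conjugate linearly) onto $\mathcal A\Lambda_{w,w}$ which sends the generator $1\in\mathbb Z$ to the rotation $1_{v^{k+1}}\in(\mathcal C*\mathcal D)(vw,wv)$. -/

import Mathlib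

open CategoryTheory MonoidalCategory TensorProduct

universe v₁ v₂ u₁ u₂

noncomputable section

/-! ### Rigid C*-tensor categories -/

/-- A `*`-structure on a `ℂ`-linear category: a conjugate linear contravariant involution on
morphisms that fixes the objects. -/
class StarCategory (C : Type u₁) [Category.{v₁} C] [Preadditive C] [Linear ℂ C] where
  /-- the adjoint `f ↦ f*` -/
  adj : ∀ {X Y : C}, (X ⟶ Y) →ₛₗ[starRingEnd ℂ] (Y ⟶ X)
  adj_adj : ∀ {X Y : C} (f : X ⟶ Y), adj (adj f) = f
  adj_comp : ∀ {X Y Z : C} (f : X ⟶ Y) (g : Y ⟶ Z), adj (f ≫ g) = adj g ≫ adj f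

open StarCategory (adj)

section StarCategory

variable {C : Type u₁} [Category.{v₁} C] [Preadditive C] [Linear ℂ C] [StarCategory C]

theorem adj_id (X : C) : adj (𝟙 X) = 𝟙 X := by
  have h := StarCategory.adj_comp (adj (𝟙 X)) (𝟙 X)
  rw [Category.comp_id, StarCategory.adj_adj, Category.comp_id] at h
  exact h.symm

/-- `v` is an isometry: `v* ∘ v = 1`. -/
def IsIsometry {X Y : C} (v : X ⟶ Y) : Prop := v ≫ adj v = 𝟙 X

/-- `u` is unitary. -/
def IsUnitary {X Y : C} (u : X ⟶ Y) : Prop := u ≫ adj u = 𝟙 X ∧ adj u ≫ u = 𝟙 Y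

/-- `p` is a (self-adjoint) projection. -/
def IsProjection {X : C} (p : X ⟶ X) : Prop := p ≫ p = p ∧ adj p = p

/-- A simple object: nonzero, with only scalar endomorphisms. -/
def IsSimpleObj (X : C) : Prop := 𝟙 X ≠ 0 ∧ ∀ f : X ⟶ X, ∃ c : ℂ, f = c • 𝟙 X

variable (C) in
/-- `N` is a family of complete norms on the morphism spaces satisfying the axioms of a C*-category. -/
structure IsCStarNorm (N : ∀ X Y : C, (X ⟶ Y) → ℝ) : Prop where
  eq_zero : ∀ {X Y : C} (f : X ⟶ Y), N X Y f = 0 → f = 0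
  add_le : ∀ {X Y : C} (f g : X ⟶ Y), N X Y (f + g) ≤ N X Y f + N X Y g
  smul : ∀ {X Y : C} (c : ℂ) (f : X ⟶ Y), N X Y (c • f) = ‖c‖ * N X Y f
  complete : ∀ {X Y : C} (s : ℕ → (X ⟶ Y)),
    (∀ ε > 0, ∃ n₀, ∀ m ≥ n₀, ∀ n ≥ n₀, N X Y (s m - s n) < ε) →
      ∃ f, ∀ ε > 0, ∃ n₀, ∀ n ≥ n₀, N X Y (s n - f) < ε
  comp_le : ∀ {X Y Z : C} (f : X ⟶ Y) (g : Y ⟶ Z), N X Z (f ≫ g) ≤ N X Y f * N Y Z g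
  adj_comp_self : ∀ {X Y : C} (f : X ⟶ Y), N X X (f ≫ adj f) = N X Y f ^ 2
  comp_adj_self : ∀ {X Y : C} (f : X ⟶ Y), N Y Y (adj f ≫ f) = N X Y f ^ 2

variable [MonoidalCategory C]

/-- `(R, R')` with `R : 𝟙 ⟶ a' ⊗ a` and `R' : 𝟙 ⟶ a ⊗ a'` solves the duality equations
`(1_a ⊗ R*) ∘ (R' ⊗ 1_a) = 1_a` and `(R* ⊗ 1_{a'}) ∘ (1_{a'} ⊗ R') = 1_{a'}`. -/
def SolvesDuality {a a' : C} (R : 𝟙_ C ⟶ a' ⊗ a) (R' : 𝟙_ C ⟶ a ⊗ a') : Prop :=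
  (λ_ a).inv ≫ (R' ▷ a) ≫ (α_ a a' a).hom ≫ (a ◁ adj R) ≫ (ρ_ a).hom = 𝟙 a ∧
  (ρ_ a').inv ≫ (a' ◁ R') ≫ (α_ a' a a').inv ≫ (adj R ▷ a') ≫ (λ_ a').hom = 𝟙 a'

end StarCategory

/-- A rigid C*-tensor category: a semisimple C*-tensor category with duals and simple unit
(not necessarily strict). -/
class RigidCStarTensorCategory (C : Type u₁) [Category.{v₁} C] [MonoidalCategory C]
    [Preadditive C] [Linear ℂ C] [MonoidalPreadditive C] [MonoidalLinear ℂ C]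
    extends StarCategory C where
  /-- `C` is a C*-category (this is a property of a `*`-category). -/
  exists_norm : ∃ N : ∀ X Y : C, (X ⟶ Y) → ℝ, IsCStarNorm C N
  /-- `f* ∘ f` is a positive element of the C*-algebra `End X`. -/
  adj_comp_self_nonneg : ∀ {X Y : C} (f : X ⟶ Y), ∃ g : X ⟶ X, f ≫ adj f = g ≫ adj g
  adj_tensorHom : ∀ {X₁ Y₁ X₂ Y₂ : C} (f : X₁ ⟶ Y₁) (g : X₂ ⟶ Y₂),
    adj (f ⊗ₘ g) = adj f ⊗ₘ adj g
  unitary_associator : ∀ X Y Z : C, IsUnitary (α_ X Y Z).hom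
  unitary_leftUnitor : ∀ X : C, IsUnitary (λ_ X).hom
  unitary_rightUnitor : ∀ X : C, IsUnitary (ρ_ X).hom
  /-- orthogonal direct sums -/
  exists_directSum : ∀ X Y : C, ∃ (Z : C) (u : X ⟶ Z) (v : Y ⟶ Z),
    IsIsometry u ∧ IsIsometry v ∧ adj u ≫ u + adj v ≫ v = 𝟙 Z
  /-- self-adjoint subobjects -/
  exists_subobject : ∀ {X : C} (p : X ⟶ X), IsProjection p →
    ∃ (Y : C) (v : Y ⟶ X), IsIsometry v ∧ adj v ≫ v = p
  /-- every object is a finite orthogonal direct sum of simple objects -/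
  exists_decomposition : ∀ X : C, ∃ (n : ℕ) (S : Fin n → C) (v : ∀ i, S i ⟶ X),
    (∀ i, IsSimpleObj (S i)) ∧ (∀ i, IsIsometry (v i)) ∧ ∑ i, adj (v i) ≫ v i = 𝟙 X
  exists_dual : ∀ a : C, ∃ (a' : C) (R : 𝟙_ C ⟶ a' ⊗ a) (R' : 𝟙_ C ⟶ a ⊗ a'), SolvesDuality R R'
  simple_unit : IsSimpleObj (𝟙_ C)

/-- `I` contains exactly one object from each isomorphism class of simple objects, except that the
class of the tensor unit is left out. -/
def IsNontrivialIrr {C : Type u₁} [Category.{v₁} C] [MonoidalCategory C] [Preadditive C]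
    [Linear ℂ C] (I : Set C) : Prop :=
  (∀ a ∈ I, IsSimpleObj a ∧ IsEmpty (a ≅ 𝟙_ C)) ∧
  ∀ x : C, IsSimpleObj x → IsEmpty (x ≅ 𝟙_ C) → ∃! a, a ∈ I ∧ Nonempty (x ≅ a)

/-! ### The tensor product of two linear categories (before completion)

Objects are pairs `(a, b)`, and morphisms `(a, b) ⟶ (a', b')` form the algebraic tensor product
`C(a, a') ⊗ D(b, b')`; composition, `⊗` and `*` act on the two tensor factors. -/

/-- Objects of the tensor product category. -/
@[ext]
structure Deligne (C : Type u₁) (D : Type u₂) where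
  /-- first component -/
  fst : C
  /-- second component -/
  snd : D

namespace Deligne

variable {C : Type u₁} [Category.{v₁} C] [Preadditive C] [Linear ℂ C]
variable {D : Type u₂} [Category.{v₂} D] [Preadditive D] [Linear ℂ D]

instance : Category.{max v₁ v₂} (Deligne C D) where
  Hom X Y := (X.fst ⟶ Y.fst) ⊗[ℂ] (X.snd ⟶ Y.snd)
  id X := 𝟙 X.fst ⊗ₜ 𝟙 X.snd
  comp {X Y Z} f g :=
    TensorProduct.map₂ (Linear.comp (S := ℂ) X.fst Y.fst Z.fst) (Linear.comp X.snd Y.snd Z.snd) f g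
  id_comp {X Y} f := by
    induction f with
    | zero => simp
    | tmul a b => simp
    | add x y hx hy => rw [map_add, hx, hy]
  comp_id {X Y} f := by
    induction f with
    | zero => simp
    | tmul a b => simp
    | add x y hx hy => rw [map_add, LinearMap.add_apply, hx, hy]
  assoc {W X Y Z} f g h := by
    induction f with
    | zero => simp
    | add x y hx hy => simp only [map_add, LinearMap.add_apply, hx, hy]
    | tmul a b =>
    induction g with
    | zero => simp
    | add x y hx hy => simp only [map_add, LinearMap.add_apply, hx, hy]
    | tmul c d =>
    induction h with
    | zero => simp
    | add x y hx hy => simp only [map_add, hx, hy]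
    | tmul e f => simp

/-- The morphism `a ⊗ b` of the tensor product category. -/
def tmul {X Y : Deligne C D} (a : X.fst ⟶ Y.fst) (b : X.snd ⟶ Y.snd) : X ⟶ Y := a ⊗ₜ[ℂ] b

instance homAddCommGroup (X Y : Deligne C D) : AddCommGroup (X ⟶ Y) :=
  inferInstanceAs (AddCommGroup ((X.fst ⟶ Y.fst) ⊗[ℂ] (X.snd ⟶ Y.snd)))

instance homModule (X Y : Deligne C D) : Module ℂ (X ⟶ Y) :=
  inferInstanceAs (Module ℂ ((X.fst ⟶ Y.fst) ⊗[ℂ] (X.snd ⟶ Y.snd)))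

/-- Composition as a bilinear map. -/
def compBilin (X Y Z : Deligne C D) : (X ⟶ Y) →ₗ[ℂ] (Y ⟶ Z) →ₗ[ℂ] (X ⟶ Z) :=
  TensorProduct.map₂ (Linear.comp (S := ℂ) X.fst Y.fst Z.fst) (Linear.comp X.snd Y.snd Z.snd)

instance : Preadditive (Deligne C D) where
  homGroup X Y := homAddCommGroup X Y
  add_comp X Y Z f g h := LinearMap.congr_fun (map_add (compBilin X Y Z) f g) h
  comp_add X Y Z f g h := map_add (compBilin X Y Z f) g h

instance : Linear ℂ (Deligne C D) where
  homModule X Y := homModule X Y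
  smul_comp X Y Z r f g := LinearMap.congr_fun (map_smul (compBilin X Y Z) r f) g
  comp_smul X Y Z f r g := map_smul (compBilin X Y Z f) r g

@[elab_as_elim]
theorem hom_induction {X Y : Deligne C D} {P : (X ⟶ Y) → Prop} (f : X ⟶ Y) (zero : P 0)
    (tmul : ∀ a b, P (tmul a b)) (add : ∀ f g, P f → P g → P (f + g)) : P f :=
  TensorProduct.induction_on f zero tmul add

@[simp]
theorem tmul_comp {X Y Z : Deligne C D} (a : X.fst ⟶ Y.fst) (b : X.snd ⟶ Y.snd)
    (a' : Y.fst ⟶ Z.fst) (b' : Y.snd ⟶ Z.snd) :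
    tmul a b ≫ tmul a' b' = (tmul (a ≫ a') (b ≫ b') : X ⟶ Z) := rfl

theorem id_eq (X : Deligne C D) : 𝟙 X = tmul (𝟙 X.fst) (𝟙 X.snd) := rfl

/-- The isomorphism `a ⊗ b`. -/
@[simps]
def isoMk {X Y : Deligne C D} (a : X.fst ≅ Y.fst) (b : X.snd ≅ Y.snd) : X ≅ Y where
  hom := tmul a.hom b.hom
  inv := tmul a.inv b.inv
  hom_inv_id := by simp [id_eq]
  inv_hom_id := by simp [id_eq]

section Star

variable [StarCategory C] [StarCategory D]

/-- The adjoint `(a ⊗ b)* = a* ⊗ b*`. -/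
def adjMap (X Y : Deligne C D) : (X ⟶ Y) →ₛₗ[starRingEnd ℂ] (Y ⟶ X) :=
  TensorProduct.map (adj (X := X.fst) (Y := Y.fst)) (adj (X := X.snd) (Y := Y.snd))

theorem adjMap_tmul {X Y : Deligne C D} (a : X.fst ⟶ Y.fst) (b : X.snd ⟶ Y.snd) :
    adjMap X Y (tmul a b) = tmul (adj a) (adj b) := rfl

instance : StarCategory (Deligne C D) where
  adj {X Y} := adjMap X Y
  adj_adj {X Y} f := by
    induction f using hom_induction with
    | zero => rw [map_zero, map_zero]
    | add f g hf hg => rw [map_add, map_add, hf, hg]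
    | tmul a b => rw [adjMap_tmul, adjMap_tmul, StarCategory.adj_adj, StarCategory.adj_adj]
  adj_comp {X Y Z} f g := by
    induction f using hom_induction with
    | zero => rw [Limits.zero_comp, map_zero, map_zero, Limits.comp_zero]
    | add f g hf hg => rw [Preadditive.add_comp, map_add, map_add, hf, hg, Preadditive.comp_add]
    | tmul a b =>
    induction g using hom_induction with
    | zero => rw [Limits.comp_zero, map_zero, map_zero, Limits.zero_comp]
    | add f g hf hg => rw [Preadditive.comp_add, map_add, map_add, hf, hg, Preadditive.add_comp]
    | tmul c d =>
      rw [tmul_comp, adjMap_tmul, adjMap_tmul, adjMap_tmul, tmul_comp, StarCategory.adj_comp,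
        StarCategory.adj_comp]

end Star

section Monoidal

variable [MonoidalCategory C] [MonoidalPreadditive C] [MonoidalLinear ℂ C]
variable [MonoidalCategory D] [MonoidalPreadditive D] [MonoidalLinear ℂ D]

/-- The tensor product of morphisms as a bilinear map. -/
def tensorBilin {C : Type u₁} [Category.{v₁} C] [Preadditive C] [Linear ℂ C]
    [MonoidalCategory C] [MonoidalPreadditive C] [MonoidalLinear ℂ C] (X₁ Y₁ X₂ Y₂ : C) :
    (X₁ ⟶ Y₁) →ₗ[ℂ] (X₂ ⟶ Y₂) →ₗ[ℂ] (X₁ ⊗ X₂ ⟶ Y₁ ⊗ Y₂) :=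
  LinearMap.mk₂ ℂ (fun f g => f ⊗ₘ g)
    (fun f f' g => by simp [MonoidalPreadditive.add_tensor])
    (fun c f g => by simp [MonoidalCategory.tensorHom_def])
    (fun f g g' => by simp [MonoidalPreadditive.tensor_add])
    (fun c f g => by simp [MonoidalCategory.tensorHom_def])

/-- The tensor product of morphisms, `(a ⊗ b) ⊗ (c ⊗ d) = (a ⊗ c) ⊗ (b ⊗ d)`. -/
def homTensor {X₁ Y₁ X₂ Y₂ : Deligne C D} :
    (X₁ ⟶ Y₁) →ₗ[ℂ] (X₂ ⟶ Y₂) →ₗ[ℂ]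
      ((⟨X₁.fst ⊗ X₂.fst, X₁.snd ⊗ X₂.snd⟩ : Deligne C D) ⟶ ⟨Y₁.fst ⊗ Y₂.fst, Y₁.snd ⊗ Y₂.snd⟩) :=
  TensorProduct.map₂ (tensorBilin X₁.fst Y₁.fst X₂.fst Y₂.fst)
    (tensorBilin X₁.snd Y₁.snd X₂.snd Y₂.snd)

instance : MonoidalCategoryStruct (Deligne C D) where
  tensorObj X Y := ⟨X.fst ⊗ Y.fst, X.snd ⊗ Y.snd⟩
  tensorHom f g := homTensor f g
  whiskerLeft X _ _ f := homTensor (𝟙 X) f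
  whiskerRight f Y := homTensor f (𝟙 Y)
  tensorUnit := ⟨𝟙_ C, 𝟙_ D⟩
  associator X Y Z := isoMk (α_ X.fst Y.fst Z.fst) (α_ X.snd Y.snd Z.snd)
  leftUnitor X := isoMk (λ_ X.fst) (λ_ X.snd)
  rightUnitor X := isoMk (ρ_ X.fst) (ρ_ X.snd)

theorem tensorHom_eq {X₁ Y₁ X₂ Y₂ : Deligne C D} (f : X₁ ⟶ Y₁) (g : X₂ ⟶ Y₂) :
    f ⊗ₘ g = homTensor f g := rfl

@[simp]
theorem tmul_tensorHom {X₁ Y₁ X₂ Y₂ : Deligne C D} (a : X₁.fst ⟶ Y₁.fst) (b : X₁.snd ⟶ Y₁.snd)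
    (a' : X₂.fst ⟶ Y₂.fst) (b' : X₂.snd ⟶ Y₂.snd) :
    tmul a b ⊗ₘ tmul a' b' = (tmul (a ⊗ₘ a') (b ⊗ₘ b') : X₁ ⊗ X₂ ⟶ Y₁ ⊗ Y₂) := rfl

theorem add_tensorHom {X₁ Y₁ X₂ Y₂ : Deligne C D} (f f' : X₁ ⟶ Y₁) (g : X₂ ⟶ Y₂) :
    (f + f') ⊗ₘ g = f ⊗ₘ g + f' ⊗ₘ g := by
  simp only [tensorHom_eq, map_add, LinearMap.add_apply]

theorem tensorHom_add {X₁ Y₁ X₂ Y₂ : Deligne C D} (f : X₁ ⟶ Y₁) (g g' : X₂ ⟶ Y₂) :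
    f ⊗ₘ (g + g') = f ⊗ₘ g + f ⊗ₘ g' := by
  simp only [tensorHom_eq, map_add]

theorem zero_tensorHom {X₁ Y₁ X₂ Y₂ : Deligne C D} (g : X₂ ⟶ Y₂) :
    (0 : X₁ ⟶ Y₁) ⊗ₘ g = 0 := by
  simp only [tensorHom_eq, map_zero, LinearMap.zero_apply]

theorem tensorHom_zero {X₁ Y₁ X₂ Y₂ : Deligne C D} (f : X₁ ⟶ Y₁) :
    f ⊗ₘ (0 : X₂ ⟶ Y₂) = 0 := by
  simp only [tensorHom_eq, map_zero]

instance : MonoidalCategory (Deligne C D) := MonoidalCategory.ofTensorHom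
  (id_tensorHom_id := fun X₁ X₂ => by simp [id_eq]; rfl)
  (id_tensorHom := fun _ _ _ _ => rfl)
  (tensorHom_id := fun _ _ => rfl)
  (tensorHom_comp_tensorHom := fun f₁ f₂ g₁ g₂ => by
    induction f₁ using hom_induction with
    | zero => simp only [zero_tensorHom, Limits.zero_comp]
    | add f f' h h' => simp only [add_tensorHom, Preadditive.add_comp, h, h']
    | tmul a₁ b₁ =>
    induction f₂ using hom_induction with
    | zero => simp only [tensorHom_zero, Limits.zero_comp]
    | add f f' h h' => simp only [tensorHom_add, Preadditive.add_comp, h, h']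
    | tmul a₂ b₂ =>
    induction g₁ using hom_induction with
    | zero => simp only [zero_tensorHom, Limits.comp_zero]
    | add f f' h h' => simp only [add_tensorHom, Preadditive.comp_add, h, h']
    | tmul c₁ d₁ =>
    induction g₂ using hom_induction with
    | zero => simp only [tensorHom_zero, Limits.comp_zero]
    | add f f' h h' => simp only [tensorHom_add, Preadditive.comp_add, h, h']
    | tmul c₂ d₂ =>
      rw [tmul_tensorHom, tmul_tensorHom, tmul_comp, tmul_comp, tmul_comp, tmul_tensorHom,
        tensorHom_comp_tensorHom, tensorHom_comp_tensorHom])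
  (associator_naturality := fun f₁ f₂ f₃ => by
    induction f₁ using hom_induction with
    | zero => simp only [zero_tensorHom, Limits.zero_comp, Limits.comp_zero]
    | add f f' h h' => simp only [add_tensorHom, Preadditive.add_comp, Preadditive.comp_add, h, h']
    | tmul a₁ b₁ =>
    induction f₂ using hom_induction with
    | zero => simp only [zero_tensorHom, tensorHom_zero, Limits.zero_comp, Limits.comp_zero]
    | add f f' h h' =>
      simp only [add_tensorHom, tensorHom_add, Preadditive.add_comp, Preadditive.comp_add, h, h']
    | tmul a₂ b₂ =>
    induction f₃ using hom_induction with
    | zero => simp only [tensorHom_zero, Limits.zero_comp, Limits.comp_zero]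
    | add f f' h h' => simp only [tensorHom_add, Preadditive.add_comp, Preadditive.comp_add, h, h']
    | tmul a₃ b₃ => exact congrArg₂ tmul (associator_naturality _ _ _) (associator_naturality _ _ _))
  (leftUnitor_naturality := fun f => by
    induction f using hom_induction with
    | zero => simp only [tensorHom_zero, Limits.zero_comp, Limits.comp_zero]
    | add f f' h h' => simp only [tensorHom_add, Preadditive.add_comp, Preadditive.comp_add, h, h']
    | tmul a b =>
      refine congrArg₂ tmul (?_ : (𝟙 _ ⊗ₘ a) ≫ (λ_ _).hom = (λ_ _).hom ≫ a)
        (?_ : (𝟙 _ ⊗ₘ b) ≫ (λ_ _).hom = (λ_ _).hom ≫ b) <;> simp)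
  (rightUnitor_naturality := fun f => by
    induction f using hom_induction with
    | zero => simp only [zero_tensorHom, Limits.zero_comp, Limits.comp_zero]
    | add f f' h h' => simp only [add_tensorHom, Preadditive.add_comp, Preadditive.comp_add, h, h']
    | tmul a b =>
      refine congrArg₂ tmul (?_ : (a ⊗ₘ 𝟙 _) ≫ (ρ_ _).hom = (ρ_ _).hom ≫ a)
        (?_ : (b ⊗ₘ 𝟙 _) ≫ (ρ_ _).hom = (ρ_ _).hom ≫ b) <;> simp)
  (pentagon := fun W X Y Z => by
    have h₁ := pentagon W.fst X.fst Y.fst Z.fst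
    have h₂ := pentagon W.snd X.snd Y.snd Z.snd
    rw [← tensorHom_id, ← id_tensorHom] at h₁ h₂
    exact congrArg₂ tmul h₁ h₂)
  (triangle := fun X Y => by
    have h₁ := triangle X.fst Y.fst
    have h₂ := triangle X.snd Y.snd
    rw [← tensorHom_id, ← id_tensorHom] at h₁ h₂
    exact congrArg₂ tmul h₁ h₂)

end Monoidal

end Deligne

/-! ### Words and the non-crossing partition category -/

/-- Words with letters in `Obj C ∪ Obj D`. -/
def Word (C : Type u₁) (D : Type u₂) := List (C ⊕ D)

namespace Word

/-- The empty word. -/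
def empty {C : Type u₁} {D : Type u₂} : Word C D := List.nil

/-- Concatenation of words. -/
def append {C : Type u₁} {D : Type u₂} (σ τ : Word C D) : Word C D := List.append σ τ

section Tensor

variable {C : Type u₁} [Category.{v₁} C] [MonoidalCategory C]
variable {D : Type u₂} [Category.{v₂} D] [MonoidalCategory D]

/-- The tensor product of the letters of `σ` that come from `C` (bracketed to the right). -/
def left : Word C D → C
  | [] => 𝟙_ C
  | Sum.inl a :: σ => a ⊗ left σ
  | Sum.inr _ :: σ => left σ

/-- The tensor product of the letters of `σ` that come from `D` (bracketed to the right). -/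
def right : Word C D → D
  | [] => 𝟙_ D
  | Sum.inl _ :: σ => right σ
  | Sum.inr b :: σ => b ⊗ right σ

/-- The rebracketing isomorphism. -/
def leftIso : ∀ σ τ : Word C D, left σ ⊗ left τ ≅ left (append σ τ)
  | [], τ => λ_ (left τ)
  | Sum.inl a :: σ, τ => α_ a (left σ) (left τ) ≪≫ whiskerLeftIso a (leftIso σ τ)
  | Sum.inr _ :: σ, τ => leftIso σ τ

/-- The rebracketing isomorphism. -/
def rightIso : ∀ σ τ : Word C D, right σ ⊗ right τ ≅ right (append σ τ)
  | [], τ => λ_ (right τ)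
  | Sum.inl _ :: σ, τ => rightIso σ τ
  | Sum.inr b :: σ, τ => α_ b (right σ) (right τ) ≪≫ whiskerLeftIso b (rightIso σ τ)

/-- The list of letters of a word. -/
def letters {C : Type u₁} {D : Type u₂} (σ : Word C D) : List (C ⊕ D) := σ

/-- All letters of the word come from `C`. -/
def AllLeft (σ : Word C D) : Prop := ∀ x ∈ σ.letters, x.isLeft

/-- All letters of the word come from `D`. -/
def AllRight (σ : Word C D) : Prop := ∀ x ∈ σ.letters, x.isRight

/-- The object `(t(σ₊), t(σ₋))`. -/
def toDeligne (σ : Word C D) : Deligne C D := ⟨left σ, right σ⟩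

end Tensor

section Unit

variable {C : Type u₁} {D : Type u₂} [Category.{v₂} D] [MonoidalCategory D]

theorem right_of_allLeft : ∀ {σ : Word C D}, AllLeft σ → right σ = 𝟙_ D
  | [], _ => rfl
  | Sum.inl _ :: σ, h => right_of_allLeft (σ := σ) fun x hx => h x (List.Mem.tail _ hx)
  | Sum.inr _ :: _, h => by simpa using h _ List.mem_cons_self

end Unit

section Unit

variable {C : Type u₁} {D : Type u₂} [Category.{v₁} C] [MonoidalCategory C]

theorem left_of_allRight : ∀ {σ : Word C D}, AllRight σ → left σ = 𝟙_ C
  | [], _ => rfl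
  | Sum.inr _ :: σ, h => left_of_allRight (σ := σ) fun x hx => h x (List.Mem.tail _ hx)
  | Sum.inl _ :: _, h => by simpa using h _ List.mem_cons_self

end Unit

variable {C : Type u₁} [Category.{v₁} C] [MonoidalCategory C] [Preadditive C] [Linear ℂ C]
variable {D : Type u₂} [Category.{v₂} D] [MonoidalCategory D] [Preadditive D] [Linear ℂ D]

/-- The ambient category: `σ ⟶ τ` is the space `C(t(σ₊), t(τ₊)) ⊗ D(t(σ₋), t(τ₋))`. -/
instance : Category.{max v₁ v₂} (Word C D) where
  Hom σ τ := toDeligne σ ⟶ toDeligne τ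
  id σ := 𝟙 (toDeligne σ)
  comp {X Y Z} f g := CategoryStruct.comp (X := toDeligne X) (Y := toDeligne Y) (Z := toDeligne Z) f g
  id_comp {X Y} f := Category.id_comp (X := toDeligne X) (Y := toDeligne Y) f
  comp_id {X Y} f := Category.comp_id (X := toDeligne X) (Y := toDeligne Y) f
  assoc {W X Y Z} f g h :=
    Category.assoc (W := toDeligne W) (X := toDeligne X) (Y := toDeligne Y) (Z := toDeligne Z) f g h

/-- The inclusion into the tensor product category. -/
@[simps]
def incl : Word C D ⥤ Deligne C D where
  obj σ := toDeligne σ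
  map f := f

instance : (incl (C := C) (D := D)).Faithful where
  map_injective h := h

/-- A morphism of words from its underlying morphism. -/
def ofHom {σ τ : Word C D} (f : toDeligne σ ⟶ toDeligne τ) : σ ⟶ τ := f

instance : Preadditive (Word C D) where
  homGroup σ τ := inferInstanceAs (AddCommGroup (toDeligne σ ⟶ toDeligne τ))
  add_comp X Y Z := Preadditive.add_comp (toDeligne X) (toDeligne Y) (toDeligne Z)
  comp_add X Y Z := Preadditive.comp_add (toDeligne X) (toDeligne Y) (toDeligne Z)

instance : Linear ℂ (Word C D) where
  homModule σ τ := inferInstanceAs (Module ℂ (toDeligne σ ⟶ toDeligne τ))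
  smul_comp X Y Z := Linear.smul_comp (toDeligne X) (toDeligne Y) (toDeligne Z)
  comp_smul X Y Z := Linear.comp_smul (toDeligne X) (toDeligne Y) (toDeligne Z)

instance [StarCategory C] [StarCategory D] : StarCategory (Word C D) where
  adj {X Y} := adj (X := toDeligne X) (Y := toDeligne Y)
  adj_adj {X Y} f := StarCategory.adj_adj (X := toDeligne X) (Y := toDeligne Y) f
  adj_comp {X Y Z} f g :=
    StarCategory.adj_comp (X := toDeligne X) (Y := toDeligne Y) (Z := toDeligne Z) f g

variable [MonoidalPreadditive C] [MonoidalLinear ℂ C]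
variable [MonoidalPreadditive D] [MonoidalLinear ℂ D]

/-- The rebracketing isomorphism `t(σ) ⊗ t(τ) ≅ t(στ)` in both components. -/
def tensorIso (σ τ : Word C D) : toDeligne σ ⊗ toDeligne τ ≅ toDeligne (append σ τ) :=
  Deligne.isoMk (X := toDeligne σ ⊗ toDeligne τ) (leftIso σ τ) (rightIso σ τ)

/-- The empty word represents the tensor unit. -/
def emptyIso : 𝟙_ (Deligne C D) ≅ toDeligne (empty : Word C D) := Iso.refl _

/-- An isomorphism of words from an isomorphism in the tensor product category. -/
def ofIso {σ τ : Word C D} (e : toDeligne σ ≅ toDeligne τ) : σ ≅ τ where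
  hom := e.hom
  inv := e.inv
  hom_inv_id := e.hom_inv_id
  inv_hom_id := e.inv_hom_id

/-- The tensor product of words is concatenation; the tensor product of morphisms is taken in both
components, identifying `t(στ)` with `t(σ) ⊗ t(τ)`. -/
instance : MonoidalCategoryStruct (Word C D) where
  tensorObj σ τ := append σ τ
  tensorUnit := empty
  tensorHom {σ τ κ ν} f g :=
    ofHom ((tensorIso σ κ).inv ≫ (incl.map f ⊗ₘ incl.map g) ≫ (tensorIso τ ν).hom)
  whiskerLeft σ {τ κ} f := ofHom ((tensorIso σ τ).inv ≫ (toDeligne σ ◁ incl.map f) ≫ (tensorIso σ κ).hom)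
  whiskerRight {τ κ} f σ := ofHom ((tensorIso τ σ).inv ≫ (incl.map f ▷ toDeligne σ) ≫ (tensorIso κ σ).hom)
  associator σ τ κ := ofIso
    ((((tensorIso _ _).symm ≪≫ ((tensorIso _ _).symm ⊗ᵢ .refl _))
        ≪≫ α_ (toDeligne σ) (toDeligne τ) (toDeligne κ)
        ≪≫ ((.refl _ ⊗ᵢ tensorIso _ _) ≪≫ tensorIso _ _)))
  leftUnitor σ := ofIso
    (((tensorIso empty σ).symm ≪≫ (emptyIso.symm ⊗ᵢ .refl (toDeligne σ))) ≪≫ λ_ (toDeligne σ))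
  rightUnitor σ := ofIso
    (((tensorIso σ empty).symm ≪≫ (.refl (toDeligne σ) ⊗ᵢ emptyIso.symm)) ≪≫ ρ_ (toDeligne σ))

instance : MonoidalCategory (Word C D) :=
  Monoidal.induced incl
    { μIso := fun σ τ => tensorIso σ τ
      whiskerLeft_eq := fun _ _ _ _ => rfl
      whiskerRight_eq := fun _ _ => rfl
      tensorHom_eq := fun _ _ => rfl
      εIso := emptyIso
      associator_eq := fun _ _ _ => rfl
      leftUnitor_eq := fun _ => rfl
      rightUnitor_eq := fun _ => rfl }

end Word

section NCP

open Word

variable {C : Type u₁} [Category.{v₁} C] [MonoidalCategory C] [Preadditive C] [Linear ℂ C]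
variable {D : Type u₂} [Category.{v₂} D] [MonoidalCategory D] [Preadditive D] [Linear ℂ D]

/-- A block of a non-crossing partition, with bottom letters `α` and top letters `β`: either all
letters are from `C` and the block carries a morphism `t(α) ⟶ t(β)` of `C`, or all letters are from
`D` and the block carries a morphism of `D`. -/
inductive Block (α β : Word C D) : Type (max v₁ v₂)
  | ofLeft (hα : AllLeft α) (hβ : AllLeft β) (f : left α ⟶ left β)
  | ofRight (hα : AllRight α) (hβ : AllRight β) (f : right α ⟶ right β)

/-- The morphism of a block; the component in the other category is the identity of the unit. -/
def Block.hom {α β : Word C D} : Block α β → (α ⟶ β)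
  | .ofLeft hα hβ f => ofHom (Deligne.tmul f
      (eqToHom ((right_of_allLeft hα).trans (right_of_allLeft hβ).symm)))
  | .ofRight hα hβ f => ofHom (Deligne.tmul
      (eqToHom ((left_of_allRight hα).trans (left_of_allRight hβ).symm)) f)

variable [MonoidalPreadditive C] [MonoidalLinear ℂ C]
variable [MonoidalPreadditive D] [MonoidalLinear ℂ D]

/-- The `(σ, τ)`-NCPs: non-crossing partitions of the letters of `σ` (bottom edge of a rectangle, from
left to right) and of `τ` (top edge), with monochromatic blocks labelled by morphisms.

A partition of points on the boundary of a rectangle is non-crossing if and only if it arises from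
the empty one by inserting nonempty blocks one at a time, each inserted block consisting of
neighbouring points of the boundary at the moment it is inserted. Reading the boundary from the right
end of the top edge, leftwards along the top and then rightwards along the bottom, such an inserted
block either lies at the left end of the rectangle (it is an initial segment of the bottom together
with an initial segment of the top), or within the bottom edge, or within the top edge. -/
inductive NCP : Word C D → Word C D → Type (max u₁ u₂ v₁ v₂)
  | nil : NCP empty empty
  | atLeft {α β σ τ : Word C D} (h : α ≠ empty ∨ β ≠ empty) (b : Block α β) (T : NCP σ τ) :
      NCP (α ⊗ σ) (β ⊗ τ)
  | atBottom {α τ : Word C D} (σ₁ σ₂ : Word C D) (h : α ≠ empty) (b : Block α empty)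
      (T : NCP (σ₁ ⊗ σ₂) τ) : NCP (σ₁ ⊗ (α ⊗ σ₂)) τ
  | atTop {β σ : Word C D} (τ₁ τ₂ : Word C D) (h : β ≠ empty) (b : Block empty β)
      (T : NCP σ (τ₁ ⊗ τ₂)) : NCP σ (τ₁ ⊗ (β ⊗ τ₂))

/-- The morphism `Z_T = Z_{T₊} ⊗ Z_{T₋}` which the graphical calculus assigns to `T` (morphisms are
read from bottom to top). -/
def NCP.eval : {σ τ : Word C D} → NCP σ τ → (σ ⟶ τ)
  | _, _, .nil => 𝟙 empty
  | _, _, .atLeft _ b T => b.hom ⊗ₘ T.eval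
  | _, _, .atBottom σ₁ σ₂ _ b T => (σ₁ ◁ ((b.hom ▷ σ₂) ≫ (λ_ σ₂).hom)) ≫ T.eval
  | _, _, .atTop τ₁ τ₂ _ b T => T.eval ≫ (τ₁ ◁ ((λ_ τ₂).inv ≫ (b.hom ▷ τ₂)))

/-- The morphism space `NCP(σ, τ)`, a subspace of `C(t(σ₊), t(τ₊)) ⊗ D(t(σ₋), t(τ₋))`. -/
def ncpHom (σ τ : Word C D) : Submodule ℂ (σ ⟶ τ) := Submodule.span ℂ (Set.range NCP.eval)

theorem exists_ncp_id : ∀ σ : Word C D, ∃ T : NCP σ σ, T.eval = 𝟙 σ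
  | [] => ⟨.nil, rfl⟩
  | Sum.inl a :: σ => by
    obtain ⟨T, hT⟩ := exists_ncp_id σ
    have h : AllLeft ([Sum.inl a] : List (C ⊕ D)) := by
      intro x hx
      rw [List.mem_singleton.1 hx]
      rfl
    refine ⟨.atLeft (α := ([Sum.inl a] : List (C ⊕ D))) (β := ([Sum.inl a] : List (C ⊕ D)))
      (Or.inl (List.cons_ne_nil _ _)) (.ofLeft h h (𝟙 _)) T, ?_⟩
    have hb : (Block.ofLeft h h (𝟙 _)).hom = 𝟙 (show Word C D from ([Sum.inl a] : List (C ⊕ D))) := rfl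
    exact (congrArg₂ (fun f g => f ⊗ₘ g) hb hT).trans (id_tensorHom_id _ _)
  | Sum.inr a :: σ => by
    obtain ⟨T, hT⟩ := exists_ncp_id σ
    have h : AllRight ([Sum.inr a] : List (C ⊕ D)) := by
      intro x hx
      rw [List.mem_singleton.1 hx]
      rfl
    refine ⟨.atLeft (α := ([Sum.inr a] : List (C ⊕ D))) (β := ([Sum.inr a] : List (C ⊕ D)))
      (Or.inl (List.cons_ne_nil _ _)) (.ofRight h h (𝟙 _)) T, ?_⟩
    have hb : (Block.ofRight h h (𝟙 _)).hom = 𝟙 (show Word C D from ([Sum.inr a] : List (C ⊕ D))) := rfl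
    exact (congrArg₂ (fun f g => f ⊗ₘ g) hb hT).trans (id_tensorHom_id _ _)

theorem id_mem_ncpHom (σ : Word C D) : 𝟙 σ ∈ ncpHom σ σ := by
  obtain ⟨T, hT⟩ := exists_ncp_id σ
  exact Submodule.subset_span ⟨T, hT⟩

end NCP

/-! ### The free product -/

section FreeProduct

variable (C : Type u₁) [Category.{v₁} C] [MonoidalCategory C] [Preadditive C] [Linear ℂ C]
variable (D : Type u₂) [Category.{v₂} D] [MonoidalCategory D] [Preadditive D] [Linear ℂ D]
variable [MonoidalPreadditive C] [MonoidalLinear ℂ C] [StarCategory C]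
variable [MonoidalPreadditive D] [MonoidalLinear ℂ D] [StarCategory D]

/-- Objects of the free product `C * D`, the projection category of the category of non-crossing
partitions: pairs `(σ, p)` with a projection `p ∈ NCP(σ, σ)`. -/
structure FreeProd where
  word : Word C D
  proj : word ⟶ word
  proj_mem : proj ∈ ncpHom word word
  isProjection : IsProjection proj

variable {C D}

namespace FreeProd

/-- The morphism space `(C * D)((σ, p), (τ, q)) = q ∘ NCP(σ, τ) ∘ p`. -/
def homs (X Y : FreeProd C D) : Submodule ℂ (X.word ⟶ Y.word) :=
  (ncpHom X.word Y.word).map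
    (Linear.rightComp ℂ X.word Y.proj ∘ₗ Linear.leftComp ℂ Y.word X.proj)

/-- A word `σ`, viewed as the object `(σ, 1)` of the free product. -/
def ofWord (σ : Word C D) : FreeProd C D where
  word := σ
  proj := 𝟙 σ
  proj_mem := id_mem_ncpHom σ
  isProjection := ⟨Category.comp_id _, adj_id σ⟩

/-- The morphism space between two words in `C * D`. -/
def wordHoms (σ τ : Word C D) : Submodule ℂ (σ ⟶ τ) := homs (ofWord σ) (ofWord τ)

theorem wordHoms_eq (σ τ : Word C D) : wordHoms σ τ = ncpHom σ τ := by
  have h : (Linear.rightComp ℂ σ (𝟙 τ) ∘ₗ Linear.leftComp ℂ τ (𝟙 σ)) = LinearMap.id :=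
    LinearMap.ext fun f => by simp
  exact (congrArg (fun l => (ncpHom σ τ).map l) h).trans (Submodule.map_id _)

end FreeProd

/-- The words that represent the simple objects of `C * D`: alternating words with letters in `IC`
and `ID`, including the empty word, which represents the tensor unit. -/
def IrrWord (IC : Set C) (ID : Set D) : Type (max u₁ u₂) :=
  {σ : Word C D // σ.letters.IsChain (fun x y => x.isLeft ≠ y.isLeft) ∧
    ∀ x ∈ σ.letters, Sum.elim (· ∈ IC) (· ∈ ID) x}

/-- The underlying word. -/
def IrrWord.word {IC : Set C} {ID : Set D} (a : IrrWord IC ID) : Word C D := a.1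

/-- The set `W` of the words in `IrrWord IC ID` of positive even length that start with a letter of `C`. -/
def evenWords (IC : Set C) (ID : Set D) : Set (IrrWord IC ID) :=
  {w | Even w.word.letters.length ∧ ∃ a ∈ IC, w.word.letters.head? = some (Sum.inl a)}

/-- `w = v ^ k` with the largest possible exponent `k`, i.e. `v` is the primitive period of `w`. -/
def IsPrimitivePeriod (v : Word C D) (k : ℕ) (w : Word C D) : Prop :=
  w.letters = (List.replicate k v.letters).flatten ∧
    ∀ (v' : Word C D) (k' : ℕ), w.letters = (List.replicate k' v'.letters).flatten → k' ≤ k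

end FreeProduct

/-! ### Annular algebras of the free product -/

section Annular

open FreeProd

variable {C : Type u₁} [Category.{v₁} C] [MonoidalCategory C] [Preadditive C] [Linear ℂ C]
variable {D : Type u₂} [Category.{v₂} D] [MonoidalCategory D] [Preadditive D] [Linear ℂ D]
variable [MonoidalPreadditive C] [MonoidalLinear ℂ C] [StarCategory C]
variable [MonoidalPreadditive D] [MonoidalLinear ℂ D] [StarCategory D]
variable {IC : Set C} {ID : Set D}

/-- `s` is an orthonormal basis of `(C * D)(c, τ)` for the inner product with `g* ∘ f = ⟨f, g⟩ 1_c`. -/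
structure IsOnb (c τ : Word C D) (s : Finset (c ⟶ τ)) : Prop where
  norm_one : ∀ u ∈ s, u ≫ adj u = 𝟙 c
  orthogonal : ∀ u ∈ s, ∀ u' ∈ s, u ≠ u' → u ≫ adj u' = 0
  span_eq : Submodule.span ℂ (s : Set (c ⟶ τ)) = wordHoms c τ

open Classical in
/-- A chosen orthonormal basis of `(C * D)(c, τ)`; it exists when `c` is simple. -/
def onb (c τ : Word C D) : Finset (c ⟶ τ) := if h : ∃ s, IsOnb c τ s then h.choose else ∅

/-- A dual of the simple object `a` of `C * D`: the representative of the conjugate of `a`, with a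
solution of the duality equations in `C * D`. -/
structure DualData (a : IrrWord IC ID) where
  bar : IrrWord IC ID
  R : 𝟙_ (Word C D) ⟶ bar.word ⊗ a.word
  R' : 𝟙_ (Word C D) ⟶ a.word ⊗ bar.word
  R_mem : R ∈ wordHoms (𝟙_ (Word C D)) (bar.word ⊗ a.word)
  R'_mem : R' ∈ wordHoms (𝟙_ (Word C D)) (a.word ⊗ bar.word)
  solves : SolvesDuality R R'

/-- The ambient space of the centralizer algebra of weight `w`: families of morphisms
`f a : a ⊗ w ⟶ w ⊗ a` of the ambient category, indexed by the simple objects `a` of `C * D`. -/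
abbrev AnnularFamily (IC : Set C) (ID : Set D) (w : Word C D) : Type (max u₁ u₂ v₁ v₂) :=
  ∀ a : IrrWord IC ID, (a.word ⊗ w ⟶ w ⊗ a.word)

variable (IC ID) in
/-- The weight `w` centralizer algebra
`AΛ_{w,w} = ⨁_a (C * D)(a ⊗ w, w ⊗ a)`, where `a` runs over the simple objects of `C * D`: the
families of finite support with values in the morphism spaces of `C * D`. -/
def centralizerAlgebra (w : Word C D) : Submodule ℂ (AnnularFamily IC ID w) where
  carrier := {f | {a | f a ≠ 0}.Finite ∧ ∀ a, f a ∈ wordHoms (a.word ⊗ w) (w ⊗ a.word)}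
  zero_mem' := ⟨by simp, fun _ => zero_mem _⟩
  add_mem' := fun {f g} hf hg =>
    ⟨(hf.1.union hg.1).subset fun a ha => by
      by_contra h
      simp only [Set.mem_union, Set.mem_ofPred_eq, not_or, not_not] at h
      exact ha (by rw [Pi.add_apply, h.1, h.2, add_zero]),
    fun a => add_mem (hf.2 a) (hg.2 a)⟩
  smul_mem' := fun c f hf =>
    ⟨hf.1.subset fun a ha h => ha (by rw [Pi.smul_apply, h, smul_zero]),
    fun a => Submodule.smul_mem _ c (hf.2 a)⟩

/-- The product of `f ∈ C(a₁ ⊗ w, w ⊗ a₁)` and `g ∈ C(a₂ ⊗ w, w ⊗ a₂)` relative to `u : c ⟶ a₁ ⊗ a₂`,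
namely `(1_w ⊗ u*) (f ⊗ 1) (1 ⊗ g) (u ⊗ 1_w)`. -/
def annularTerm {w a₁ a₂ c : Word C D} (f : a₁ ⊗ w ⟶ w ⊗ a₁) (g : a₂ ⊗ w ⟶ w ⊗ a₂)
    (u : c ⟶ a₁ ⊗ a₂) : c ⊗ w ⟶ w ⊗ c :=
  (u ▷ w) ≫ (α_ a₁ a₂ w).hom ≫ (a₁ ◁ g) ≫ (α_ a₁ w a₂).inv ≫ (f ▷ a₂) ≫ (α_ w a₁ a₂).hom ≫
    (w ◁ adj u)

/-- The multiplication of the annular algebra: the component at `c` of `f · g` is the sum of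
`(1 ⊗ u*) (f_{a₁} ⊗ 1) (1 ⊗ g_{a₂}) (u ⊗ 1)` over all `a₁`, `a₂` and all `u` in an orthonormal basis of
`(C * D)(c, a₁ ⊗ a₂)`. -/
def annularMul {w : Word C D} (f g : AnnularFamily IC ID w) : AnnularFamily IC ID w := fun c =>
  ∑ᶠ (a₁ : IrrWord IC ID) (a₂ : IrrWord IC ID),
    ∑ u ∈ onb c.word (a₁.word ⊗ a₂.word), annularTerm (f a₁) (g a₂) u

/-- The morphism `f^# = (R* ⊗ 1_w ⊗ 1) (1 ⊗ f* ⊗ 1) (1 ⊗ 1_w ⊗ R')` from `ā ⊗ w` to `w ⊗ ā`. -/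
def annularAdjTerm {w : Word C D} {a : IrrWord IC ID} (d : DualData a)
    (f : a.word ⊗ w ⟶ w ⊗ a.word) : d.bar.word ⊗ w ⟶ w ⊗ d.bar.word :=
  d.bar.word ◁ ((ρ_ w).inv ≫ (w ◁ d.R') ≫ (α_ w a.word d.bar.word).inv ≫ (adj f ▷ d.bar.word) ≫
      (α_ a.word w d.bar.word).hom) ≫
    (α_ d.bar.word a.word (w ⊗ d.bar.word)).inv ≫
    (adj d.R ▷ (w ⊗ d.bar.word)) ≫ (λ_ (w ⊗ d.bar.word)).hom

open Classical in
/-- The involution `#` of the annular algebra: it sends the component of `f` at `a` to the component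
at the conjugate of `a`. Every simple object has a dual, and `#` does not depend on its choice. -/
def annularAdj {w : Word C D} (f : AnnularFamily IC ID w) : AnnularFamily IC ID w :=
  ∑ᶠ a : IrrWord IC ID, if h : Nonempty (DualData a) then
    Pi.single h.some.bar (annularAdjTerm h.some (f a)) else 0

open Classical in
/-- If `v w = w v` as words, the identity of this word is a morphism `v ⊗ w ⟶ w ⊗ v`, the rotation by
`v`. -/
def wordRotation {w : Word C D} (v : IrrWord IC ID) (h : v.word ⊗ w = w ⊗ v.word) :
    AnnularFamily IC ID w :=
  Pi.single v (eqToHom h)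

/-- The `*`-structure of a group algebra: the conjugate linear extension of `g ↦ g⁻¹`. -/
def groupAlgebraStar {G : Type*} [Group G] (x : MonoidAlgebra ℂ G) : MonoidAlgebra ℂ G :=
  x.coeff.sum fun g c => MonoidAlgebra.single g⁻¹ (starRingEnd ℂ c)

end Annular

end

/-! The engine is Schur's lemma for non-crossing partitions. In an alternating word a run of
neighbouring letters of one colour has at most one letter, and a nontrivial simple object admits no
nonzero morphism from the unit. Counting letters block by block shows, for words with letters in
`IC` and `ID`: if `τ` is alternating and `σ` is not longer, then every partition from `σ` to `τ`
evaluates to zero unless `σ = τ`, and then to a multiple of the identity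
(`NCP.eval_eq_smul_eqToHom`). The other word need not alternate. This is decisive, since `a ⊗ w` and
`w ⊗ a` have equal length and it is enough that one of them alternates.

The word `w` starts in `C` and ends in `D`. If `a` is empty or starts in `C`, then `wa` alternates,
so a nonzero morphism `aw ⟶ wa` forces `aw = wa` and is a multiple of the identity of that word. The
words commuting with `w` are the powers of one word `v` (`List.exists_root_of_commuting`), which is
the primitive period of `w`. If `a` starts in `D`, the involution `#` passes to the conjugate `ā`,
which ends in `D`. Either `ā` starts in `C` and is a power of `v`, or `āw` alternates and differs
from `wā`, so that the summand vanishes. Hence the algebra is spanned by the rotations by `v ^ n`,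
`n ≥ 0`, and their adjoints (`RotationData.classification`). They are nonzero and lie in pairwise
different summands.

For the product, morphisms `aw ⟶ wa` with an arbitrary word `a` are drawn on an annulus, and those
that differ by pushing a morphism once around are identified. The classes form a monoid under
juxtaposition, in which the rotation by `v` is invertible: the inverse is the rotation by the dual
word, by the zigzag equations. Taking the component at a simple object is well defined on classes
(`annProj_slide`, Schur again), and the product of the algebra consists of the components of the
juxtaposition. So the powers of the rotation multiply like `ℤ` (`RotationData.annProj_family`). The
operation `#` reverses products, sends the rotation to its inverse, and does not depend on the
chosen duals, because these are unique up to a scalar that cancels.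

The groundwork is threefold. All rebracketings of words are equalities of words
(`isStr_associator`). The spaces `ncpHom` are closed under composition, tensor products and adjoints
(`comp_mem_ncpHom`, `whiskerRight_mem`, `adj_mem`). A faithful positive functional on endomorphisms
yields orthonormal bases (`exists_isOnb`). -/

set_option linter.unusedSectionVars false

noncomputable section

open StarCategory (adj)

/-! ### Structural morphisms: identities up to an equality of objects -/

section Strict
variable {C : Type u₁} [Category.{v₁} C]

/-- A morphism which only changes the presentation of its source. -/
def IsStr {X Y : C} (f : X ⟶ Y) : Prop := ∃ h : X = Y, f = eqToHom h

theorem isStr_id (X : C) : IsStr (𝟙 X) := ⟨rfl, rfl⟩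

theorem isStr_eqToHom {X Y : C} (h : X = Y) : IsStr (eqToHom h) := ⟨h, rfl⟩

theorem IsStr.comp {X Y Z : C} {f : X ⟶ Y} {g : Y ⟶ Z} (hf : IsStr f) (hg : IsStr g) :
    IsStr (f ≫ g) := by
  obtain ⟨rfl, rfl⟩ := hf
  obtain ⟨rfl, rfl⟩ := hg
  exact ⟨rfl, by simp⟩

theorem IsStr.inv {X Y : C} {e : X ≅ Y} (he : IsStr e.hom) : IsStr e.inv := by
  obtain ⟨h, he⟩ := he
  subst h
  refine ⟨rfl, ?_⟩
  rw [eqToHom_refl] at he ⊢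
  rw [← cancel_epi e.hom, e.hom_inv_id, he, Category.comp_id]

theorem IsStr.eq {X Y : C} {f g : X ⟶ Y} (hf : IsStr f) (hg : IsStr g) : f = g := by
  obtain ⟨h, rfl⟩ := hf
  obtain ⟨h', rfl⟩ := hg
  rfl

variable [MonoidalCategory C]

theorem IsStr.whiskerLeft {X Y : C} {f : X ⟶ Y} (hf : IsStr f) (Z : C) : IsStr (Z ◁ f) := by
  obtain ⟨rfl, rfl⟩ := hf
  exact ⟨rfl, by simp⟩

theorem IsStr.whiskerRight {X Y : C} {f : X ⟶ Y} (hf : IsStr f) (Z : C) : IsStr (f ▷ Z) := by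
  obtain ⟨rfl, rfl⟩ := hf
  exact ⟨rfl, by simp⟩

end Strict

/-! ### Adjoints of structural and unitary morphisms -/

section StarLemmas

variable {C : Type u₁} [Category.{v₁} C] [Preadditive C] [Linear ℂ C] [StarCategory C]

theorem adj_eqToHom {X Y : C} (h : X = Y) : adj (eqToHom h) = eqToHom h.symm := by
  subst h
  exact adj_id _

theorem IsUnitary.adj_eq_inv {X Y : C} {e : X ≅ Y} (h : IsUnitary e.hom) : adj e.hom = e.inv := by
  rw [← Iso.hom_comp_eq_id]
  exact h.1

theorem adj_inv_of_adj_hom {X Y : C} {e : X ≅ Y} (h : adj e.hom = e.inv) : adj e.inv = e.hom := by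
  rw [← h, StarCategory.adj_adj]

end StarLemmas

/-! ### Bilinearity of the tensor product in the tensor product category -/

namespace Deligne

variable {C : Type u₁} [Category.{v₁} C] [MonoidalCategory C] [Preadditive C] [Linear ℂ C]
variable {D : Type u₂} [Category.{v₂} D] [MonoidalCategory D] [Preadditive D] [Linear ℂ D]
variable [MonoidalPreadditive C] [MonoidalLinear ℂ C]
variable [MonoidalPreadditive D] [MonoidalLinear ℂ D]

theorem smul_tensorHom {X₁ Y₁ X₂ Y₂ : Deligne C D} (c : ℂ) (f : X₁ ⟶ Y₁) (g : X₂ ⟶ Y₂) :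
    (c • f) ⊗ₘ g = c • (f ⊗ₘ g) := by
  simp only [tensorHom_eq, map_smul, LinearMap.smul_apply]

theorem tensorHom_smul {X₁ Y₁ X₂ Y₂ : Deligne C D} (c : ℂ) (f : X₁ ⟶ Y₁) (g : X₂ ⟶ Y₂) :
    f ⊗ₘ (c • g) = c • (f ⊗ₘ g) := by
  simp only [tensorHom_eq, map_smul]

instance : MonoidalPreadditive (Deligne C D) where
  whiskerLeft_zero := by intros; rw [← id_tensorHom, tensorHom_zero]
  zero_whiskerRight := by intros; rw [← tensorHom_id, zero_tensorHom]
  whiskerLeft_add := by intros; simp only [← id_tensorHom, tensorHom_add]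
  add_whiskerRight := by intros; simp only [← tensorHom_id, add_tensorHom]

instance : MonoidalLinear ℂ (Deligne C D) where
  whiskerLeft_smul := by intros; simp only [← id_tensorHom, tensorHom_smul]
  smul_whiskerRight := by intros; simp only [← tensorHom_id, smul_tensorHom]

end Deligne

/-! ### Inductive steps for the coherence of rebracketing -/

section Rebracket

variable {C : Type u₁} [Category.{v₁} C] [MonoidalCategory C]

theorem whiskerLeft_eqToHom' (a : C) {X Y : C} (h : X = Y) :
    a ◁ eqToHom h = eqToHom (congrArg (a ⊗ ·) h) := by
  subst h
  simp

theorem rebracket_unit {T K TK : C} (p : T ⊗ K ≅ TK) (e : TK = TK) :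
    (λ_ T).hom ▷ K ≫ p.hom ≫ eqToHom e = (α_ (𝟙_ C) T K).hom ≫ 𝟙_ C ◁ p.hom ≫ (λ_ TK).hom := by
  simp

/-- Prepends one letter `a` to the first word. The final `eqToHom` is needed because the two
bracketings of a concatenation agree only up to associativity of list append. -/
theorem rebracket_step (a : C) {S T K ST TK STK S' : C} (p : S ⊗ T ≅ ST) (q : ST ⊗ K ≅ STK)
    (r : T ⊗ K ≅ TK) (t : S ⊗ TK ≅ S') (e : STK = S') (e' : a ⊗ STK = a ⊗ S')
    (h : p.hom ▷ K ≫ q.hom ≫ eqToHom e = (α_ S T K).hom ≫ S ◁ r.hom ≫ t.hom) :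
    (α_ a S T ≪≫ whiskerLeftIso a p).hom ▷ K ≫ (α_ a ST K ≪≫ whiskerLeftIso a q).hom ≫
      eqToHom e' =
    (α_ (a ⊗ S) T K).hom ≫ (a ⊗ S) ◁ r.hom ≫ (α_ a S TK ≪≫ whiskerLeftIso a t).hom := by
  rw [← whiskerLeft_eqToHom' a e]
  have h' := congrArg (a ◁ ·) h
  simp only [whiskerLeft_comp] at h'
  simp only [Iso.trans_hom, whiskerLeftIso_hom, comp_whiskerRight, Category.assoc, whisker_assoc,
    Iso.inv_hom_id_assoc, h']
  simp

theorem rebracket_empty_step (a : C) {S T : C} (p : S ⊗ 𝟙_ C ≅ T) (e : T = S) (e' : a ⊗ T = a ⊗ S)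
    (h : p.hom ≫ eqToHom e = (ρ_ S).hom) :
    (α_ a S (𝟙_ C) ≪≫ whiskerLeftIso a p).hom ≫ eqToHom e' = (ρ_ (a ⊗ S)).hom := by
  rw [← whiskerLeft_eqToHom' a e]
  have h' := congrArg (a ◁ ·) h
  simp only [whiskerLeft_comp] at h'
  simp only [Iso.trans_hom, whiskerLeftIso_hom, Category.assoc, h']
  simp

theorem rebracket_empty_unit (e : 𝟙_ C = 𝟙_ C) : (λ_ (𝟙_ C)).hom ≫ eqToHom e = (ρ_ (𝟙_ C)).hom := by
  simp [unitors_equal]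

end Rebracket

/-! ### The category of words is strict up to equality of words -/

namespace Word

section Append

variable {C : Type u₁} {D : Type u₂}

theorem append_assoc' (σ τ κ : Word C D) : append (append σ τ) κ = append σ (append τ κ) :=
  List.append_assoc σ τ κ

theorem append_empty (σ : Word C D) : append σ empty = σ := List.append_nil σ

end Append

section Iso

variable {C : Type u₁} [Category.{v₁} C] [MonoidalCategory C]
variable {D : Type u₂} [Category.{v₂} D] [MonoidalCategory D]

theorem leftIso_assoc : ∀ σ τ κ : Word C D,
    (leftIso σ τ).hom ▷ left κ ≫ (leftIso (append σ τ) κ).hom ≫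
      eqToHom (congrArg left (append_assoc' σ τ κ)) =
    (α_ _ _ _).hom ≫ left σ ◁ (leftIso τ κ).hom ≫ (leftIso σ (append τ κ)).hom
  | [], τ, κ => rebracket_unit (leftIso τ κ) rfl
  | Sum.inl a :: σ, τ, κ => rebracket_step a _ _ _ _ _ _ (leftIso_assoc σ τ κ)
  | Sum.inr _ :: σ, τ, κ => leftIso_assoc σ τ κ

theorem rightIso_assoc : ∀ σ τ κ : Word C D,
    (rightIso σ τ).hom ▷ right κ ≫ (rightIso (append σ τ) κ).hom ≫
      eqToHom (congrArg right (append_assoc' σ τ κ)) =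
    (α_ _ _ _).hom ≫ right σ ◁ (rightIso τ κ).hom ≫ (rightIso σ (append τ κ)).hom
  | [], τ, κ => rebracket_unit (rightIso τ κ) rfl
  | Sum.inr a :: σ, τ, κ => rebracket_step a _ _ _ _ _ _ (rightIso_assoc σ τ κ)
  | Sum.inl _ :: σ, τ, κ => rightIso_assoc σ τ κ

theorem leftIso_empty : ∀ σ : Word C D,
    (leftIso σ empty).hom ≫ eqToHom (congrArg left (append_empty σ)) = (ρ_ (left σ)).hom
  | [] => rebracket_empty_unit _
  | Sum.inl a :: σ => rebracket_empty_step a _ _ _ (leftIso_empty σ)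
  | Sum.inr _ :: σ => leftIso_empty σ

theorem rightIso_empty : ∀ σ : Word C D,
    (rightIso σ empty).hom ≫ eqToHom (congrArg right (append_empty σ)) = (ρ_ (right σ)).hom
  | [] => rebracket_empty_unit _
  | Sum.inr a :: σ => rebracket_empty_step a _ _ _ (rightIso_empty σ)
  | Sum.inl _ :: σ => rightIso_empty σ

end Iso

variable {C : Type u₁} [Category.{v₁} C] [MonoidalCategory C] [Preadditive C] [Linear ℂ C]
variable {D : Type u₂} [Category.{v₂} D] [MonoidalCategory D] [Preadditive D] [Linear ℂ D]

variable [MonoidalPreadditive C] [MonoidalLinear ℂ C]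
variable [MonoidalPreadditive D] [MonoidalLinear ℂ D]

theorem incl_eqToHom {σ τ : Word C D} (h : σ = τ) :
    incl.map (eqToHom h) = Deligne.tmul (X := toDeligne σ) (Y := toDeligne τ)
      (eqToHom (congrArg left h)) (eqToHom (congrArg right h)) := by
  subst h
  rfl

/-- The associator of words is the ambient associator conjugated by the rebracketings, and
`leftIso_assoc` and `rightIso_assoc` say that these cancel. Together with the unitors, every
coherence morphism thus becomes an `eqToHom`, so by `IsStr.eq` it is determined by its source and
target. -/
theorem isStr_associator (σ τ κ : Word C D) : IsStr (α_ σ τ κ).hom := by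
  refine ⟨append_assoc' σ τ κ, incl.map_injective ?_⟩
  rw [incl_eqToHom]
  change ((tensorIso _ _).inv ≫ ((tensorIso _ _).inv ⊗ₘ 𝟙 _)) ≫ (α_ _ _ _).hom ≫
    (𝟙 _ ⊗ₘ (tensorIso _ _).hom) ≫ (tensorIso _ _).hom = _
  have h : ((tensorIso σ τ).hom ⊗ₘ 𝟙 (toDeligne κ)) ≫ (tensorIso (append σ τ) κ).hom ≫
      Deligne.tmul (X := toDeligne (append (append σ τ) κ)) (Y := toDeligne (append σ (append τ κ)))
      (eqToHom (congrArg left (append_assoc' σ τ κ))) (eqToHom (congrArg right (append_assoc' σ τ κ)))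
      = (α_ _ _ _).hom ≫ (𝟙 (toDeligne σ) ⊗ₘ (tensorIso τ κ).hom) ≫
        (tensorIso σ (append τ κ)).hom := by
    have h1 := leftIso_assoc σ τ κ
    have h2 := rightIso_assoc σ τ κ
    rw [← tensorHom_id, ← id_tensorHom] at h1 h2
    exact congrArg₂ Deligne.tmul h1 h2
  rw [← h, tensorHom_id, tensorHom_id, Category.assoc, inv_hom_whiskerRight_assoc,
    Iso.inv_hom_id_assoc]

theorem isStr_leftUnitor (σ : Word C D) : IsStr (λ_ σ).hom := by
  refine ⟨rfl, incl.map_injective ?_⟩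
  change ((tensorIso empty σ).inv ≫ (𝟙 _ ⊗ₘ 𝟙 (toDeligne σ))) ≫ (λ_ (toDeligne σ)).hom = 𝟙 _
  have h : (tensorIso empty σ).hom = (λ_ (toDeligne σ)).hom := rfl
  rw [← h, id_tensorHom_id, Category.comp_id]
  exact Iso.inv_hom_id _

theorem isStr_rightUnitor (σ : Word C D) : IsStr (ρ_ σ).hom := by
  refine ⟨append_empty σ, incl.map_injective ?_⟩
  rw [incl_eqToHom]
  change ((tensorIso σ empty).inv ≫ (𝟙 (toDeligne σ) ⊗ₘ 𝟙 _)) ≫ (ρ_ (toDeligne σ)).hom = _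
  have h : (tensorIso σ empty).hom ≫
      Deligne.tmul (X := toDeligne (append σ empty)) (Y := toDeligne σ)
      (eqToHom (congrArg left (append_empty σ))) (eqToHom (congrArg right (append_empty σ)))
      = (ρ_ (toDeligne σ)).hom := congrArg₂ Deligne.tmul (leftIso_empty σ) (rightIso_empty σ)
  rw [← h, id_tensorHom_id, Category.comp_id, Iso.inv_hom_id_assoc]

instance : MonoidalPreadditive (Word C D) where
  whiskerLeft_zero {X Y Z} :=
    (by simp : (tensorIso X Y).inv ≫ (toDeligne X ◁ 0) ≫ (tensorIso X Z).hom = 0)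
  zero_whiskerRight {X Y Z} :=
    (by simp : (tensorIso Y X).inv ≫ (0 ▷ toDeligne X) ≫ (tensorIso Z X).hom = 0)
  whiskerLeft_add {X Y Z} f g :=
    (by simp : ∀ f g : toDeligne Y ⟶ toDeligne Z,
      (tensorIso X Y).inv ≫ (toDeligne X ◁ (f + g)) ≫ (tensorIso X Z).hom =
      (tensorIso X Y).inv ≫ (toDeligne X ◁ f) ≫ (tensorIso X Z).hom +
      (tensorIso X Y).inv ≫ (toDeligne X ◁ g) ≫ (tensorIso X Z).hom) f g
  add_whiskerRight {X Y Z} f g :=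
    (by simp : ∀ f g : toDeligne Y ⟶ toDeligne Z,
      (tensorIso Y X).inv ≫ ((f + g) ▷ toDeligne X) ≫ (tensorIso Z X).hom =
      (tensorIso Y X).inv ≫ (f ▷ toDeligne X) ≫ (tensorIso Z X).hom +
      (tensorIso Y X).inv ≫ (g ▷ toDeligne X) ≫ (tensorIso Z X).hom) f g

instance : MonoidalLinear ℂ (Word C D) where
  whiskerLeft_smul X {Y Z} c f :=
    (by simp : ∀ f : toDeligne Y ⟶ toDeligne Z,
      (tensorIso X Y).inv ≫ (toDeligne X ◁ (c • f)) ≫ (tensorIso X Z).hom =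
      c • ((tensorIso X Y).inv ≫ (toDeligne X ◁ f) ≫ (tensorIso X Z).hom)) f
  smul_whiskerRight c {Y Z} f X :=
    (by simp : ∀ f : toDeligne Y ⟶ toDeligne Z,
      (tensorIso Y X).inv ≫ ((c • f) ▷ toDeligne X) ≫ (tensorIso Z X).hom =
      c • ((tensorIso Y X).inv ≫ (f ▷ toDeligne X) ≫ (tensorIso Z X).hom)) f

end Word

/-! ### Compatibility of the adjoint with the tensor product of words -/

section Rigid

open Word RigidCStarTensorCategory

section General

variable {C : Type u₁} [Category.{v₁} C] [MonoidalCategory C] [Preadditive C] [Linear ℂ C]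
  [MonoidalPreadditive C] [MonoidalLinear ℂ C] [RigidCStarTensorCategory C]

theorem RigidCStarTensorCategory.adj_whiskerLeft (X : C) {Y Z : C} (f : Y ⟶ Z) :
    adj (X ◁ f) = X ◁ adj f := by
  rw [← id_tensorHom, adj_tensorHom, adj_id, id_tensorHom]

end General

variable {C : Type u₁} [Category.{v₁} C] [MonoidalCategory C] [Preadditive C] [Linear ℂ C]
  [MonoidalPreadditive C] [MonoidalLinear ℂ C] [RigidCStarTensorCategory C]
variable {D : Type u₂} [Category.{v₂} D] [MonoidalCategory D] [Preadditive D] [Linear ℂ D]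
  [MonoidalPreadditive D] [MonoidalLinear ℂ D] [RigidCStarTensorCategory D]

theorem rebracket_adj_step (a : C) {S T ST : C} (p : S ⊗ T ≅ ST) (h : adj p.hom = p.inv) :
    adj (α_ a S T ≪≫ whiskerLeftIso a p).hom = (α_ a S T ≪≫ whiskerLeftIso a p).inv := by
  simp only [Iso.trans_hom, whiskerLeftIso_hom, StarCategory.adj_comp,
    RigidCStarTensorCategory.adj_whiskerLeft, h, (unitary_associator a S T).adj_eq_inv,
    Iso.trans_inv, whiskerLeftIso_inv]

theorem adj_leftIso : ∀ σ τ : Word C D, adj (leftIso σ τ).hom = (leftIso σ τ).inv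
  | [], _ => (unitary_leftUnitor _).adj_eq_inv
  | Sum.inl a :: σ, τ => rebracket_adj_step a _ (adj_leftIso σ τ)
  | Sum.inr _ :: σ, τ => adj_leftIso σ τ

theorem adj_rightIso : ∀ σ τ : Word C D, adj (rightIso σ τ).hom = (rightIso σ τ).inv
  | [], _ => (unitary_leftUnitor _).adj_eq_inv
  | Sum.inr a :: σ, τ => rebracket_adj_step a _ (adj_rightIso σ τ)
  | Sum.inl _ :: σ, τ => adj_rightIso σ τ

/-- The rebracketings are unitary, being composed of associators and unitors, so conjugation by them
commutes with the adjoint. -/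
theorem adj_tensorIso (σ τ : Word C D) : adj (tensorIso σ τ).hom = (tensorIso σ τ).inv :=
  congrArg₂ Deligne.tmul (adj_leftIso σ τ) (adj_rightIso σ τ)

theorem Deligne.adj_tensorHom {X₁ Y₁ X₂ Y₂ : Deligne C D} (f : X₁ ⟶ Y₁) (g : X₂ ⟶ Y₂) :
    adj (f ⊗ₘ g) = adj f ⊗ₘ adj g := by
  induction f using hom_induction with
  | zero => rw [zero_tensorHom, map_zero, map_zero, zero_tensorHom]
  | add f f' h h' => rw [add_tensorHom, map_add, map_add, add_tensorHom, h, h']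
  | tmul a b =>
    induction g using hom_induction with
    | zero => rw [tensorHom_zero, map_zero, map_zero, tensorHom_zero]
    | add f f' h h' => rw [tensorHom_add, map_add, map_add, tensorHom_add, h, h']
    | tmul c d =>
      exact congrArg₂ Deligne.tmul (RigidCStarTensorCategory.adj_tensorHom a c)
        (RigidCStarTensorCategory.adj_tensorHom b d)

theorem Word.adj_tensorHom {σ τ κ ν : Word C D} (f : σ ⟶ τ) (g : κ ⟶ ν) :
    adj (f ⊗ₘ g) = adj f ⊗ₘ adj g := by
  have h : ∀ (f : toDeligne σ ⟶ toDeligne τ) (g : toDeligne κ ⟶ toDeligne ν),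
      adj ((tensorIso σ κ).inv ≫ (f ⊗ₘ g) ≫ (tensorIso τ ν).hom) =
      (tensorIso τ ν).inv ≫ (adj f ⊗ₘ adj g) ≫ (tensorIso σ κ).hom := by
    intro f g
    rw [StarCategory.adj_comp, StarCategory.adj_comp, Deligne.adj_tensorHom, adj_tensorIso,
      adj_inv_of_adj_hom (adj_tensorIso _ _), Category.assoc]
  exact h f g

@[simp]
theorem Word.adj_whiskerLeft (ρ : Word C D) {σ τ : Word C D} (f : σ ⟶ τ) :
    adj (ρ ◁ f) = ρ ◁ adj f := by
  rw [← id_tensorHom, adj_tensorHom, adj_id, id_tensorHom]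

@[simp]
theorem Word.adj_whiskerRight (ρ : Word C D) {σ τ : Word C D} (f : σ ⟶ τ) :
    adj (f ▷ ρ) = adj f ▷ ρ := by
  rw [← tensorHom_id, adj_tensorHom, adj_id, tensorHom_id]

theorem IsStr.adj_hom {σ τ : Word C D} {e : σ ≅ τ} (h : IsStr e.hom) : adj e.hom = e.inv := by
  refine IsStr.eq ?_ h.inv
  obtain ⟨h, h'⟩ := h
  rw [h', adj_eqToHom]
  exact isStr_eqToHom _

@[simp]
theorem Word.adj_associator_hom (σ τ κ : Word C D) : adj (α_ σ τ κ).hom = (α_ σ τ κ).inv :=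
  (isStr_associator _ _ _).adj_hom

@[simp]
theorem Word.adj_associator_inv (σ τ κ : Word C D) : adj (α_ σ τ κ).inv = (α_ σ τ κ).hom :=
  adj_inv_of_adj_hom (adj_associator_hom _ _ _)

@[simp]
theorem Word.adj_leftUnitor_hom (σ : Word C D) : adj (λ_ σ).hom = (λ_ σ).inv :=
  (isStr_leftUnitor _).adj_hom

@[simp]
theorem Word.adj_leftUnitor_inv (σ : Word C D) : adj (λ_ σ).inv = (λ_ σ).hom :=
  adj_inv_of_adj_hom (adj_leftUnitor_hom _)

@[simp]
theorem Word.adj_rightUnitor_hom (σ : Word C D) : adj (ρ_ σ).hom = (ρ_ σ).inv :=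
  (isStr_rightUnitor _).adj_hom

@[simp]
theorem Word.adj_rightUnitor_inv (σ : Word C D) : adj (ρ_ σ).inv = (ρ_ σ).hom :=
  adj_inv_of_adj_hom (adj_rightUnitor_hom _)

end Rigid

/-! ### Diagram identities behind the closure of partitions under composition -/

section Diagrams

variable {C : Type u₁} [Category.{v₁} C] [MonoidalCategory C]

theorem whiskerRight_insert {σ₁ σ₂ α τ ρ : C} (b : α ⟶ 𝟙_ C) (t : σ₁ ⊗ σ₂ ⟶ τ) :
    ((σ₁ ◁ ((b ▷ σ₂) ≫ (λ_ σ₂).hom)) ≫ t) ▷ ρ =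
      ((α_ σ₁ (α ⊗ σ₂) ρ).hom ≫ σ₁ ◁ (α_ α σ₂ ρ).hom) ≫
        (σ₁ ◁ ((b ▷ (σ₂ ⊗ ρ)) ≫ (λ_ (σ₂ ⊗ ρ)).hom)) ≫ (α_ σ₁ σ₂ ρ).inv ≫ t ▷ ρ := by
  monoidal

theorem insert_whiskerRight {τ₁ τ₂ β σ ρ : C} (b : 𝟙_ C ⟶ β) (t : σ ⟶ τ₁ ⊗ τ₂) :
    (t ≫ (τ₁ ◁ ((λ_ τ₂).inv ≫ (b ▷ τ₂)))) ▷ ρ =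
      ((t ▷ ρ ≫ (α_ τ₁ τ₂ ρ).hom) ≫ (τ₁ ◁ ((λ_ (τ₂ ⊗ ρ)).inv ≫ (b ▷ (τ₂ ⊗ ρ))))) ≫
        (τ₁ ◁ (α_ β τ₂ ρ).inv ≫ (α_ τ₁ (β ⊗ τ₂) ρ).inv) := by
  monoidal

theorem tensorHom_whiskerRight {α β σ τ ρ : C} (b : α ⟶ β) (t : σ ⟶ τ) :
    (b ⊗ₘ t) ▷ ρ = ((α_ α σ ρ).hom ≫ (b ⊗ₘ (t ▷ ρ))) ≫ (α_ β τ ρ).inv := by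
  simp only [MonoidalCategory.tensorHom_def]
  monoidal

/-- The `merge_*` identities treat a block `g` placed over new strands `α₀` on the left and an
initial segment of the top of a diagram. There is one identity for each position of that segment
relative to the last inserted block. -/
theorem merge_into_through {α₀ α₁ β K δ σ τ : C} (b : α₁ ⟶ β ⊗ K) (t : σ ⟶ τ)
    (g : α₀ ⊗ β ⟶ δ) :
    (α₀ ◁ ((b ⊗ₘ t) ≫ (α_ β K τ).hom)) ≫ (α_ α₀ β (K ⊗ τ)).inv ≫ g ▷ (K ⊗ τ) =
      ((α_ α₀ α₁ σ).inv ≫ ((α₀ ◁ b ≫ (α_ α₀ β K).inv ≫ g ▷ K) ⊗ₘ t)) ≫ (α_ δ K τ).hom := by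
  simp only [MonoidalCategory.tensorHom_def']
  monoidal

theorem merge_through {α₀ α₁ β K δ σ ρ : C} (b : α₁ ⟶ β) (t : σ ⟶ K ⊗ ρ)
    (g : α₀ ⊗ (β ⊗ K) ⟶ δ) :
    (α₀ ◁ ((b ⊗ₘ t) ≫ (α_ β K ρ).inv)) ≫ (α_ α₀ (β ⊗ K) ρ).inv ≫ g ▷ ρ =
      (α_ α₀ α₁ σ).inv ≫ ((α₀ ⊗ α₁) ◁ (t ≫ 𝟙 _)) ≫ (α_ (α₀ ⊗ α₁) K ρ).inv ≫
        ((α_ α₀ α₁ K).hom ≫ α₀ ◁ (b ▷ K) ≫ g) ▷ ρ := by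
  have h : b ⊗ₘ t = α₁ ◁ t ≫ b ▷ (K ⊗ ρ) := MonoidalCategory.tensorHom_def' _ _
  rw [h]
  monoidal

theorem merge_cap {α₀ α₁ α ρ δ σ : C} {τ : C} (b : α₁ ⟶ 𝟙_ C) (t : σ ⟶ τ) (s : τ ⟶ α ⊗ ρ)
    (g : α₀ ⊗ α ⟶ δ) :
    (α₀ ◁ ((b ⊗ₘ t) ≫ (λ_ τ).hom ≫ s)) ≫ (α_ α₀ α ρ).inv ≫ g ▷ ρ =
      (α₀ ◁ ((b ▷ σ) ≫ (λ_ σ).hom)) ≫ ((α₀ ◁ (t ≫ s)) ≫ (α_ α₀ α ρ).inv ≫ g ▷ ρ) := by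
  simp only [MonoidalCategory.tensorHom_def]
  simp

theorem merge_insert_left {α₀ α K τ₂ β σ δ : C} (b : 𝟙_ C ⟶ β) (t : σ ⟶ (α ⊗ K) ⊗ τ₂)
    (g : α₀ ⊗ α ⟶ δ) :
    (α₀ ◁ ((t ≫ ((α ⊗ K) ◁ ((λ_ τ₂).inv ≫ (b ▷ τ₂)))) ≫ (α_ α K (β ⊗ τ₂)).hom)) ≫
      (α_ α₀ α (K ⊗ (β ⊗ τ₂))).inv ≫ g ▷ (K ⊗ (β ⊗ τ₂)) =
    ((((α₀ ◁ (t ≫ (α_ α K τ₂).hom)) ≫ (α_ α₀ α (K ⊗ τ₂)).inv ≫ g ▷ (K ⊗ τ₂)) ≫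
      (α_ δ K τ₂).inv) ≫ ((δ ⊗ K) ◁ ((λ_ τ₂).inv ≫ (b ▷ τ₂)))) ≫ (α_ δ K (β ⊗ τ₂)).hom := by
  have h : g ▷ (K ⊗ τ₂) ≫ δ ◁ (K ◁ ((λ_ τ₂).inv ≫ (b ▷ τ₂))) =
    (α₀ ⊗ α) ◁ (K ◁ ((λ_ τ₂).inv ≫ (b ▷ τ₂))) ≫ g ▷ _ := (whisker_exchange _ _).symm
  have h2 : ((g ▷ (K ⊗ τ₂)) ≫ (α_ δ K τ₂).inv) ≫ ((δ ⊗ K) ◁ ((λ_ τ₂).inv ≫ (b ▷ τ₂))) ≫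
      (α_ δ K (β ⊗ τ₂)).hom = (α₀ ⊗ α) ◁ (K ◁ ((λ_ τ₂).inv ≫ (b ▷ τ₂))) ≫ g ▷ _ := by
    rw [← h]; monoidal
  simp only [Category.assoc] at h2 ⊢
  rw [h2]
  monoidal

theorem merge_insert_mid {α₀ τ₁ β K ρ σ δ : C} (b : 𝟙_ C ⟶ β) (t : σ ⟶ τ₁ ⊗ (K ⊗ ρ))
    (g : α₀ ⊗ (τ₁ ⊗ (β ⊗ K)) ⟶ δ) :
    (α₀ ◁ ((t ≫ (τ₁ ◁ ((λ_ (K ⊗ ρ)).inv ≫ (b ▷ (K ⊗ ρ))))) ≫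
        (τ₁ ◁ (α_ β K ρ).inv ≫ (α_ τ₁ (β ⊗ K) ρ).inv))) ≫
      (α_ α₀ (τ₁ ⊗ (β ⊗ K)) ρ).inv ≫ g ▷ ρ =
    (α₀ ◁ (t ≫ (α_ τ₁ K ρ).inv)) ≫ (α_ α₀ (τ₁ ⊗ K) ρ).inv ≫
      (α₀ ◁ τ₁ ◁ ((λ_ K).inv ≫ b ▷ K) ≫ g) ▷ ρ := by
  monoidal

theorem merge_insert_right {α₀ τ₁ K K' τ₂ σ δ : C} (b : 𝟙_ C ⟶ K ⊗ K') (t : σ ⟶ τ₁ ⊗ τ₂)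
    (g : α₀ ⊗ (τ₁ ⊗ K) ⟶ δ) :
    (α₀ ◁ ((t ≫ (τ₁ ◁ ((λ_ τ₂).inv ≫ (b ▷ τ₂)))) ≫
        (τ₁ ◁ (α_ K K' τ₂).hom ≫ (α_ τ₁ K (K' ⊗ τ₂)).inv))) ≫
      (α_ α₀ (τ₁ ⊗ K) (K' ⊗ τ₂)).inv ≫ g ▷ (K' ⊗ τ₂) =
    ((α₀ ◁ (t ≫ 𝟙 _)) ≫ (α_ α₀ τ₁ τ₂).inv ≫
      (((ρ_ _).inv ≫ (α_ α₀ τ₁ (𝟙_ C)).hom ≫ α₀ ◁ (τ₁ ◁ b ≫ (α_ τ₁ K K').inv) ≫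
        (α_ α₀ (τ₁ ⊗ K) K').inv ≫ g ▷ K') ▷ τ₂)) ≫ (α_ δ K' τ₂).hom := by
  monoidal

theorem merge_trivial {α₀ ρ δ σ : C} (t : σ ⟶ ρ) (g : α₀ ⊗ 𝟙_ C ⟶ δ) :
    (α₀ ◁ (t ≫ (λ_ ρ).inv)) ≫ (α_ α₀ (𝟙_ C) ρ).inv ≫ g ▷ ρ = ((ρ_ α₀).inv ≫ g) ⊗ₘ t := by
  have h : ((ρ_ α₀).inv ≫ g) ⊗ₘ t = α₀ ◁ t ≫ ((ρ_ α₀).inv ≫ g) ▷ ρ := MonoidalCategory.tensorHom_def' _ _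
  rw [h]
  monoidal

/-- The `comp_*` identities treat a block `g` stacked on neighbouring top letters. Here `g` overlaps
the inserted block `b`: `a₁`, `a₂` are the parts of `α` outside `β`, and `b₁`, `b₂` the parts of `β`
outside `α`. The two blocks fuse into one from `a₁a₂` to `b₁δb₂`. -/
theorem comp_overlap {σ ρ' ρ'' a₁ a₂ b₁ b₂ α β δ : C} (e : a₁ ⊗ (β ⊗ a₂) ⟶ b₁ ⊗ (α ⊗ b₂))
    (b : 𝟙_ C ⟶ β) (g : α ⟶ δ) (t : σ ⟶ (ρ' ⊗ a₁) ⊗ (a₂ ⊗ ρ'')) :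
    (t ≫ ((ρ' ⊗ a₁) ◁ ((λ_ (a₂ ⊗ ρ'')).inv ≫ b ▷ (a₂ ⊗ ρ'')))) ≫
      ((α_ ρ' a₁ _).hom ≫ ρ' ◁ (a₁ ◁ (α_ β a₂ ρ'').inv ≫ (α_ a₁ _ ρ'').inv ≫ e ▷ ρ'' ≫
        (α_ b₁ (α ⊗ b₂) ρ'').hom ≫ b₁ ◁ (α_ α b₂ ρ'').hom) ≫ (α_ ρ' b₁ _).inv) ≫
      (ρ' ⊗ b₁) ◁ (g ▷ (b₂ ⊗ ρ'')) =
    (t ≫ ((α_ ρ' a₁ _).hom ≫ ρ' ◁ (α_ a₁ a₂ ρ'').inv) ≫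
      ρ' ◁ ((a₁ ◁ ((λ_ a₂).inv ≫ b ▷ a₂) ≫ e ≫ b₁ ◁ (g ▷ b₂)) ▷ ρ'')) ≫
      (ρ' ◁ ((α_ b₁ (δ ⊗ b₂) ρ'').hom ≫ b₁ ◁ (α_ δ b₂ ρ'').hom) ≫ (α_ ρ' b₁ _).inv) := by
  monoidal

theorem comp_disjoint_right {σ τ₁ β K α ρ₂ δ : C} (b : 𝟙_ C ⟶ β) (g : α ⟶ δ)
    (t : σ ⟶ τ₁ ⊗ (K ⊗ (α ⊗ ρ₂))) :
    (t ≫ (τ₁ ◁ ((λ_ (K ⊗ (α ⊗ ρ₂))).inv ≫ (b ▷ (K ⊗ (α ⊗ ρ₂)))))) ≫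
      (τ₁ ◁ (α_ β K (α ⊗ ρ₂)).inv ≫ (α_ τ₁ (β ⊗ K) (α ⊗ ρ₂)).inv) ≫
      (τ₁ ⊗ (β ⊗ K)) ◁ (g ▷ ρ₂) =
    (((t ≫ (α_ τ₁ K (α ⊗ ρ₂)).inv ≫ (τ₁ ⊗ K) ◁ (g ▷ ρ₂)) ≫ (α_ τ₁ K (δ ⊗ ρ₂)).hom) ≫
      (τ₁ ◁ ((λ_ (K ⊗ (δ ⊗ ρ₂))).inv ≫ (b ▷ (K ⊗ (δ ⊗ ρ₂)))))) ≫
      (τ₁ ◁ (α_ β K (δ ⊗ ρ₂)).inv ≫ (α_ τ₁ (β ⊗ K) (δ ⊗ ρ₂)).inv) := by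
  have h : (b ▷ (K ⊗ (α ⊗ ρ₂))) ≫ β ◁ (K ◁ (g ▷ ρ₂)) =
    (𝟙_ C) ◁ (K ◁ (g ▷ ρ₂)) ≫ b ▷ (K ⊗ (δ ⊗ ρ₂)) := (whisker_exchange _ _).symm
  trans t ≫ τ₁ ◁ ((λ_ _).inv ≫ ((b ▷ (K ⊗ (α ⊗ ρ₂))) ≫ β ◁ (K ◁ (g ▷ ρ₂))) ≫
    (α_ β K (δ ⊗ ρ₂)).inv) ≫ (α_ τ₁ (β ⊗ K) (δ ⊗ ρ₂)).inv
  · monoidal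
  · rw [h]
    monoidal

theorem comp_disjoint_left {σ τ₂ β K α ρ₁ δ : C} (b : 𝟙_ C ⟶ β) (g : α ⟶ δ)
    (t : σ ⟶ (ρ₁ ⊗ (α ⊗ K)) ⊗ τ₂) :
    (t ≫ ((ρ₁ ⊗ (α ⊗ K)) ◁ ((λ_ τ₂).inv ≫ (b ▷ τ₂)))) ≫
      ((α_ ρ₁ (α ⊗ K) (β ⊗ τ₂)).hom ≫ ρ₁ ◁ (α_ α K (β ⊗ τ₂)).hom) ≫
      ρ₁ ◁ (g ▷ (K ⊗ (β ⊗ τ₂))) =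
    (((t ≫ ((α_ ρ₁ (α ⊗ K) τ₂).hom ≫ ρ₁ ◁ (α_ α K τ₂).hom) ≫ ρ₁ ◁ (g ▷ (K ⊗ τ₂))) ≫
      (ρ₁ ◁ (α_ δ K τ₂).inv ≫ (α_ ρ₁ (δ ⊗ K) τ₂).inv)) ≫
      ((ρ₁ ⊗ (δ ⊗ K)) ◁ ((λ_ τ₂).inv ≫ (b ▷ τ₂)))) ≫
      ((α_ ρ₁ (δ ⊗ K) (β ⊗ τ₂)).hom ≫ ρ₁ ◁ (α_ δ K (β ⊗ τ₂)).hom) := by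
  have h : α ◁ (K ◁ ((λ_ τ₂).inv ≫ (b ▷ τ₂))) ≫ g ▷ (K ⊗ (β ⊗ τ₂)) =
    g ▷ (K ⊗ τ₂) ≫ δ ◁ (K ◁ ((λ_ τ₂).inv ≫ (b ▷ τ₂))) := whisker_exchange _ _
  trans t ≫ ((α_ ρ₁ (α ⊗ K) τ₂).hom ≫ ρ₁ ◁ (α_ α K τ₂).hom) ≫
    ρ₁ ◁ (α ◁ (K ◁ ((λ_ τ₂).inv ≫ (b ▷ τ₂))) ≫ g ▷ (K ⊗ (β ⊗ τ₂)))
  · monoidal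
  · rw [h]
    monoidal

theorem comp_atLeft_right {α₀ β σ K α ρ₂ δ : C} (b : α₀ ⟶ β) (t : σ ⟶ K ⊗ (α ⊗ ρ₂)) (g : α ⟶ δ) :
    (b ⊗ₘ t) ≫ (α_ β K (α ⊗ ρ₂)).inv ≫ (β ⊗ K) ◁ (g ▷ ρ₂) =
      (b ⊗ₘ (t ≫ 𝟙 _ ≫ K ◁ (g ▷ ρ₂))) ≫ (α_ β K (δ ⊗ ρ₂)).inv := by
  simp only [MonoidalCategory.tensorHom_def]
  monoidal

theorem comp_atLeft_left {α₀ σ τ ρ₁ K α δ : C} (b : α₀ ⟶ ρ₁ ⊗ (α ⊗ K)) (t : σ ⟶ τ) (g : α ⟶ δ) :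
    (b ⊗ₘ t) ≫ ((α_ ρ₁ (α ⊗ K) τ).hom ≫ ρ₁ ◁ (α_ α K τ).hom) ≫ ρ₁ ◁ (g ▷ (K ⊗ τ)) =
      ((b ≫ ρ₁ ◁ (g ▷ K)) ⊗ₘ t) ≫ ((α_ ρ₁ (δ ⊗ K) τ).hom ≫ ρ₁ ◁ (α_ δ K τ).hom) := by
  have h : ∀ {β β' : C} (b : α₀ ⟶ β) (b' : β ⟶ β'), (b ≫ b') ⊗ₘ t = α₀ ◁ t ≫ b ▷ τ ≫ b' ▷ τ := by
    intro β β' b b'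
    rw [MonoidalCategory.tensorHom_def', comp_whiskerRight]
  have h' : b ⊗ₘ t = α₀ ◁ t ≫ b ▷ τ := MonoidalCategory.tensorHom_def' _ _
  rw [h, h']
  monoidal

theorem comp_atLeft_overlap {α₀ σ ρ₁ K K' ρ₂ δ : C} (b : α₀ ⟶ ρ₁ ⊗ K) (t : σ ⟶ K' ⊗ ρ₂)
    (g : K ⊗ K' ⟶ δ) :
    (b ⊗ₘ t) ≫ ((α_ ρ₁ K (K' ⊗ ρ₂)).hom ≫ ρ₁ ◁ (α_ K K' ρ₂).inv) ≫ ρ₁ ◁ (g ▷ ρ₂) =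
      ((α₀ ◁ (t ≫ 𝟙 _)) ≫ (α_ α₀ K' ρ₂).inv ≫
        (b ▷ K' ≫ (α_ ρ₁ K K').hom ≫ ρ₁ ◁ g) ▷ ρ₂) ≫ (α_ ρ₁ δ ρ₂).hom := by
  have h' : b ⊗ₘ t = α₀ ◁ t ≫ b ▷ (K' ⊗ ρ₂) := MonoidalCategory.tensorHom_def' _ _
  rw [h']
  monoidal

end Diagrams

/-! ### Monochromatic words and concatenation -/

section WordLemmas

variable {C : Type u₁} {D : Type u₂}

/-- All letters of the word have the colour `c` (`true` for `C` and `false` for `D`). -/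
def Word.Mono (c : Bool) (σ : Word C D) : Prop := ∀ x ∈ σ.letters, x.isLeft = c

theorem Word.mono_empty (c : Bool) : Mono c (empty : Word C D) := fun _ h => by cases h

variable [Category.{v₁} C] [MonoidalCategory C] [Preadditive C] [Linear ℂ C]
  [MonoidalPreadditive C] [MonoidalLinear ℂ C]
variable [Category.{v₂} D] [MonoidalCategory D] [Preadditive D] [Linear ℂ D]
  [MonoidalPreadditive D] [MonoidalLinear ℂ D]

theorem Word.mono_tensor {c : Bool} {σ τ : Word C D} : Mono c (σ ⊗ τ) ↔ Mono c σ ∧ Mono c τ := by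
  constructor
  · intro h
    exact ⟨fun x hx => h x (List.mem_append_left _ hx), fun x hx => h x (List.mem_append_right _ hx)⟩
  · rintro ⟨h, h'⟩ x hx
    rcases List.mem_append.1 hx with hx | hx
    exacts [h x hx, h' x hx]

theorem Word.Mono.eq_of_ne_empty {c c' : Bool} {σ : Word C D} (h : Mono c σ) (h' : Mono c' σ)
    (hσ : σ ≠ empty) : c = c' := by
  obtain ⟨x, hx⟩ := List.exists_mem_of_ne_nil _ hσ
  rw [← h x hx, ← h' x hx]

theorem Word.tensor_eq_tensor {σ τ κ ν : Word C D} (h : σ ⊗ τ = κ ⊗ ν) :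
    (∃ μ : Word C D, κ = σ ⊗ μ ∧ τ = μ ⊗ ν) ∨ (∃ μ : Word C D, σ = κ ⊗ μ ∧ ν = μ ⊗ τ) :=
  List.append_eq_append_iff.1 h

theorem Word.tensor_empty (σ : Word C D) : σ ⊗ (empty : Word C D) = σ := List.append_nil σ

theorem Word.empty_tensor (σ : Word C D) : (empty : Word C D) ⊗ σ = σ := rfl

theorem Word.tensor_assoc (σ τ κ : Word C D) : (σ ⊗ τ) ⊗ κ = σ ⊗ (τ ⊗ κ) := List.append_assoc σ τ κ

end WordLemmas

/-! ### Closure of `ncpHom` under tensor products and adjoints -/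

section Closure

open Word RigidCStarTensorCategory

variable {C : Type u₁} [Category.{v₁} C] [MonoidalCategory C] [Preadditive C] [Linear ℂ C]
  [MonoidalPreadditive C] [MonoidalLinear ℂ C] [RigidCStarTensorCategory C]
variable {D : Type u₂} [Category.{v₂} D] [MonoidalCategory D] [Preadditive D] [Linear ℂ D]
  [MonoidalPreadditive D] [MonoidalLinear ℂ D] [RigidCStarTensorCategory D]

theorem RigidCStarTensorCategory.exists_smul_eqToHom {X Y : D} (hX : X = 𝟙_ D) (hY : Y = 𝟙_ D)
    (f : X ⟶ Y) : ∃ z : ℂ, f = z • eqToHom (hX.trans hY.symm) := by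
  subst hX hY
  exact simple_unit.2 f

theorem Deligne.tmul_smul' {X Y : Deligne C D} (z : ℂ) (a : X.fst ⟶ Y.fst) (b : X.snd ⟶ Y.snd) :
    (tmul a (z • b) : X ⟶ Y) = tmul (z • a) b := TensorProduct.tmul_smul z a b

theorem Deligne.add_tmul' {X Y : Deligne C D} (a a' : X.fst ⟶ Y.fst) (b : X.snd ⟶ Y.snd) :
    (tmul (a + a') b : X ⟶ Y) = tmul a b + tmul a' b := TensorProduct.add_tmul a a' b

theorem Deligne.tmul_add' {X Y : Deligne C D} (a : X.fst ⟶ Y.fst) (b b' : X.snd ⟶ Y.snd) :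
    (tmul a (b + b') : X ⟶ Y) = tmul a b + tmul a b' := TensorProduct.tmul_add a b b'

theorem Deligne.zero_tmul' {X Y : Deligne C D} (b : X.snd ⟶ Y.snd) :
    (tmul 0 b : X ⟶ Y) = 0 := TensorProduct.zero_tmul _ b

theorem Deligne.tmul_zero' {X Y : Deligne C D} (a : X.fst ⟶ Y.fst) :
    (tmul a 0 : X ⟶ Y) = 0 := TensorProduct.tmul_zero _ a

/-- The unit of `D` is simple, so the second tensor factor is a scalar and can be absorbed into the
first. -/
theorem Deligne.exists_eq_tmul_left {X Y : Deligne C D} (hX : X.snd = 𝟙_ D) (hY : Y.snd = 𝟙_ D)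
    (f : X ⟶ Y) : ∃ a : X.fst ⟶ Y.fst, f = tmul a (eqToHom (hX.trans hY.symm)) := by
  induction f using hom_induction with
  | zero => exact ⟨0, (zero_tmul' _).symm⟩
  | add f g hf hg =>
    obtain ⟨a, rfl⟩ := hf
    obtain ⟨b, rfl⟩ := hg
    exact ⟨a + b, (add_tmul' _ _ _).symm⟩
  | tmul a b =>
    obtain ⟨z, rfl⟩ := exists_smul_eqToHom hX hY b
    exact ⟨z • a, tmul_smul' _ _ _⟩

theorem Deligne.exists_eq_tmul_right {X Y : Deligne C D} (hX : X.fst = 𝟙_ C) (hY : Y.fst = 𝟙_ C)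
    (f : X ⟶ Y) : ∃ b : X.snd ⟶ Y.snd, f = tmul (eqToHom (hX.trans hY.symm)) b := by
  induction f using hom_induction with
  | zero => exact ⟨0, (tmul_zero' _).symm⟩
  | add f g hf hg =>
    obtain ⟨a, rfl⟩ := hf
    obtain ⟨b, rfl⟩ := hg
    exact ⟨a + b, (tmul_add' _ _ _).symm⟩
  | tmul a b =>
    obtain ⟨z, rfl⟩ := exists_smul_eqToHom hX hY a
    exact ⟨z • b, (tmul_smul' _ _ _).symm⟩

/-- The factor of the other colour is an endomorphism of the simple unit, hence a scalar. Blocks may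
therefore be replaced by arbitrary morphisms between words of one colour. -/
theorem Word.exists_block {c : Bool} {α β : Word C D} (hα : Mono c α) (hβ : Mono c β) (g : α ⟶ β) :
    ∃ b : Block α β, b.hom = g := by
  cases c with
  | true =>
    obtain ⟨a, ha⟩ := Deligne.exists_eq_tmul_left (X := toDeligne α) (Y := toDeligne β)
      (right_of_allLeft hα) (right_of_allLeft hβ) g
    exact ⟨.ofLeft hα hβ a, ha.symm⟩
  | false =>
    have h : ∀ {σ : Word C D}, Mono false σ → AllRight σ := fun hσ x hx => by
      simpa using hσ x hx
    obtain ⟨a, ha⟩ := Deligne.exists_eq_tmul_right (X := toDeligne α) (Y := toDeligne β)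
      (left_of_allRight (h hα)) (left_of_allRight (h hβ)) g
    exact ⟨.ofRight (h hα) (h hβ) a, ha.symm⟩

theorem Block.exists_mono {α β : Word C D} (b : Block α β) : ∃ c, Mono c α ∧ Mono c β := by
  cases b with
  | ofLeft hα hβ _ => exact ⟨true, hα, hβ⟩
  | ofRight hα hβ _ =>
    exact ⟨false, fun x hx => by simpa using hα x hx, fun x hx => by simpa using hβ x hx⟩

theorem Word.exists_smul_id_empty (g : (empty : Word C D) ⟶ empty) : ∃ z : ℂ, g = z • 𝟙 empty := by
  obtain ⟨a, ha⟩ := Deligne.exists_eq_tmul_left (X := toDeligne (empty : Word C D))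
    (Y := toDeligne (empty : Word C D)) rfl rfl g
  obtain ⟨z, rfl⟩ := simple_unit.2 a
  exact ⟨z, ha⟩

/-- Homogeneity is required only up to some scalar `z'`, so that the conjugate linear adjoint is
covered as well. -/
theorem ncpHom_induction {σ τ σ' τ' : Word C D} (Φ : (σ ⟶ τ) → (σ' ⟶ τ'))
    (hadd : ∀ f g, Φ (f + g) = Φ f + Φ g) (hzero : Φ 0 = 0)
    (hsmul : ∀ (z : ℂ) f, ∃ z' : ℂ, Φ (z • f) = z' • Φ f)
    (heval : ∀ T : NCP σ τ, Φ T.eval ∈ ncpHom σ' τ') {f : σ ⟶ τ} (hf : f ∈ ncpHom σ τ) :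
    Φ f ∈ ncpHom σ' τ' := by
  induction hf using Submodule.span_induction with
  | mem f hf =>
    obtain ⟨T, rfl⟩ := hf
    exact heval T
  | zero => rw [hzero]; exact zero_mem _
  | add f g _ _ hf hg => rw [hadd]; exact add_mem hf hg
  | smul z f _ hf =>
    obtain ⟨z', hz⟩ := hsmul z f
    rw [hz]
    exact Submodule.smul_mem _ _ hf

theorem NCP.eval_mem {σ τ : Word C D} (T : NCP σ τ) : T.eval ∈ ncpHom σ τ :=
  Submodule.subset_span ⟨T, rfl⟩

theorem NCP.eval_atLeft {α β σ τ : Word C D} (h : α ≠ empty ∨ β ≠ empty) (b : Block α β)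
    (T : NCP σ τ) : (NCP.atLeft h b T).eval = b.hom ⊗ₘ T.eval := by
  rw [NCP.eval]

theorem NCP.eval_atBottom {α τ : Word C D} (σ₁ σ₂ : Word C D) (h : α ≠ empty) (b : Block α empty)
    (T : NCP (σ₁ ⊗ σ₂) τ) : (NCP.atBottom σ₁ σ₂ h b T).eval =
      (σ₁ ◁ (((b.hom : α ⟶ 𝟙_ (Word C D)) ▷ σ₂) ≫ (λ_ σ₂).hom)) ≫ T.eval := by
  rw [NCP.eval]

theorem NCP.eval_atTop {β σ : Word C D} (τ₁ τ₂ : Word C D) (h : β ≠ empty) (b : Block empty β)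
    (T : NCP σ (τ₁ ⊗ τ₂)) : (NCP.atTop τ₁ τ₂ h b T).eval =
      T.eval ≫ (τ₁ ◁ ((λ_ τ₂).inv ≫ ((b.hom : 𝟙_ (Word C D) ⟶ β) ▷ τ₂))) := by
  rw [NCP.eval]

theorem ncpHom_of_eq {σ τ : Word C D} {f g : σ ⟶ τ} (h : f = g) (hg : g ∈ ncpHom σ τ) :
    f ∈ ncpHom σ τ := h ▸ hg

theorem IsStr.comp_mem {σ σ' τ : Word C D} {s : σ' ⟶ σ} (hs : IsStr s) {f : σ ⟶ τ}
    (hf : f ∈ ncpHom σ τ) : s ≫ f ∈ ncpHom σ' τ := by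
  obtain ⟨rfl, rfl⟩ := hs
  rwa [eqToHom_refl, Category.id_comp]

theorem IsStr.mem_comp {σ τ τ' : Word C D} {s : τ ⟶ τ'} (hs : IsStr s) {f : σ ⟶ τ}
    (hf : f ∈ ncpHom σ τ) : f ≫ s ∈ ncpHom σ τ' := by
  obtain ⟨rfl, rfl⟩ := hs
  rwa [eqToHom_refl, Category.comp_id]

theorem IsStr.mem {σ τ : Word C D} {s : σ ⟶ τ} (hs : IsStr s) : s ∈ ncpHom σ τ := by
  have := hs.mem_comp (id_mem_ncpHom σ)
  rwa [Category.id_comp] at this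

/-- Removes the nonemptiness condition of `NCP.atLeft`: a block without letters is a scalar. -/
theorem tensorHom_mem_of_mono {c : Bool} {α β σ τ : Word C D} (hα : Mono c α) (hβ : Mono c β)
    (g : α ⟶ β) {f : σ ⟶ τ} (hf : f ∈ ncpHom σ τ) : g ⊗ₘ f ∈ ncpHom (α ⊗ σ) (β ⊗ τ) := by
  by_cases h : α ≠ empty ∨ β ≠ empty
  · obtain ⟨b, rfl⟩ := exists_block hα hβ g
    refine ncpHom_induction (fun f => b.hom ⊗ₘ f) ?_ ?_ ?_ (fun T => ncpHom_of_eq (NCP.eval_atLeft h b T).symm (NCP.eval_mem _)) hf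
    · intro f g; simp [MonoidalPreadditive.tensor_add]
    · simp
    · intro z f; exact ⟨z, by simp [MonoidalCategory.tensorHom_def]⟩
  · push Not at h
    obtain ⟨rfl, rfl⟩ := h
    obtain ⟨z, rfl⟩ := exists_smul_id_empty g
    have h : (z • 𝟙 (empty : Word C D)) ⊗ₘ f = z • ((λ_ σ).hom ≫ f ≫ (λ_ τ).inv) := by
      change (z • 𝟙 (𝟙_ (Word C D))) ⊗ₘ f = _
      simp [MonoidalCategory.tensorHom_def]
    rw [h]
    exact Submodule.smul_mem _ _ ((isStr_leftUnitor σ).comp_mem ((isStr_leftUnitor τ).inv.mem_comp hf))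

/-- The word with a single letter. -/
def Word.letter {C : Type u₁} {D : Type u₂} (x : C ⊕ D) : Word C D := [x]

theorem Word.mono_letter {C : Type u₁} {D : Type u₂} (x : C ⊕ D) : Mono x.isLeft (letter x) := by
  intro y hy
  rw [List.mem_singleton.1 hy]

theorem whiskerLeft_letter_mem {σ τ : Word C D} {f : σ ⟶ τ} (x : C ⊕ D) (ρ : Word C D)
    (h : ρ ◁ f ∈ ncpHom (ρ ⊗ σ) (ρ ⊗ τ)) :
    (letter x ⊗ ρ) ◁ f ∈ ncpHom ((letter x ⊗ ρ) ⊗ σ) ((letter x ⊗ ρ) ⊗ τ) := by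
  have h' : (letter x ⊗ ρ) ◁ f =
      (α_ (letter x) ρ σ).hom ≫ (𝟙 (letter x) ⊗ₘ (ρ ◁ f)) ≫ (α_ (letter x) ρ τ).inv := by simp
  rw [h']
  exact (isStr_associator (letter x) ρ σ).comp_mem ((isStr_associator (letter x) ρ τ).inv.mem_comp
    (tensorHom_mem_of_mono (mono_letter x) (mono_letter x) (𝟙 _) h))

theorem whiskerLeft_mem {σ τ : Word C D} {f : σ ⟶ τ} (hf : f ∈ ncpHom σ τ) :
    ∀ ρ : Word C D, ρ ◁ f ∈ ncpHom (ρ ⊗ σ) (ρ ⊗ τ)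
  | [] => by
    have h : 𝟙_ (Word C D) ◁ f = (λ_ σ).hom ≫ f ≫ (λ_ τ).inv := by simp
    have h' := (isStr_leftUnitor σ).comp_mem ((isStr_leftUnitor τ).inv.mem_comp hf)
    rw [← h] at h'
    exact h'
  | x :: ρ => whiskerLeft_letter_mem x ρ (whiskerLeft_mem hf ρ)

theorem insert_comp_mem {c : Bool} {σ₁ σ₂ α τ : Word C D} (hα : Mono c α) (g : α ⟶ 𝟙_ (Word C D))
    {f : σ₁ ⊗ σ₂ ⟶ τ} (hf : f ∈ ncpHom (σ₁ ⊗ σ₂) τ) :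
    (σ₁ ◁ ((g ▷ σ₂) ≫ (λ_ σ₂).hom)) ≫ f ∈ ncpHom (σ₁ ⊗ (α ⊗ σ₂)) τ := by
  by_cases h : α = empty
  · subst h
    obtain ⟨z, rfl⟩ := exists_smul_id_empty g
    have h : (σ₁ ◁ (((z • 𝟙 (𝟙_ (Word C D))) ▷ σ₂) ≫ (λ_ σ₂).hom)) ≫ f =
      z • ((σ₁ ◁ (λ_ σ₂).hom) ≫ f) := by simp
    exact h ▸ Submodule.smul_mem _ _ (((isStr_leftUnitor σ₂).whiskerLeft σ₁).comp_mem hf)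
  · obtain ⟨b, rfl⟩ := exists_block hα (mono_empty c) g
    refine ncpHom_induction (fun f => (σ₁ ◁ ((b.hom ▷ σ₂) ≫ (λ_ σ₂).hom)) ≫ f) ?_ ?_ ?_
      (fun T => ncpHom_of_eq (NCP.eval_atBottom σ₁ σ₂ h b T).symm (NCP.eval_mem _)) hf
    · intro f g; simp
    · simp
    · intro z f; exact ⟨z, by simp⟩

theorem comp_insert_mem {c : Bool} {τ₁ τ₂ β σ : Word C D} (hβ : Mono c β) (g : 𝟙_ (Word C D) ⟶ β)
    {f : σ ⟶ τ₁ ⊗ τ₂} (hf : f ∈ ncpHom σ (τ₁ ⊗ τ₂)) :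
    f ≫ (τ₁ ◁ ((λ_ τ₂).inv ≫ (g ▷ τ₂))) ∈ ncpHom σ (τ₁ ⊗ (β ⊗ τ₂)) := by
  by_cases h : β = empty
  · subst h
    obtain ⟨z, rfl⟩ := exists_smul_id_empty g
    have h : f ≫ (τ₁ ◁ ((λ_ τ₂).inv ≫ ((z • 𝟙 (𝟙_ (Word C D))) ▷ τ₂))) =
      z • (f ≫ (τ₁ ◁ (λ_ τ₂).inv)) := by simp
    exact h ▸ Submodule.smul_mem _ _ (((isStr_leftUnitor τ₂).inv.whiskerLeft τ₁).mem_comp hf)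
  · obtain ⟨b, rfl⟩ := exists_block (mono_empty c) hβ g
    refine ncpHom_induction (fun f => f ≫ (τ₁ ◁ ((λ_ τ₂).inv ≫ (b.hom ▷ τ₂)))) ?_ ?_ ?_
      (fun T => ncpHom_of_eq (NCP.eval_atTop τ₁ τ₂ h b T).symm (NCP.eval_mem _)) hf
    · intro f g; simp
    · simp
    · intro z f; exact ⟨z, by simp⟩

theorem insert_comp_whiskerRight_mem {c : Bool} {σ₁ σ₂ α τ : Word C D} (ρ : Word C D)
    (hα : Mono c α) (g : α ⟶ 𝟙_ (Word C D)) {f : σ₁ ⊗ σ₂ ⟶ τ}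
    (hf : f ▷ ρ ∈ ncpHom ((σ₁ ⊗ σ₂) ⊗ ρ) (τ ⊗ ρ)) :
    ((σ₁ ◁ ((g ▷ σ₂) ≫ (λ_ σ₂).hom)) ≫ f) ▷ ρ ∈ ncpHom ((σ₁ ⊗ (α ⊗ σ₂)) ⊗ ρ) (τ ⊗ ρ) := by
  rw [whiskerRight_insert]
  have h1 := (isStr_associator σ₁ (α ⊗ σ₂) ρ).comp ((isStr_associator α σ₂ ρ).whiskerLeft σ₁)
  have h2 := (isStr_associator σ₁ σ₂ ρ).inv.comp_mem hf
  exact h1.comp_mem (insert_comp_mem hα g h2)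

theorem comp_insert_whiskerRight_mem {c : Bool} {τ₁ τ₂ β σ : Word C D} (ρ : Word C D)
    (hβ : Mono c β) (g : 𝟙_ (Word C D) ⟶ β) {f : σ ⟶ τ₁ ⊗ τ₂}
    (hf : f ▷ ρ ∈ ncpHom (σ ⊗ ρ) ((τ₁ ⊗ τ₂) ⊗ ρ)) :
    (f ≫ (τ₁ ◁ ((λ_ τ₂).inv ≫ (g ▷ τ₂)))) ▷ ρ ∈ ncpHom (σ ⊗ ρ) ((τ₁ ⊗ (β ⊗ τ₂)) ⊗ ρ) := by
  rw [insert_whiskerRight]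
  have h1 := ((isStr_associator β τ₂ ρ).inv.whiskerLeft τ₁).comp (isStr_associator τ₁ (β ⊗ τ₂) ρ).inv
  have h2 := (isStr_associator τ₁ τ₂ ρ).mem_comp hf
  exact h1.mem_comp (comp_insert_mem hβ g h2)

theorem tensorHom_whiskerRight_mem_of_mono {c : Bool} {α β σ τ : Word C D} (ρ : Word C D)
    (hα : Mono c α) (hβ : Mono c β) (g : α ⟶ β) {f : σ ⟶ τ}
    (hf : f ▷ ρ ∈ ncpHom (σ ⊗ ρ) (τ ⊗ ρ)) :
    (g ⊗ₘ f) ▷ ρ ∈ ncpHom ((α ⊗ σ) ⊗ ρ) ((β ⊗ τ) ⊗ ρ) := by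
  rw [tensorHom_whiskerRight]
  exact (isStr_associator β τ ρ).inv.mem_comp
    ((isStr_associator α σ ρ).comp_mem (tensorHom_mem_of_mono hα hβ g hf))

/-- Adding strands on the right does not disturb the insertion of blocks: what was inserted at the
left end, at the bottom or at the top can be inserted there again. The induction starts with the
identity of `ρ`. -/
theorem whiskerRight_mem (ρ : Word C D) {σ τ : Word C D} {f : σ ⟶ τ} (hf : f ∈ ncpHom σ τ) :
    f ▷ ρ ∈ ncpHom (σ ⊗ ρ) (τ ⊗ ρ) := by
  refine ncpHom_induction (fun f => f ▷ ρ) (fun f g => by simp) (by simp)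
    (fun z f => ⟨z, by simp⟩) (fun T => ?_) hf
  clear hf f
  induction T with
  | nil =>
    change 𝟙 (empty : Word C D) ▷ ρ ∈ _
    rw [id_whiskerRight]
    exact id_mem_ncpHom _
  | atLeft h b T ih =>
    obtain ⟨c, hα, hβ⟩ := b.exists_mono
    rw [NCP.eval_atLeft]
    exact tensorHom_whiskerRight_mem_of_mono ρ hα hβ _ ih
  | atBottom σ₁ σ₂ h b T ih =>
    obtain ⟨c, hα, -⟩ := b.exists_mono
    rw [NCP.eval_atBottom]
    exact insert_comp_whiskerRight_mem ρ hα _ ih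
  | atTop τ₁ τ₂ h b T ih =>
    obtain ⟨c, -, hβ⟩ := b.exists_mono
    rw [NCP.eval_atTop]
    exact comp_insert_whiskerRight_mem ρ hβ _ ih

/-- Reflecting the rectangle exchanges insertions at the bottom and at the top. -/
theorem adj_mem {σ τ : Word C D} {f : σ ⟶ τ} (hf : f ∈ ncpHom σ τ) : adj f ∈ ncpHom τ σ := by
  refine ncpHom_induction (fun f => adj f) (fun f g => by simp) (by simp)
    (fun z f => ⟨_, map_smulₛₗ _ z f⟩) (fun T => ?_) hf
  clear hf f
  induction T with
  | nil =>
    change adj (𝟙 (empty : Word C D)) ∈ _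
    rw [adj_id]
    exact id_mem_ncpHom _
  | atLeft h b T ih =>
    obtain ⟨c, hα, hβ⟩ := b.exists_mono
    rw [NCP.eval_atLeft, Word.adj_tensorHom]
    exact tensorHom_mem_of_mono hβ hα _ ih
  | atBottom σ₁ σ₂ h b T ih =>
    obtain ⟨c, hα, -⟩ := b.exists_mono
    rw [NCP.eval_atBottom, StarCategory.adj_comp, Word.adj_whiskerLeft, StarCategory.adj_comp,
      Word.adj_whiskerRight, Word.adj_leftUnitor_hom]
    exact comp_insert_mem hα _ ih
  | atTop τ₁ τ₂ h b T ih =>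
    obtain ⟨c, -, hβ⟩ := b.exists_mono
    rw [NCP.eval_atTop, StarCategory.adj_comp, Word.adj_whiskerLeft, StarCategory.adj_comp,
      Word.adj_whiskerRight, Word.adj_leftUnitor_inv]
    exact insert_comp_mem hβ _ ih

end Closure

/-! ### Closure of `ncpHom` under composition -/

section Composition

open Word RigidCStarTensorCategory

variable {C : Type u₁} [Category.{v₁} C] [MonoidalCategory C] [Preadditive C] [Linear ℂ C]
  [MonoidalPreadditive C] [MonoidalLinear ℂ C] [RigidCStarTensorCategory C]
variable {D : Type u₂} [Category.{v₂} D] [MonoidalCategory D] [Preadditive D] [Linear ℂ D]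
  [MonoidalPreadditive D] [MonoidalLinear ℂ D] [RigidCStarTensorCategory D]

theorem whiskerRight_mem_of_mono {c : Bool} {α β : Word C D} (ρ : Word C D) (hα : Mono c α)
    (hβ : Mono c β) (g : α ⟶ β) : g ▷ ρ ∈ ncpHom (α ⊗ ρ) (β ⊗ ρ) := by
  rw [← tensorHom_id]
  exact tensorHom_mem_of_mono hα hβ g (id_mem_ncpHom ρ)

/-- The last step in the construction of a morphism that joins the block `g` to the
left end of the morphism `t`. -/
abbrev Merges {σ τ : Word C D} (t : σ ⟶ τ) : Prop :=
  ∀ {c : Bool} {α₀ α ρ δ : Word C D}, Mono c α₀ → Mono c α → Mono c δ →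
    ∀ {s : τ ⟶ α ⊗ ρ}, IsStr s → ∀ g : α₀ ⊗ α ⟶ δ,
      (α₀ ◁ (t ≫ s)) ≫ (α_ α₀ α ρ).inv ≫ g ▷ ρ ∈ ncpHom (α₀ ⊗ σ) (δ ⊗ ρ)

theorem merges_id : Merges (𝟙 (empty : Word C D)) := by
  intro c α₀ α ρ δ h₀ hα hδ s hs g
  rw [Category.id_comp]
  have h1 := (hs.whiskerLeft α₀).comp (isStr_associator α₀ α ρ).inv
  have h2 := h1.comp_mem (whiskerRight_mem_of_mono ρ (mono_tensor.2 ⟨h₀, hα⟩) hδ g)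
  rwa [Category.assoc] at h2

theorem merge_empty_mem {c : Bool} {α₀ ρ δ σ τ : Word C D} {t : σ ⟶ τ} (ht : t ∈ ncpHom σ τ)
    (h₀ : Mono c α₀) (hδ : Mono c δ) {s : τ ⟶ 𝟙_ (Word C D) ⊗ ρ} (hs : IsStr s)
    (g : α₀ ⊗ 𝟙_ (Word C D) ⟶ δ) :
    (α₀ ◁ (t ≫ s)) ≫ (α_ α₀ (𝟙_ (Word C D)) ρ).inv ≫ g ▷ ρ ∈ ncpHom (α₀ ⊗ σ) (δ ⊗ ρ) := by
  have h : t ≫ s = (t ≫ s ≫ (λ_ ρ).hom) ≫ (λ_ ρ).inv := by simp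
  rw [h, merge_trivial]
  exact tensorHom_mem_of_mono h₀ hδ _ ((hs.comp (isStr_leftUnitor ρ)).mem_comp ht)

/-- The initial segment `α` of the top is compared with the top letters `β₁` of the block at the
left end. -/
theorem merges_tensorHom {c : Bool} {α₁ β₁ σ₁ τ₁ : Word C D} (hα₁ : Mono c α₁) (hβ₁ : Mono c β₁)
    (b : α₁ ⟶ β₁) {t : σ₁ ⟶ τ₁} (ht : t ∈ ncpHom σ₁ τ₁) (ih : Merges t) : Merges (b ⊗ₘ t) := by
  intro c' α₀ α ρ δ h₀ hα hδ s hs g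
  by_cases hα0 : α = empty
  · subst hα0
    exact merge_empty_mem (tensorHom_mem_of_mono hα₁ hβ₁ b ht) h₀ hδ hs g
  -- A block `b` without top letters may have a colour different from that of `g`. It never meets
  -- `g` and becomes an insertion at the bottom.
  by_cases hβ0 : β₁ = empty
  · subst hβ0
    have e : s = (λ_ τ₁).hom ≫ ((λ_ τ₁).inv ≫ s) := by simp
    rw [e]
    refine ncpHom_of_eq (merge_cap b t _ g) ?_
    exact insert_comp_mem hα₁ b (ih h₀ hα hδ ((isStr_leftUnitor τ₁).inv.comp hs) g)
  · rcases tensor_eq_tensor hs.1 with ⟨K, rfl, rfl⟩ | ⟨K, rfl, rfl⟩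
    -- `α` contains all of `β₁`: the block `b` is swallowed by `g`, and the enlarged block continues
    -- into `t`.
    · obtain rfl := hβ₁.eq_of_ne_empty (mono_tensor.1 hα).1 hβ0
      rw [hs.eq (isStr_associator β₁ K ρ).inv, merge_through]
      exact (isStr_associator α₀ α₁ σ₁).inv.comp_mem
        (ih (mono_tensor.2 ⟨h₀, hα₁⟩) (mono_tensor.1 hα).2 hδ (isStr_id _) _)
    -- `β₁` reaches beyond `α`: the blocks `b` and `g` fuse into a single block at the left end.
    · obtain rfl := hα.eq_of_ne_empty (mono_tensor.1 hβ₁).1 hα0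
      rw [hs.eq (isStr_associator α K τ₁), merge_into_through]
      exact (isStr_associator δ K τ₁).mem_comp ((isStr_associator α₀ α₁ σ₁).inv.comp_mem
        (tensorHom_mem_of_mono (mono_tensor.2 ⟨h₀, hα₁⟩)
          (mono_tensor.2 ⟨hδ, (mono_tensor.1 hβ₁).2⟩) _ ht))

theorem merges_insert_comp {c : Bool} {σ₁ σ₂ α₁ τ : Word C D} (hα₁ : Mono c α₁)
    (b : α₁ ⟶ 𝟙_ (Word C D)) {t : σ₁ ⊗ σ₂ ⟶ τ} (ih : Merges t) :
    Merges ((σ₁ ◁ ((b ▷ σ₂) ≫ (λ_ σ₂).hom)) ≫ t) := by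
  intro c' α₀ α ρ δ h₀ hα hδ s hs g
  have e : (α₀ ◁ (((σ₁ ◁ ((b ▷ σ₂) ≫ (λ_ σ₂).hom)) ≫ t) ≫ s)) ≫ (α_ α₀ α ρ).inv ≫ g ▷ ρ =
      (α_ α₀ σ₁ (α₁ ⊗ σ₂)).inv ≫ ((α₀ ⊗ σ₁) ◁ ((b ▷ σ₂) ≫ (λ_ σ₂).hom)) ≫
        (α_ α₀ σ₁ σ₂).hom ≫ ((α₀ ◁ (t ≫ s)) ≫ (α_ α₀ α ρ).inv ≫ g ▷ ρ) := by
    simp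
  rw [e]
  exact (isStr_associator α₀ σ₁ (α₁ ⊗ σ₂)).inv.comp_mem (insert_comp_mem hα₁ b
    ((isStr_associator α₀ σ₁ σ₂).comp_mem (ih h₀ hα hδ hs g)))

/-- Either `β` lies to the right of `α` and can be inserted after the merge, or it lies inside `α`
and is absorbed by `g`, or it straddles the end of `α` and fuses with `g`. -/
theorem merges_comp_insert {c : Bool} {τ₁ τ₂ β σ : Word C D} (hβ : Mono c β)
    (b : 𝟙_ (Word C D) ⟶ β) {t : σ ⟶ τ₁ ⊗ τ₂} (ih : Merges t) :
    Merges (t ≫ (τ₁ ◁ ((λ_ τ₂).inv ≫ (b ▷ τ₂)))) := by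
  intro c' α₀ α ρ δ h₀ hα hδ s hs g
  have left : ∀ K : Word C D, τ₁ = α ⊗ K → ρ = K ⊗ (β ⊗ τ₂) →
      (α₀ ◁ ((t ≫ (τ₁ ◁ ((λ_ τ₂).inv ≫ (b ▷ τ₂)))) ≫ s)) ≫ (α_ α₀ α ρ).inv ≫ g ▷ ρ ∈
        ncpHom (α₀ ⊗ σ) (δ ⊗ ρ) := by
    rintro K rfl rfl
    rw [hs.eq (isStr_associator α K (β ⊗ τ₂)), merge_insert_left]
    exact (isStr_associator δ K (β ⊗ τ₂)).mem_comp (comp_insert_mem hβ b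
      ((isStr_associator δ K τ₂).inv.mem_comp (ih h₀ hα hδ (isStr_associator α K τ₂) g)))
  rcases tensor_eq_tensor hs.1 with ⟨K, rfl, h⟩ | ⟨K, h, h'⟩
  · by_cases hK : K = empty
    · subst hK
      refine left empty ?_ h.symm
      rw [tensor_empty, tensor_empty]
    rcases tensor_eq_tensor h with ⟨K', rfl, rfl⟩ | ⟨K', rfl, rfl⟩
    · rw [hs.eq (((isStr_associator β K' ρ).inv.whiskerLeft τ₁).comp
        (isStr_associator τ₁ (β ⊗ K') ρ).inv), merge_insert_mid]
      have h1 := mono_tensor.1 hα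
      exact ih h₀ (mono_tensor.2 ⟨h1.1, (mono_tensor.1 h1.2).2⟩) hδ (isStr_associator τ₁ K' ρ).inv _
    · obtain rfl := (mono_tensor.1 hα).2.eq_of_ne_empty (mono_tensor.1 hβ).1 hK
      rw [hs.eq (((isStr_associator K K' τ₂).whiskerLeft τ₁).comp
        (isStr_associator τ₁ K (K' ⊗ τ₂)).inv), merge_insert_right]
      exact (isStr_associator δ K' τ₂).mem_comp (ih h₀ (mono_tensor.1 hα).1
        (mono_tensor.2 ⟨hδ, (mono_tensor.1 hβ).2⟩) (isStr_id _) _)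
  · exact left K h h'

theorem NCP.merges_eval {σ τ : Word C D} (T : NCP σ τ) : Merges T.eval := by
  induction T with
  | nil => exact merges_id
  | atLeft h b T ih =>
    obtain ⟨c, hα, hβ⟩ := b.exists_mono
    rw [NCP.eval_atLeft]
    exact merges_tensorHom hα hβ _ T.eval_mem ih
  | atBottom σ₁ σ₂ h b T ih =>
    obtain ⟨c, hα, -⟩ := b.exists_mono
    rw [NCP.eval_atBottom]
    exact merges_insert_comp hα _ ih
  | atTop τ₁ τ₂ h b T ih =>
    obtain ⟨c, -, hβ⟩ := b.exists_mono
    rw [NCP.eval_atTop]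
    exact merges_comp_insert hβ _ ih

/-- The composition of `t` with a block `g` whose letters are neighbours. -/
abbrev AbsorbsBlocks {σ τ : Word C D} (t : σ ⟶ τ) : Prop :=
  ∀ {c : Bool} {ρ₁ α ρ₂ δ : Word C D}, Mono c α → Mono c δ →
    ∀ {s : τ ⟶ ρ₁ ⊗ (α ⊗ ρ₂)}, IsStr s → ∀ g : α ⟶ δ,
      t ≫ s ≫ ρ₁ ◁ (g ▷ ρ₂) ∈ ncpHom σ (ρ₁ ⊗ (δ ⊗ ρ₂))

theorem absorb_empty_mem {c : Bool} {ρ₁ ρ₂ δ σ τ : Word C D} {t : σ ⟶ τ} (ht : t ∈ ncpHom σ τ)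
    (hδ : Mono c δ) {s : τ ⟶ ρ₁ ⊗ (𝟙_ (Word C D) ⊗ ρ₂)} (hs : IsStr s) (g : 𝟙_ (Word C D) ⟶ δ) :
    t ≫ s ≫ ρ₁ ◁ (g ▷ ρ₂) ∈ ncpHom σ (ρ₁ ⊗ (δ ⊗ ρ₂)) := by
  have h : t ≫ s ≫ ρ₁ ◁ (g ▷ ρ₂) =
    (t ≫ s ≫ ρ₁ ◁ (λ_ ρ₂).hom) ≫ (ρ₁ ◁ ((λ_ ρ₂).inv ≫ (g ▷ ρ₂))) := by simp
  rw [h]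
  exact comp_insert_mem hδ g ((hs.comp ((isStr_leftUnitor ρ₂).whiskerLeft ρ₁)).mem_comp ht)

theorem absorbs_id : AbsorbsBlocks (𝟙 (empty : Word C D)) := by
  intro c ρ₁ α ρ₂ δ hα hδ s hs g
  rw [Category.id_comp]
  exact hs.comp_mem (whiskerLeft_mem (whiskerRight_mem_of_mono ρ₂ hα hδ g) ρ₁)

/-- If the letters of `g` belong partly to the block `b` at the left end and partly to `t`, then `b`
and `g` together form a block that is joined to the left end of `t`. This case is the reason for
`Merges`. -/
theorem absorbs_tensorHom {c : Bool} {α₁ β₁ σ₁ τ₁ : Word C D} (hα₁ : Mono c α₁) (hβ₁ : Mono c β₁)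
    (b : α₁ ⟶ β₁) {t : σ₁ ⟶ τ₁} (ht : t ∈ ncpHom σ₁ τ₁) (hm : Merges t) (ih : AbsorbsBlocks t) :
    AbsorbsBlocks (b ⊗ₘ t) := by
  intro c' ρ₁ α ρ₂ δ hα hδ s hs g
  have right : ∀ K : Word C D, ρ₁ = β₁ ⊗ K → τ₁ = K ⊗ (α ⊗ ρ₂) →
      (b ⊗ₘ t) ≫ s ≫ ρ₁ ◁ (g ▷ ρ₂) ∈ ncpHom (α₁ ⊗ σ₁) (ρ₁ ⊗ (δ ⊗ ρ₂)) := by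
    rintro K rfl rfl
    rw [hs.eq (isStr_associator β₁ K (α ⊗ ρ₂)).inv, comp_atLeft_right]
    exact (isStr_associator β₁ K (δ ⊗ ρ₂)).inv.mem_comp
      (tensorHom_mem_of_mono hα₁ hβ₁ b (ih hα hδ (isStr_id _) g))
  by_cases hα0 : α = empty
  · subst hα0
    exact absorb_empty_mem (tensorHom_mem_of_mono hα₁ hβ₁ b ht) hδ hs g
  rcases tensor_eq_tensor hs.1 with ⟨K, h, h'⟩ | ⟨K, rfl, h⟩
  · exact right K h h'
  · by_cases hK : K = empty
    · subst hK
      refine right empty ?_ h.symm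
      rw [tensor_empty, tensor_empty]
    have hβ := mono_tensor.1 hβ₁
    rcases tensor_eq_tensor h with ⟨K', rfl, rfl⟩ | ⟨K', rfl, rfl⟩
    · obtain rfl := hα.eq_of_ne_empty (mono_tensor.1 hβ.2).1 hα0
      rw [hs.eq ((isStr_associator ρ₁ (α ⊗ K') τ₁).comp
        ((isStr_associator α K' τ₁).whiskerLeft ρ₁)), comp_atLeft_left]
      exact ((isStr_associator ρ₁ (δ ⊗ K') τ₁).comp
        ((isStr_associator δ K' τ₁).whiskerLeft ρ₁)).mem_comp (tensorHom_mem_of_mono hα₁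
          (mono_tensor.2 ⟨hβ.1, mono_tensor.2 ⟨hδ, (mono_tensor.1 hβ.2).2⟩⟩) _ ht)
    · obtain rfl := hβ.2.eq_of_ne_empty (mono_tensor.1 hα).1 hK
      rw [hs.eq ((isStr_associator ρ₁ K (K' ⊗ ρ₂)).comp
        ((isStr_associator K K' ρ₂).inv.whiskerLeft ρ₁)), comp_atLeft_overlap]
      exact (isStr_associator ρ₁ δ ρ₂).mem_comp
        (hm hα₁ (mono_tensor.1 hα).2 (mono_tensor.2 ⟨hβ.1, hδ⟩) (isStr_id _) _)

theorem absorbs_insert_comp {c : Bool} {σ₁ σ₂ α₁ τ : Word C D} (hα₁ : Mono c α₁)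
    (b : α₁ ⟶ 𝟙_ (Word C D)) {t : σ₁ ⊗ σ₂ ⟶ τ} (ih : AbsorbsBlocks t) :
    AbsorbsBlocks ((σ₁ ◁ ((b ▷ σ₂) ≫ (λ_ σ₂).hom)) ≫ t) := by
  intro c' ρ₁ α ρ₂ δ hα hδ s hs g
  rw [Category.assoc]
  exact insert_comp_mem hα₁ b (ih hα hδ hs g)

/-- All overlapping positions at once: in `a₁βa₂ = b₁αb₂` the superfluous words are taken to be
empty. Removing `β` makes `a₁` and `a₂` neighbours, so the fused block is again of the kind that `t`
absorbs. -/
theorem absorb_overlap_mem {c : Bool} {τ₁ τ₂ β σ ρ₁ α ρ₂ δ : Word C D} (hδ : Mono c δ)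
    (b : 𝟙_ (Word C D) ⟶ β) {t : σ ⟶ τ₁ ⊗ τ₂} (ih : AbsorbsBlocks t) {s : τ₁ ⊗ (β ⊗ τ₂) ⟶ ρ₁ ⊗ (α ⊗ ρ₂)}
    (hs : IsStr s) (g : α ⟶ δ) (ρ' ρ'' a₁ a₂ b₁ b₂ : Word C D) (h₁ : τ₁ = ρ' ⊗ a₁)
    (h₂ : τ₂ = a₂ ⊗ ρ'') (h₃ : ρ₁ = ρ' ⊗ b₁) (h₄ : ρ₂ = b₂ ⊗ ρ'') (ha₁ : Mono c a₁)
    (ha₂ : Mono c a₂) (hb₁ : Mono c b₁) (hb₂ : Mono c b₂) (h : a₁ ⊗ (β ⊗ a₂) = b₁ ⊗ (α ⊗ b₂)) :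
    (t ≫ (τ₁ ◁ ((λ_ τ₂).inv ≫ (b ▷ τ₂)))) ≫ s ≫ ρ₁ ◁ (g ▷ ρ₂) ∈ ncpHom σ (ρ₁ ⊗ (δ ⊗ ρ₂)) := by
  subst h₁ h₂ h₃ h₄
  have e := isStr_eqToHom h
  have h1 := ((isStr_associator b₁ (α ⊗ b₂) ρ'').comp ((isStr_associator α b₂ ρ'').whiskerLeft b₁))
  have h2 := (((isStr_associator β a₂ ρ'').inv.whiskerLeft a₁).comp
    ((isStr_associator a₁ (β ⊗ a₂) ρ'').inv.comp ((e.whiskerRight ρ'').comp h1)))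
  rw [hs.eq ((isStr_associator ρ' a₁ (β ⊗ (a₂ ⊗ ρ''))).comp ((h2.whiskerLeft ρ').comp
    (isStr_associator ρ' b₁ (α ⊗ (b₂ ⊗ ρ''))).inv)), comp_overlap]
  have h3 := ((isStr_associator b₁ (δ ⊗ b₂) ρ'').comp ((isStr_associator δ b₂ ρ'').whiskerLeft b₁))
  exact ((h3.whiskerLeft ρ').comp (isStr_associator ρ' b₁ (δ ⊗ (b₂ ⊗ ρ''))).inv).mem_comp
    (ih (mono_tensor.2 ⟨ha₁, ha₂⟩) (mono_tensor.2 ⟨hb₁, mono_tensor.2 ⟨hδ, hb₂⟩⟩)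
      ((isStr_associator ρ' a₁ (a₂ ⊗ ρ'')).comp ((isStr_associator a₁ a₂ ρ'').inv.whiskerLeft ρ')) _)

theorem absorbs_comp_insert {c : Bool} {τ₁ τ₂ β σ : Word C D} (hβ : Mono c β)
    (b : 𝟙_ (Word C D) ⟶ β) {t : σ ⟶ τ₁ ⊗ τ₂} (ht : t ∈ ncpHom σ (τ₁ ⊗ τ₂)) (ih : AbsorbsBlocks t) :
    AbsorbsBlocks (t ≫ (τ₁ ◁ ((λ_ τ₂).inv ≫ (b ▷ τ₂)))) := by
  intro c' ρ₁ α ρ₂ δ hα hδ s hs g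
  by_cases hα0 : α = empty
  · subst hα0
    exact absorb_empty_mem (comp_insert_mem hβ b ht) hδ hs g
  have right : ∀ K : Word C D, ρ₁ = τ₁ ⊗ (β ⊗ K) → τ₂ = K ⊗ (α ⊗ ρ₂) →
      (t ≫ (τ₁ ◁ ((λ_ τ₂).inv ≫ (b ▷ τ₂)))) ≫ s ≫ ρ₁ ◁ (g ▷ ρ₂) ∈
        ncpHom σ (ρ₁ ⊗ (δ ⊗ ρ₂)) := by
    rintro K rfl rfl
    rw [hs.eq (((isStr_associator β K (α ⊗ ρ₂)).inv.whiskerLeft τ₁).comp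
      (isStr_associator τ₁ (β ⊗ K) (α ⊗ ρ₂)).inv), comp_disjoint_right]
    exact (((isStr_associator β K (δ ⊗ ρ₂)).inv.whiskerLeft τ₁).comp
      (isStr_associator τ₁ (β ⊗ K) (δ ⊗ ρ₂)).inv).mem_comp (comp_insert_mem hβ b
        ((isStr_associator τ₁ K (δ ⊗ ρ₂)).mem_comp
          (ih hα hδ (isStr_associator τ₁ K (α ⊗ ρ₂)).inv g)))
  have left : ∀ K : Word C D, τ₁ = ρ₁ ⊗ (α ⊗ K) → ρ₂ = K ⊗ (β ⊗ τ₂) →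
      (t ≫ (τ₁ ◁ ((λ_ τ₂).inv ≫ (b ▷ τ₂)))) ≫ s ≫ ρ₁ ◁ (g ▷ ρ₂) ∈
        ncpHom σ (ρ₁ ⊗ (δ ⊗ ρ₂)) := by
    rintro K rfl rfl
    rw [hs.eq ((isStr_associator ρ₁ (α ⊗ K) (β ⊗ τ₂)).comp
      ((isStr_associator α K (β ⊗ τ₂)).whiskerLeft ρ₁)), comp_disjoint_left]
    exact ((isStr_associator ρ₁ (δ ⊗ K) (β ⊗ τ₂)).comp
      ((isStr_associator δ K (β ⊗ τ₂)).whiskerLeft ρ₁)).mem_comp (comp_insert_mem hβ b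
        (((((isStr_associator δ K τ₂).inv.whiskerLeft ρ₁).comp
          (isStr_associator ρ₁ (δ ⊗ K) τ₂).inv)).mem_comp
          (ih hα hδ ((isStr_associator ρ₁ (α ⊗ K) τ₂).comp
            ((isStr_associator α K τ₂).whiskerLeft ρ₁)) g)))
  have he := mono_empty (C := C) (D := D)
  rcases tensor_eq_tensor hs.1 with ⟨K, hK, h⟩ | ⟨K, hK, h⟩
  · rcases tensor_eq_tensor h with ⟨K', rfl, h'⟩ | ⟨K', hβ', h'⟩
    · exact right K' hK h'
    by_cases hK' : K' = empty
    · subst hK'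
      refine right empty ?_ h'.symm
      rw [tensor_empty, hK, hβ', tensor_empty]
    have hβ1 := mono_tensor.1 (hβ' ▸ hβ)
    rcases tensor_eq_tensor h' with ⟨K'', h1, h2⟩ | ⟨K'', h1, h2⟩
    · obtain rfl := hα.eq_of_ne_empty (mono_tensor.1 (h1 ▸ hβ1.2)).1 hα0
      exact absorb_overlap_mem hδ b ih hs g τ₁ τ₂ empty empty K K'' (tensor_empty τ₁).symm rfl hK
        h2 (he _) (he _) hβ1.1 (mono_tensor.1 (h1 ▸ hβ1.2)).2
        (by rw [hβ', h1, tensor_empty]; rfl)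
    · obtain rfl := hβ1.2.eq_of_ne_empty (mono_tensor.1 (h1 ▸ hα)).1 hK'
      exact absorb_overlap_mem hδ b ih hs g τ₁ ρ₂ empty K'' K empty (tensor_empty τ₁).symm h2 hK
        rfl (he _) (mono_tensor.1 (h1 ▸ hα)).2 hβ1.1 (he _)
        (by rw [hβ', h1, tensor_empty]; exact tensor_assoc _ _ _)
  · rcases tensor_eq_tensor h with ⟨K', hK', h'⟩ | ⟨K', h₁, h₂⟩
    · exact left K' (hK' ▸ hK) h'
    by_cases hK' : K' = empty
    · subst hK'
      refine left empty ?_ h₂.symm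
      rw [hK, h₁, tensor_empty, tensor_empty]
    have hα1 := mono_tensor.1 (h₁ ▸ hα)
    rcases tensor_eq_tensor h₂ with ⟨K'', h1, h2⟩ | ⟨K'', h1, h2⟩
    · exact absorb_overlap_mem hδ b ih hs g ρ₁ ρ₂ K K'' empty empty hK h2 (tensor_empty ρ₁).symm
        rfl hα1.1 (mono_tensor.1 (h1 ▸ hα1.2)).2 (he _) (he _)
        (by rw [h₁, h1, tensor_empty]; rfl)
    · obtain rfl := hα1.2.eq_of_ne_empty (mono_tensor.1 (h1 ▸ hβ)).1 hK'
      exact absorb_overlap_mem hδ b ih hs g ρ₁ τ₂ K empty empty K'' hK rfl (tensor_empty ρ₁).symm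
        h2 hα1.1 (he _) (he _) (mono_tensor.1 (h1 ▸ hβ)).2
        (by rw [h₁, h1, tensor_empty]; exact (tensor_assoc _ _ _).symm)

theorem NCP.absorbsBlocks_eval {σ τ : Word C D} (T : NCP σ τ) : AbsorbsBlocks T.eval := by
  induction T with
  | nil => exact absorbs_id
  | atLeft h b T ih =>
    obtain ⟨c, hα, hβ⟩ := b.exists_mono
    rw [NCP.eval_atLeft]
    exact absorbs_tensorHom hα hβ _ T.eval_mem T.merges_eval ih
  | atBottom σ₁ σ₂ h b T ih =>
    obtain ⟨c, hα, -⟩ := b.exists_mono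
    rw [NCP.eval_atBottom]
    exact absorbs_insert_comp hα _ ih
  | atTop τ₁ τ₂ h b T ih =>
    obtain ⟨c, -, hβ⟩ := b.exists_mono
    rw [NCP.eval_atTop]
    exact absorbs_comp_insert hβ _ T.eval_mem ih

theorem comp_block_mem {c : Bool} {σ ρ₁ α ρ₂ δ : Word C D} (hα : Mono c α) (hδ : Mono c δ)
    {f : σ ⟶ ρ₁ ⊗ (α ⊗ ρ₂)} (hf : f ∈ ncpHom σ (ρ₁ ⊗ (α ⊗ ρ₂))) (g : α ⟶ δ) :
    f ≫ ρ₁ ◁ (g ▷ ρ₂) ∈ ncpHom σ (ρ₁ ⊗ (δ ⊗ ρ₂)) := by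
  refine ncpHom_induction (fun f => f ≫ ρ₁ ◁ (g ▷ ρ₂)) (fun f g => by simp) (by simp)
    (fun z f => ⟨z, by simp⟩) (fun T => ?_) hf
  have h := T.absorbsBlocks_eval hα hδ (isStr_id _) g
  rwa [Category.id_comp] at h

/-- The second factor is dismantled block by block, each block being absorbed by the first factor.
The word `ρ` on the left is arbitrary because peeling off a block at the left end moves its top
letters `β` into `ρ`. -/
theorem comp_eval_mem {τ ν : Word C D} (T : NCP τ ν) : ∀ {σ ρ : Word C D} {f : σ ⟶ ρ ⊗ τ},
    f ∈ ncpHom σ (ρ ⊗ τ) → f ≫ ρ ◁ T.eval ∈ ncpHom σ (ρ ⊗ ν) := by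
  induction T with
  | nil =>
    intro σ ρ f hf
    have h : f ≫ ρ ◁ 𝟙 (empty : Word C D) = f := by simp
    exact ncpHom_of_eq h hf
  | @atLeft α β σ₁ τ₁ h b T ih =>
    intro σ ρ f hf
    obtain ⟨c, hα, hβ⟩ := b.exists_mono
    have h : f ≫ ρ ◁ (b.hom ⊗ₘ T.eval) = ((f ≫ ρ ◁ (b.hom ▷ σ₁)) ≫ (α_ ρ β σ₁).inv) ≫
        (ρ ⊗ β) ◁ T.eval ≫ (α_ ρ β τ₁).hom := by
      simp [MonoidalCategory.tensorHom_def]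
    rw [NCP.eval_atLeft, h, ← Category.assoc]
    exact (isStr_associator ρ β τ₁).mem_comp (ih ((isStr_associator ρ β σ₁).inv.mem_comp
      (comp_block_mem hα hβ hf _)))
  | @atBottom α τ₁ σ₁ σ₂ h b T ih =>
    intro σ ρ f hf
    obtain ⟨c, hα, -⟩ := b.exists_mono
    rw [NCP.eval_atBottom]
    generalize (b.hom : α ⟶ 𝟙_ (Word C D)) = g
    have h : f ≫ ρ ◁ ((σ₁ ◁ (g ▷ σ₂ ≫ (λ_ σ₂).hom)) ≫ T.eval) =
        (((f ≫ (α_ ρ σ₁ (α ⊗ σ₂)).inv) ≫ (ρ ⊗ σ₁) ◁ (g ▷ σ₂)) ≫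
          ((ρ ⊗ σ₁) ◁ (λ_ σ₂).hom ≫ (α_ ρ σ₁ σ₂).hom)) ≫ ρ ◁ T.eval := by
      simp
    rw [h]
    exact ih ((((isStr_leftUnitor σ₂).whiskerLeft _).comp (isStr_associator ρ σ₁ σ₂)).mem_comp
      (comp_block_mem hα (mono_empty c) ((isStr_associator ρ σ₁ (α ⊗ σ₂)).inv.mem_comp hf) g))
  | @atTop β σ₁ τ₁ τ₂ h b T ih =>
    intro σ ρ f hf
    obtain ⟨c, -, hβ⟩ := b.exists_mono
    rw [NCP.eval_atTop]
    generalize (b.hom : 𝟙_ (Word C D) ⟶ β) = g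
    have h : f ≫ ρ ◁ (T.eval ≫ (τ₁ ◁ ((λ_ τ₂).inv ≫ (g ▷ τ₂)))) =
        (((f ≫ ρ ◁ T.eval) ≫ (α_ ρ τ₁ τ₂).inv) ≫ (ρ ⊗ τ₁) ◁ ((λ_ τ₂).inv ≫ (g ▷ τ₂))) ≫
          (α_ ρ τ₁ (β ⊗ τ₂)).hom := by
      simp
    rw [h]
    exact (isStr_associator ρ τ₁ (β ⊗ τ₂)).mem_comp (comp_insert_mem hβ g
      ((isStr_associator ρ τ₁ τ₂).inv.mem_comp (ih hf)))

theorem comp_mem_ncpHom {σ τ ν : Word C D} {f : σ ⟶ τ} {g : τ ⟶ ν} (hf : f ∈ ncpHom σ τ)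
    (hg : g ∈ ncpHom τ ν) : f ≫ g ∈ ncpHom σ ν := by
  refine ncpHom_induction (fun g => f ≫ g) (fun f g => by simp) (by simp)
    (fun z f => ⟨z, by simp⟩) (fun T => ?_) hg
  have h : f ≫ T.eval = ((f ≫ (λ_ τ).inv) ≫ 𝟙_ (Word C D) ◁ T.eval) ≫ (λ_ ν).hom := by simp
  rw [h]
  exact (isStr_leftUnitor ν).mem_comp (comp_eval_mem T ((isStr_leftUnitor τ).inv.mem_comp hf))

end Composition

/-! ### Schur's lemma for alternating words -/

section Schur

open Word RigidCStarTensorCategory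

section General

variable {C : Type u₁} [Category.{v₁} C] [MonoidalCategory C] [Preadditive C] [Linear ℂ C]
  [MonoidalPreadditive C] [MonoidalLinear ℂ C] [RigidCStarTensorCategory C]

theorem RigidCStarTensorCategory.eq_zero_of_comp_adj {X Y : C} {f : X ⟶ Y} (h : f ≫ adj f = 0) :
    f = 0 := by
  obtain ⟨N, hN⟩ := exists_norm (C := C)
  have h0 : N X X 0 = 0 := by
    have := hN.smul (0 : ℂ) (0 : X ⟶ X)
    simpa using this
  have h1 := hN.adj_comp_self f
  rw [h, h0] at h1
  exact hN.eq_zero f (by simpa using h1.symm)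

/-- Both `f ≫ adj f` and `adj f ≫ f` are scalars. The scalars agree by associativity and are nonzero
by the C*-identity, so `f` is invertible with inverse a multiple of its adjoint. -/
theorem IsSimpleObj.nonempty_iso {s t : C} (hs : IsSimpleObj s) (ht : IsSimpleObj t) {f : s ⟶ t}
    (hf : f ≠ 0) : Nonempty (s ≅ t) := by
  obtain ⟨c, hc⟩ := hs.2 (f ≫ adj f)
  obtain ⟨c', hc'⟩ := ht.2 (adj f ≫ f)
  have hc0 : c ≠ 0 := by
    rintro rfl
    exact hf (eq_zero_of_comp_adj (by rw [hc, zero_smul]))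
  have h : c • f = c' • f := by
    have h1 : (f ≫ adj f) ≫ f = f ≫ (adj f ≫ f) := Category.assoc _ _ _
    rw [hc, hc'] at h1
    simpa using h1
  obtain rfl : c = c' := smul_left_injective ℂ hf h
  exact ⟨⟨f, c⁻¹ • adj f, by rw [Linear.comp_smul, hc, inv_smul_smul₀ hc0],
    by rw [Linear.smul_comp, hc', inv_smul_smul₀ hc0]⟩⟩

theorem IsNontrivialIrr.eq_of_ne_zero {I : Set C} (hI : IsNontrivialIrr I) {a b : C} (ha : a ∈ I)
    (hb : b ∈ I) {f : a ⟶ b} (hf : f ≠ 0) : a = b := by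
  have h := (hI.1 a ha).1.nonempty_iso (hI.1 b hb).1 hf
  exact (hI.2 a (hI.1 a ha).1 (hI.1 a ha).2).unique ⟨ha, ⟨Iso.refl a⟩⟩ ⟨hb, h⟩

theorem IsNontrivialIrr.eq_zero_of_unit {I : Set C} (hI : IsNontrivialIrr I) {a : C} (ha : a ∈ I)
    (f : 𝟙_ C ⟶ a ⊗ 𝟙_ C) : f = 0 := by
  by_contra h
  have h' : f ≫ (ρ_ a).hom ≠ 0 := fun h0 => h (by
    rw [← cancel_mono (ρ_ a).hom, h0, Limits.zero_comp])
  obtain ⟨e⟩ := simple_unit.nonempty_iso (hI.1 a ha).1 h'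
  exact (hI.1 a ha).2.false e.symm

theorem IsNontrivialIrr.eq_smul_eqToHom {I : Set C} (hI : IsNontrivialIrr I) {a b : C} (ha : a ∈ I)
    (hb : b ∈ I) (f : a ⊗ 𝟙_ C ⟶ b ⊗ 𝟙_ C) :
    f = 0 ∨ ∃ (h : a = b) (z : ℂ), f = z • eqToHom (by rw [h]) := by
  by_cases h : f = 0
  · exact Or.inl h
  · have h' : (ρ_ a).inv ≫ f ≫ (ρ_ b).hom ≠ 0 := fun h0 => h (by
      rw [← cancel_epi (ρ_ a).inv, ← cancel_mono (ρ_ b).hom, Category.assoc, h0, Limits.comp_zero,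
        Limits.zero_comp])
    obtain rfl := hI.eq_of_ne_zero ha hb h'
    obtain ⟨z, hz⟩ := (hI.1 a ha).1.2 ((ρ_ a).inv ≫ f ≫ (ρ_ a).hom)
    refine Or.inr ⟨rfl, z, ?_⟩
    rw [eqToHom_refl, ← cancel_epi (ρ_ a).inv, ← cancel_mono (ρ_ a).hom, Category.assoc, hz]
    simp

end General

variable {C : Type u₁} [Category.{v₁} C] [MonoidalCategory C] [Preadditive C] [Linear ℂ C]
  [MonoidalPreadditive C] [MonoidalLinear ℂ C] [RigidCStarTensorCategory C]
variable {D : Type u₂} [Category.{v₂} D] [MonoidalCategory D] [Preadditive D] [Linear ℂ D]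
  [MonoidalPreadditive D] [MonoidalLinear ℂ D] [RigidCStarTensorCategory D]

/-- All letters of the word belong to `IC` or `ID`. -/
def Word.LettersIn {C : Type u₁} {D : Type u₂} (IC : Set C) (ID : Set D) (σ : Word C D) : Prop :=
  ∀ x ∈ σ.letters, Sum.elim (· ∈ IC) (· ∈ ID) x

/-- Neighbouring letters of the word have different colours. -/
def Word.Alternating {C : Type u₁} {D : Type u₂} (σ : Word C D) : Prop :=
  σ.letters.IsChain (fun x y => x.isLeft ≠ y.isLeft)

variable {IC : Set C} {ID : Set D}

theorem Word.lettersIn_tensor {σ τ : Word C D} :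
    LettersIn IC ID (σ ⊗ τ) ↔ LettersIn IC ID σ ∧ LettersIn IC ID τ := by
  constructor
  · intro h
    exact ⟨fun x hx => h x (List.mem_append_left _ hx), fun x hx => h x (List.mem_append_right _ hx)⟩
  · rintro ⟨h, h'⟩ x hx
    rcases List.mem_append.1 hx with hx | hx
    exacts [h x hx, h' x hx]

theorem Word.Alternating.of_tensor {σ τ : Word C D} (h : Alternating (σ ⊗ τ)) :
    Alternating σ ∧ Alternating τ :=
  ⟨(List.isChain_append.1 h).1, (List.isChain_append.1 h).2.1⟩

/-- The number of letters. -/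
def Word.len {C : Type u₁} {D : Type u₂} (σ : Word C D) : ℕ := σ.letters.length

theorem Word.len_tensor (σ τ : Word C D) : (σ ⊗ τ).len = σ.len + τ.len := List.length_append

theorem Word.len_eq_zero {σ : Word C D} : σ.len = 0 ↔ σ = empty := List.length_eq_zero_iff

theorem Word.exists_eq_letter {σ : Word C D} (h : σ.len = 1) : ∃ x, σ = letter x :=
  List.length_eq_one_iff.1 h

theorem Word.Alternating.len_le_one {c : Bool} {σ : Word C D} (h : Alternating σ) (hσ : Mono c σ) :
    σ.len ≤ 1 := by
  rcases σ with _ | ⟨x, _ | ⟨y, σ⟩⟩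
  · exact Nat.zero_le _
  · exact le_rfl
  · have h1 := (List.isChain_cons_cons.1 h).1
    exact absurd ((hσ x List.mem_cons_self).trans
      (hσ y (List.mem_cons_of_mem _ List.mem_cons_self)).symm) h1

theorem Word.eq_zero_of_unit (hIC : IsNontrivialIrr IC) (hID : IsNontrivialIrr ID) {y : C ⊕ D}
    (hy : Sum.elim (· ∈ IC) (· ∈ ID) y) (g : (empty : Word C D) ⟶ letter y) : g = 0 := by
  cases y with
  | inl a =>
    obtain ⟨f, hf⟩ := Deligne.exists_eq_tmul_left (X := toDeligne (empty : Word C D))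
      (Y := toDeligne (letter (Sum.inl a) : Word C D)) rfl rfl g
    obtain rfl : f = 0 := hIC.eq_zero_of_unit hy f
    exact hf.trans (Deligne.zero_tmul' _)
  | inr a =>
    obtain ⟨f, hf⟩ := Deligne.exists_eq_tmul_right (X := toDeligne (empty : Word C D))
      (Y := toDeligne (letter (Sum.inr a) : Word C D)) rfl rfl g
    obtain rfl : f = 0 := hID.eq_zero_of_unit hy f
    exact hf.trans (Deligne.tmul_zero' _)

theorem Word.letter_hom (hIC : IsNontrivialIrr IC) (hID : IsNontrivialIrr ID) {x y : C ⊕ D}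
    (hx : Sum.elim (· ∈ IC) (· ∈ ID) x) (hy : Sum.elim (· ∈ IC) (· ∈ ID) y)
    (hxy : x.isLeft = y.isLeft) (g : (letter x : Word C D) ⟶ letter y) :
    g = 0 ∨ ∃ (h : (letter x : Word C D) = letter y) (z : ℂ), g = z • eqToHom h := by
  rcases x with a | a <;> rcases y with b | b
  · obtain ⟨f, hf⟩ := Deligne.exists_eq_tmul_left (X := toDeligne (letter (Sum.inl a) : Word C D))
      (Y := toDeligne (letter (Sum.inl b) : Word C D)) rfl rfl g
    rcases hIC.eq_smul_eqToHom hx hy f with rfl | ⟨rfl, z, rfl⟩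
    · exact Or.inl (hf.trans (Deligne.zero_tmul' _))
    · exact Or.inr ⟨rfl, z, hf⟩
  · simp at hxy
  · simp at hxy
  · obtain ⟨f, hf⟩ := Deligne.exists_eq_tmul_right (X := toDeligne (letter (Sum.inr a) : Word C D))
      (Y := toDeligne (letter (Sum.inr b) : Word C D)) rfl rfl g
    rcases hID.eq_smul_eqToHom hx hy f with rfl | ⟨rfl, z, rfl⟩
    · exact Or.inl (hf.trans (Deligne.tmul_zero' _))
    · exact Or.inr ⟨rfl, z, hf.trans (Deligne.tmul_smul' _ _ _)⟩

/-- A monochromatic block has at most one letter in the alternating top word. If it has one and no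
letter at the bottom, it is a morphism from the unit to a nontrivial simple and vanishes. So every
block of a nonzero partition has at least as many bottom as top letters, and the length bound forces
each block to join one letter to one letter. Since letters represent distinct simple classes, such a
block is a scalar. -/
theorem NCP.eval_eq_smul_eqToHom (hIC : IsNontrivialIrr IC) (hID : IsNontrivialIrr ID)
    {σ τ : Word C D} (T : NCP σ τ) (hσ : LettersIn IC ID σ) (hτ : LettersIn IC ID τ)
    (hτ' : Alternating τ) (hl : σ.len ≤ τ.len) :
    T.eval = 0 ∨ ∃ (h : σ = τ) (z : ℂ), T.eval = z • eqToHom h := by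
  induction T with
  | nil => exact Or.inr ⟨rfl, 1, by rw [one_smul]; rfl⟩
  | @atLeft α β σ τ h b T ih =>
    rw [lettersIn_tensor] at hσ hτ
    rw [len_tensor, len_tensor] at hl
    obtain ⟨c, hα, hβ⟩ := b.exists_mono
    have hβ1 := hτ'.of_tensor.1.len_le_one hβ
    rw [NCP.eval_atLeft]
    -- If the rest has strictly fewer letters at the bottom than at the top, the induction
    -- hypothesis makes it zero. Otherwise `α` has at most as many letters as `β`, hence at most
    -- one.
    by_cases hlt : σ.len < τ.len
    · left
      rcases ih hσ.2 hτ.2 hτ'.of_tensor.2 hlt.le with h0 | ⟨rfl, -⟩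
      · rw [h0, MonoidalPreadditive.tensor_zero]
      · exact absurd hlt (lt_irrefl _)
    have hβ0 : β.len ≠ 0 := by
      intro h0
      have hα0 : α.len = 0 := by omega
      rw [len_eq_zero] at h0 hα0
      exact h.elim (fun h => h hα0) (fun h => h h0)
    obtain ⟨y, rfl⟩ := exists_eq_letter (show β.len = 1 by omega)
    have hy := hτ.1 y List.mem_cons_self
    by_cases hα0 : α.len = 0
    · rw [len_eq_zero] at hα0
      subst hα0
      left
      rw [eq_zero_of_unit hIC hID hy b.hom, MonoidalPreadditive.zero_tensor]
    · obtain ⟨x, rfl⟩ := exists_eq_letter (show α.len = 1 by omega)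
      have hx := hσ.1 x List.mem_cons_self
      have hxy : x.isLeft = y.isLeft := (hα x List.mem_cons_self).trans (hβ y List.mem_cons_self).symm
      rcases letter_hom hIC hID hx hy hxy b.hom with h0 | ⟨h1, z, hz⟩
      · left
        rw [h0, MonoidalPreadditive.zero_tensor]
      rcases ih hσ.2 hτ.2 hτ'.of_tensor.2 (by omega) with h0 | ⟨rfl, z', hz'⟩
      · left
        rw [h0, MonoidalPreadditive.tensor_zero]
      right
      obtain rfl : x = y := by simpa using List.singleton_injective h1
      refine ⟨rfl, z' * z, ?_⟩
      rw [hz, hz']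
      simp [MonoidalCategory.tensorHom_def, mul_smul]
  | @atBottom α τ σ₁ σ₂ h b T ih =>
    left
    rw [lettersIn_tensor, lettersIn_tensor] at hσ
    rw [len_tensor, len_tensor] at hl
    have hα : α.len ≠ 0 := fun h0 => h (len_eq_zero.1 h0)
    rw [NCP.eval_atBottom]
    -- Without the letters of `α` the bottom is strictly shorter than `τ`, so the equality of words
    -- is impossible and the rest vanishes.
    rcases ih (lettersIn_tensor.2 ⟨hσ.1, hσ.2.2⟩) hτ hτ' (by rw [len_tensor]; omega) with
      h0 | ⟨h1, -⟩
    · rw [h0, Limits.comp_zero]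
    · rw [← h1, len_tensor] at hl
      omega
  | @atTop β σ τ₁ τ₂ h b T ih =>
    left
    rw [lettersIn_tensor, lettersIn_tensor] at hτ
    obtain ⟨c, -, hβ⟩ := b.exists_mono
    have hβ1 := hτ'.of_tensor.2.of_tensor.1.len_le_one hβ
    have hβ0 : β.len ≠ 0 := fun h0 => h (len_eq_zero.1 h0)
    obtain ⟨y, rfl⟩ := exists_eq_letter (show β.len = 1 by omega)
    have h0 : (b.hom : 𝟙_ (Word C D) ⟶ letter y) = 0 :=
      eq_zero_of_unit hIC hID (hτ.2.1 y List.mem_cons_self) b.hom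
    rw [NCP.eval_atTop, h0]
    simp

theorem ncpHom_eq_zero_of_ne (hIC : IsNontrivialIrr IC) (hID : IsNontrivialIrr ID)
    {σ τ : Word C D} (hσ : LettersIn IC ID σ) (hτ : LettersIn IC ID τ)
    (hτ' : Alternating τ) (hl : σ.len ≤ τ.len) (hne : σ ≠ τ) {f : σ ⟶ τ} (hf : f ∈ ncpHom σ τ) :
    f = 0 := by
  have h : ncpHom σ τ ≤ ⊥ := by
    refine Submodule.span_le.2 ?_
    rintro _ ⟨T, rfl⟩
    rcases T.eval_eq_smul_eqToHom hIC hID hσ hτ hτ' hl with h | ⟨h, -⟩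
    · exact h
    · exact absurd h hne
  exact (Submodule.mem_bot ℂ).1 (h hf)

theorem ncpHom_eq_smul (hIC : IsNontrivialIrr IC) (hID : IsNontrivialIrr ID)
    {σ τ : Word C D} (hσ : LettersIn IC ID σ) (hσ' : Alternating σ) (h : σ = τ) {f : σ ⟶ τ}
    (hf : f ∈ ncpHom σ τ) : ∃ z : ℂ, f = z • eqToHom h := by
  subst h
  have h : ncpHom σ σ ≤ Submodule.span ℂ {𝟙 σ} := by
    refine Submodule.span_le.2 ?_
    rintro _ ⟨T, rfl⟩
    rcases T.eval_eq_smul_eqToHom hIC hID hσ hσ hσ' le_rfl with h | ⟨_, z, hz⟩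
    · rw [h]
      exact zero_mem _
    · rw [hz]
      exact Submodule.smul_mem _ _ (Submodule.mem_span_singleton_self _)
  obtain ⟨z, hz⟩ := Submodule.mem_span_singleton.1 (h hf)
  exact ⟨z, hz.symm⟩

/-- The mirror image, through the adjoint: now the source is the longer word and has to alternate.
-/
theorem ncpHom_eq_zero_of_ne' (hIC : IsNontrivialIrr IC) (hID : IsNontrivialIrr ID)
    {σ τ : Word C D} (hσ : LettersIn IC ID σ) (hτ : LettersIn IC ID τ)
    (hσ' : Alternating σ) (hl : τ.len ≤ σ.len) (hne : σ ≠ τ) {f : σ ⟶ τ} (hf : f ∈ ncpHom σ τ) :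
    f = 0 := by
  rw [← StarCategory.adj_adj f,
    ncpHom_eq_zero_of_ne hIC hID hτ hσ hσ' hl hne.symm (adj_mem hf), map_zero]

theorem ncpHom_eq_zero (hIC : IsNontrivialIrr IC) (hID : IsNontrivialIrr ID)
    {σ τ : Word C D} (hσ : LettersIn IC ID σ) (hτ : LettersIn IC ID τ)
    (hσ' : Alternating σ) (hτ' : Alternating τ) (hne : σ ≠ τ) {f : σ ⟶ τ} (hf : f ∈ ncpHom σ τ) :
    f = 0 := by
  rcases le_total σ.len τ.len with h | h
  · exact ncpHom_eq_zero_of_ne hIC hID hσ hτ hτ' h hne hf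
  · exact ncpHom_eq_zero_of_ne' hIC hID hσ hτ hσ' h hne hf

end Schur

/-! ### Inner products on morphism spaces of a rigid C*-tensor category -/

section InnerProducts

open scoped ComplexConjugate

theorem InnerProductSpace.Core.exists_tensor {V W : Type*} [AddCommGroup V] [Module ℂ V]
    [AddCommGroup W] [Module ℂ W] (c : InnerProductSpace.Core ℂ V)
    (c' : InnerProductSpace.Core ℂ W) :
    ∃ d : InnerProductSpace.Core ℂ (V ⊗[ℂ] W), ∀ x y x' y',
      d.inner (x ⊗ₜ y) (x' ⊗ₜ y') = c.inner x x' * c'.inner y y' := by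
  let _ : NormedAddCommGroup V := c.toNormedAddCommGroup
  let _ : InnerProductSpace ℂ V := InnerProductSpace.ofCore c.toCore
  let _ : NormedAddCommGroup W := c'.toNormedAddCommGroup
  let _ : InnerProductSpace ℂ W := InnerProductSpace.ofCore c'.toCore
  exact ⟨InnerProductSpace.toCore (𝕜 := ℂ) (E := V ⊗[ℂ] W), fun _ _ _ _ => rfl⟩

/-- The common square norm `r` is left free because in the application it is the value of the
functional at `1_c`, which need not be `1`. -/
theorem InnerProductSpace.Core.exists_orthogonal_finset {V : Type*} [AddCommGroup V] [Module ℂ V]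
    (c : InnerProductSpace.Core ℂ V) (N : Submodule ℂ V) [FiniteDimensional ℂ N] {r : ℝ}
    (hr : 0 < r) : ∃ s : Finset V, (∀ u ∈ s, c.inner u u = r) ∧
      (∀ u ∈ s, ∀ u' ∈ s, u ≠ u' → c.inner u u' = 0) ∧ Submodule.span ℂ (s : Set V) = N := by
  classical
  let _ : NormedAddCommGroup V := c.toNormedAddCommGroup
  let _ : InnerProductSpace ℂ V := InnerProductSpace.ofCore c.toCore
  let b := stdOrthonormalBasis ℂ N
  have hr0 : ((Real.sqrt r : ℝ) : ℂ) ≠ 0 := by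
    exact_mod_cast (Real.sqrt_pos.2 hr).ne'
  let e : Fin (Module.finrank ℂ N) → V := fun i => ((Real.sqrt r : ℝ) : ℂ) • (b i : V)
  have he : ∀ i j, c.inner (e i) (e j) = if i = j then (r : ℂ) else 0 := by
    intro i j
    change inner ℂ (e i) (e j) = _
    have h := orthonormal_iff_ite.1 b.orthonormal i j
    rw [Submodule.coe_inner] at h
    simp only [e, inner_smul_left, inner_smul_right, h, Complex.conj_ofReal]
    split_ifs
    · rw [mul_one, ← Complex.ofReal_mul, Real.mul_self_sqrt hr.le]
    · simp
  refine ⟨Finset.univ.image e, ?_, ?_, ?_⟩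
  · intro u hu
    obtain ⟨i, -, rfl⟩ := Finset.mem_image.1 hu
    rw [he, if_pos rfl]
  · intro u hu u' hu' hne
    obtain ⟨i, -, rfl⟩ := Finset.mem_image.1 hu
    obtain ⟨j, -, rfl⟩ := Finset.mem_image.1 hu'
    rw [he, if_neg (fun h => hne (by rw [h]))]
  · apply le_antisymm
    · refine Submodule.span_le.2 ?_
      intro u hu
      obtain ⟨i, -, rfl⟩ := Finset.mem_image.1 (Finset.mem_coe.1 hu)
      exact N.smul_mem _ (b i).2
    · intro x hx
      have h : (x : V) = ∑ i, (b.repr ⟨x, hx⟩ i) • (b i : V) := by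
        have := congrArg (Subtype.val) (b.sum_repr ⟨x, hx⟩)
        simpa using this.symm
      rw [h]
      refine Submodule.sum_mem _ fun i _ => Submodule.smul_mem _ _ ?_
      have h2 : (b i : V) = ((Real.sqrt r : ℝ) : ℂ)⁻¹ • e i := by
        simp only [e]
        rw [inv_smul_smul₀ hr0]
      rw [h2]
      exact Submodule.smul_mem _ _ (Submodule.subset_span (by simp))

namespace RigidCStarTensorCategory

variable {C : Type u₁} [Category.{v₁} C] [MonoidalCategory C] [Preadditive C] [Linear ℂ C]
  [MonoidalPreadditive C] [MonoidalLinear ℂ C] [RigidCStarTensorCategory C]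

theorem exists_coefficient {s : C} (hs : IsSimpleObj s) :
    ∃ φ : (s ⟶ s) →ₗ[ℂ] ℂ, ∀ f, f = φ f • 𝟙 s := by
  have hb : Function.Bijective (LinearMap.toSpanSingleton ℂ (s ⟶ s) (𝟙 s)) :=
    ⟨fun a b h => smul_left_injective ℂ hs.1 h, fun f => by
      obtain ⟨c, rfl⟩ := hs.2 f
      exact ⟨c, rfl⟩⟩
  refine ⟨(LinearEquiv.ofBijective _ hb).symm.toLinearMap, fun f => ?_⟩
  exact ((LinearEquiv.ofBijective _ hb).apply_symm_apply f).symm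

/-- The functional is `h ↦ ∑ i, v i* h v i`, read off on the simple summands of `X`. On a simple
object a positive endomorphism has the form `|c|²`, which gives positivity; faithfulness follows
since the `v i` decompose `X`. No trace property is claimed or needed. -/
theorem exists_trace (X : C) : ∃ t : (X ⟶ X) →ₗ[ℂ] ℂ, (∀ h, t (adj h) = conj (t h)) ∧
    ∀ (Y : C) (f : X ⟶ Y), ∃ r : ℝ, 0 ≤ r ∧ t (f ≫ adj f) = r ∧ (r = 0 → f = 0) := by
  obtain ⟨n, S, v, hS, -, hv⟩ := exists_decomposition X
  choose φ hφ using fun i => exists_coefficient (hS i)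
  have hφ' : ∀ i (z : ℂ), φ i (z • 𝟙 (S i)) = z := fun i z =>
    smul_left_injective ℂ (hS i).1 (hφ i _).symm
  let t : (X ⟶ X) →ₗ[ℂ] ℂ := ∑ i, φ i ∘ₗ Linear.rightComp ℂ (S i) (adj (v i)) ∘ₗ
    Linear.leftComp ℂ X (v i)
  have ht : ∀ h, t h = ∑ i, φ i ((v i ≫ h) ≫ adj (v i)) := fun h => by simp [t]
  refine ⟨t, fun h => ?_, fun Y f => ?_⟩
  · rw [ht, ht, map_sum]
    refine Finset.sum_congr rfl fun i _ => ?_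
    have h1 : (v i ≫ adj h) ≫ adj (v i) = adj ((v i ≫ h) ≫ adj (v i)) := by
      rw [StarCategory.adj_comp, StarCategory.adj_comp, StarCategory.adj_adj, Category.assoc]
    rw [h1, hφ i ((v i ≫ h) ≫ adj (v i)), map_smulₛₗ, adj_id, hφ', hφ']
  · have hr : ∀ i, ∃ r : ℝ, 0 ≤ r ∧ φ i ((v i ≫ (f ≫ adj f)) ≫ adj (v i)) = r ∧
        (r = 0 → v i ≫ f = 0) := by
      intro i
      have h1 : (v i ≫ (f ≫ adj f)) ≫ adj (v i) = (v i ≫ f) ≫ adj (v i ≫ f) := by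
        rw [StarCategory.adj_comp, Category.assoc, Category.assoc, Category.assoc]
      -- Here positivity in the C*-algebra enters: the adjoint alone would not make the scalar
      -- nonnegative.
      obtain ⟨g, hg⟩ := adj_comp_self_nonneg (v i ≫ f)
      obtain ⟨c, rfl⟩ := (hS i).2 g
      have h2 : (c • 𝟙 (S i)) ≫ adj (c • 𝟙 (S i)) = ((‖c‖ ^ 2 : ℝ) : ℂ) • 𝟙 (S i) := by
        rw [map_smulₛₗ, adj_id, Linear.smul_comp, Linear.comp_smul, Category.comp_id, smul_smul,
          Complex.mul_conj, Complex.normSq_eq_norm_sq]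
      refine ⟨‖c‖ ^ 2, sq_nonneg _, ?_, fun h => ?_⟩
      · rw [h1, hg, h2, hφ']
      · apply eq_zero_of_comp_adj
        rw [hg, h2, h]
        simp
    choose r hr0 hr1 hr2 using hr
    refine ⟨∑ i, r i, Finset.sum_nonneg fun i _ => hr0 i, ?_, fun h => ?_⟩
    · rw [ht, Complex.ofReal_sum]
      exact Finset.sum_congr rfl fun i _ => hr1 i
    · have h1 := (Finset.sum_eq_zero_iff_of_nonneg fun i _ => hr0 i).1 h
      have h2 : f = ∑ i, (adj (v i) ≫ v i) ≫ f := by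
        rw [← Preadditive.sum_comp, hv, Category.id_comp]
      rw [h2]
      refine Finset.sum_eq_zero fun i hi => ?_
      rw [Category.assoc, hr2 i (h1 i hi), Limits.comp_zero]

theorem exists_trace_core (X : C) : ∃ t : (X ⟶ X) →ₗ[ℂ] ℂ, ∀ Y : C,
    ∃ c : InnerProductSpace.Core ℂ (X ⟶ Y), ∀ f g, c.inner f g = t (g ≫ adj f) := by
  obtain ⟨t, ht, ht'⟩ := exists_trace X
  refine ⟨t, fun Y => ⟨{
    inner := fun f g => t (g ≫ adj f)
    conj_inner_symm := fun f g => by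
      rw [← ht, StarCategory.adj_comp, StarCategory.adj_adj]
    re_inner_nonneg := fun f => by
      obtain ⟨r, hr, h, -⟩ := ht' Y f
      rw [h]
      exact hr
    add_left := fun f g h => by rw [map_add, Preadditive.comp_add, map_add]
    smul_left := fun f g z => by rw [map_smulₛₗ, Linear.comp_smul, map_smul]; rfl
    definite := fun f hf => by
      obtain ⟨r, hr, h, h0⟩ := ht' Y f
      exact h0 (by exact_mod_cast h.symm.trans hf) }, fun _ _ => rfl⟩⟩

theorem finiteDimensional_hom_simple {s t : C} (hs : IsSimpleObj s) (ht : IsSimpleObj t) :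
    FiniteDimensional ℂ (s ⟶ t) := by
  by_cases h : ∀ f : s ⟶ t, f = 0
  · have : Subsingleton (s ⟶ t) := ⟨fun f g => by rw [h f, h g]⟩
    infer_instance
  · push Not at h
    obtain ⟨f, hf⟩ := h
    obtain ⟨e⟩ := hs.nonempty_iso ht hf
    obtain ⟨φ, hφ⟩ := exists_coefficient hs
    refine Module.Finite.of_injective (φ ∘ₗ Linear.rightComp ℂ s e.inv) ?_
    intro f g hfg
    have h1 : φ (f ≫ e.inv) = φ (g ≫ e.inv) := hfg
    rw [← cancel_mono e.inv, hφ (f ≫ e.inv), hφ (g ≫ e.inv), h1]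

theorem finiteDimensional_hom (X Y : C) : FiniteDimensional ℂ (X ⟶ Y) := by
  obtain ⟨n, S, v, hS, -, hv⟩ := exists_decomposition X
  obtain ⟨m, T, w, hT, -, hw⟩ := exists_decomposition Y
  have : ∀ i j, FiniteDimensional ℂ (S i ⟶ T j) := fun i j =>
    finiteDimensional_hom_simple (hS i) (hT j)
  let L : (X ⟶ Y) →ₗ[ℂ] (∀ i j, (S i ⟶ T j)) := LinearMap.pi fun i => LinearMap.pi fun j =>
    Linear.rightComp ℂ (S i) (adj (w j)) ∘ₗ Linear.leftComp ℂ Y (v i)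
  refine Module.Finite.of_injective L ?_
  rw [injective_iff_map_eq_zero]
  intro f hf
  have h0 : ∀ i j, (v i ≫ f) ≫ adj (w j) = 0 := fun i j => congrFun (congrFun hf i) j
  have h1 : f = ∑ i, ∑ j, (adj (v i) ≫ v i) ≫ f ≫ (adj (w j) ≫ w j) := by
    simp_rw [← Preadditive.comp_sum]
    rw [hw, ← Preadditive.sum_comp, hv]
    simp
  rw [h1]
  refine Finset.sum_eq_zero fun i _ => Finset.sum_eq_zero fun j _ => ?_
  have h2 := h0 i j
  have h3 : (adj (v i) ≫ v i) ≫ f ≫ adj (w j) ≫ w j =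
      adj (v i) ≫ ((v i ≫ f) ≫ adj (w j)) ≫ w j := by simp only [Category.assoc]
  rw [h3, h2, Limits.zero_comp, Limits.comp_zero]

end RigidCStarTensorCategory

end InnerProducts

/-! ### Inner products and orthonormal bases for words -/

section WordInner

open Word RigidCStarTensorCategory

variable {C : Type u₁} [Category.{v₁} C] [MonoidalCategory C] [Preadditive C] [Linear ℂ C]
  [MonoidalPreadditive C] [MonoidalLinear ℂ C] [RigidCStarTensorCategory C]
variable {D : Type u₂} [Category.{v₂} D] [MonoidalCategory D] [Preadditive D] [Linear ℂ D]
  [MonoidalPreadditive D] [MonoidalLinear ℂ D] [RigidCStarTensorCategory D]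
variable {IC : Set C} {ID : Set D}

/-- The product of the two functionals serves. Definiteness on the tensor product is inherited from
the inner product of a tensor product of inner product spaces. -/
theorem Deligne.exists_trace_core (X : Deligne C D) : ∃ t : (X ⟶ X) →ₗ[ℂ] ℂ, ∀ Y : Deligne C D,
    ∃ c : InnerProductSpace.Core ℂ (X ⟶ Y), ∀ f g, c.inner f g = t (g ≫ adj f) := by
  obtain ⟨t₁, h₁⟩ := RigidCStarTensorCategory.exists_trace_core X.fst
  obtain ⟨t₂, h₂⟩ := RigidCStarTensorCategory.exists_trace_core X.snd
  let t : (X ⟶ X) →ₗ[ℂ] ℂ := LinearMap.mul' ℂ ℂ ∘ₗ TensorProduct.map t₁ t₂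
  have ht : ∀ a b, t (tmul a b) = t₁ a * t₂ b := fun a b => rfl
  refine ⟨t, fun Y => ?_⟩
  obtain ⟨c₁, hc₁⟩ := h₁ Y.fst
  obtain ⟨c₂, hc₂⟩ := h₂ Y.snd
  obtain ⟨c, hc⟩ := c₁.exists_tensor c₂
  let c' : InnerProductSpace.Core ℂ (X ⟶ Y) := c
  have hc' : ∀ x y x' y', c'.inner (tmul x y) (tmul x' y') = c₁.inner x x' * c₂.inner y y' := hc
  have add_right : ∀ x y z, c'.inner x (y + z) = c'.inner x y + c'.inner x z := by
    intro x y z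
    rw [← c'.conj_inner_symm, c'.add_left, map_add, c'.conj_inner_symm, c'.conj_inner_symm]
  have zero_left : ∀ x, c'.inner 0 x = 0 := by
    intro x
    have := c'.smul_left 0 x 0
    simpa using this
  have zero_right : ∀ x, c'.inner x 0 = 0 := by
    intro x
    rw [← c'.conj_inner_symm, zero_left, map_zero]
  refine ⟨c', fun f g => ?_⟩
  induction f using hom_induction with
  | zero => rw [zero_left, map_zero, Limits.comp_zero, map_zero]
  | add f f' hf hf' => rw [c'.add_left, hf, hf', map_add, Preadditive.comp_add, map_add]
  | tmul a b =>
    induction g using hom_induction with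
    | zero => rw [zero_right, Limits.zero_comp, map_zero]
    | add g g' hg hg' => rw [add_right, hg, hg', Preadditive.add_comp, map_add]
    | tmul a' b' =>
      rw [hc', hc₁, hc₂]
      exact (ht (a' ≫ adj a) (b' ≫ adj b)).symm

theorem Word.exists_trace_core (σ : Word C D) : ∃ t : (σ ⟶ σ) →ₗ[ℂ] ℂ, ∀ τ : Word C D,
    ∃ c : InnerProductSpace.Core ℂ (σ ⟶ τ), ∀ f g, c.inner f g = t (g ≫ adj f) := by
  obtain ⟨t, ht⟩ := Deligne.exists_trace_core (toDeligne σ)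
  exact ⟨t, fun τ => ht (toDeligne τ)⟩

theorem Word.finiteDimensional_hom (σ τ : Word C D) : FiniteDimensional ℂ (σ ⟶ τ) := by
  have := RigidCStarTensorCategory.finiteDimensional_hom (left σ) (left τ)
  have := RigidCStarTensorCategory.finiteDimensional_hom (right σ) (right τ)
  exact inferInstanceAs (FiniteDimensional ℂ ((left σ ⟶ left τ) ⊗[ℂ] (right σ ⟶ right τ)))

theorem Word.eq_zero_of_comp_adj {σ τ : Word C D} {f : σ ⟶ τ} (h : f ≫ adj f = 0) : f = 0 := by
  obtain ⟨t, ht⟩ := exists_trace_core σ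
  obtain ⟨c, hc⟩ := ht τ
  exact c.definite f (by rw [hc, h, map_zero])

/-- By Schur's lemma `u ≫ adj u'` is a multiple of `1_c`, so the scalar valued inner product of the
definition is that of the functional `t` divided by `t 1_c`. An orthogonal family of square norm `t
1_c` is therefore orthonormal in the required sense. -/
theorem exists_isOnb (hIC : IsNontrivialIrr IC) (hID : IsNontrivialIrr ID) {c : Word C D}
    (hc : LettersIn IC ID c) (hc' : Alternating c) (h1 : 𝟙 c ≠ 0) (τ : Word C D) :
    ∃ s, IsOnb c τ s := by
  obtain ⟨t, ht⟩ := exists_trace_core c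
  obtain ⟨k, hk⟩ := ht τ
  obtain ⟨k₁, hk₁⟩ := ht c
  have e1 : k₁.inner (𝟙 c) (𝟙 c) = t (𝟙 c) := by rw [hk₁, adj_id, Category.comp_id]
  have e2 : ((k₁.inner (𝟙 c) (𝟙 c)).re : ℂ) = k₁.inner (𝟙 c) (𝟙 c) := by
    rw [← Complex.conj_eq_iff_re]
    exact k₁.conj_inner_symm _ _
  have e3 : (t (𝟙 c)) ≠ 0 := fun h => h1 (k₁.definite _ (e1.trans h))
  have e4 : 0 < (k₁.inner (𝟙 c) (𝟙 c)).re := by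
    refine lt_of_le_of_ne (k₁.re_inner_nonneg _) fun h => e3 ?_
    rw [← e1, ← e2, ← h, Complex.ofReal_zero]
  have := Word.finiteDimensional_hom c τ
  obtain ⟨s, hs1, hs2, hs3⟩ := k.exists_orthogonal_finset (FreeProd.wordHoms c τ) e4
  have hmem : ∀ u ∈ s, u ∈ ncpHom c τ := by
    intro u hu
    rw [← FreeProd.wordHoms_eq, ← hs3]
    exact Submodule.subset_span hu
  have key : ∀ u ∈ s, ∀ u' ∈ s, ∃ z : ℂ, u ≫ adj u' = z • 𝟙 c ∧ k.inner u' u = z * t (𝟙 c) := by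
    intro u hu u' hu'
    obtain ⟨z, hz⟩ := ncpHom_eq_smul hIC hID hc hc' rfl
      (comp_mem_ncpHom (hmem u hu) (adj_mem (hmem u' hu')))
    rw [eqToHom_refl] at hz
    exact ⟨z, hz, by rw [hk, hz, map_smul, smul_eq_mul]⟩
  refine ⟨s, ?_, ?_, hs3⟩
  · intro u hu
    obtain ⟨z, hz, hz'⟩ := key u hu u hu
    rw [hs1 u hu, e2, e1] at hz'
    have : z = 1 := by
      have h := mul_right_cancel₀ e3 (hz'.symm.trans (one_mul _).symm)
      exact h
    rw [hz, this, one_smul]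
  · intro u hu u' hu' hne
    obtain ⟨z, hz, hz'⟩ := key u hu u' hu'
    rw [hs2 u' hu' u hu hne.symm] at hz'
    have : z = 0 := by
      rcases mul_eq_zero.1 hz'.symm with h | h
      · exact h
      · exact absurd h e3
    rw [hz, this, zero_smul]

theorem onb_isOnb (hIC : IsNontrivialIrr IC) (hID : IsNontrivialIrr ID) {c : Word C D}
    (hc : LettersIn IC ID c) (hc' : Alternating c) (h1 : 𝟙 c ≠ 0) (τ : Word C D) :
    IsOnb c τ (onb c τ) := by
  have h := exists_isOnb hIC hID hc hc' h1 τ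
  rw [onb, dif_pos h]
  exact h.choose_spec

end WordInner

/-! ### Diagram calculus for duals and for morphisms on the annulus -/

section AnnularDiagrams

variable {C : Type u₁} [Category.{v₁} C] [MonoidalCategory C]

/-- `η` and `ε` satisfy the duality equations. -/
structure Zigzag {a a' : C} (η : 𝟙_ C ⟶ a ⊗ a') (ε : a' ⊗ a ⟶ 𝟙_ C) : Prop where
  left : (λ_ a).inv ≫ η ▷ a ≫ (α_ a a' a).hom ≫ a ◁ ε ≫ (ρ_ a).hom = 𝟙 a
  right : (ρ_ a').inv ≫ a' ◁ η ≫ (α_ a' a a').inv ≫ ε ▷ a' ≫ (λ_ a').hom = 𝟙 a'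

/-- Makes `ExactPairing.tensor` and the transport of exact pairings along isomorphisms and functors
available for `Zigzag`. -/
theorem zigzag_iff_exactPairing {a a' : C} {η : 𝟙_ C ⟶ a ⊗ a'} {ε : a' ⊗ a ⟶ 𝟙_ C} :
    Zigzag η ε ↔ ∃ p : ExactPairing a a', p.coevaluation' = η ∧ p.evaluation' = ε := by
  constructor
  · intro h
    refine ⟨⟨η, ε, ?_, ?_⟩, rfl, rfl⟩
    · rw [← Iso.inv_comp_eq, ← cancel_mono (λ_ a').hom]
      simpa using h.right
    · rw [← Iso.inv_comp_eq, ← cancel_mono (ρ_ a).hom]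
      simpa using h.left
  · rintro ⟨p, rfl, rfl⟩
    refine ⟨?_, ?_⟩
    · have h := p.evaluation_coevaluation'
      rw [← Iso.inv_comp_eq, ← cancel_mono (ρ_ a).hom] at h
      simpa using h
    · have h := p.coevaluation_evaluation'
      rw [← Iso.inv_comp_eq, ← cancel_mono (λ_ a').hom] at h
      simpa using h

/-- The coevaluation of a tensor product. -/
def coevTensor {a a' b b' : C} (η : 𝟙_ C ⟶ a ⊗ a') (η' : 𝟙_ C ⟶ b ⊗ b') :
    𝟙_ C ⟶ (a ⊗ b) ⊗ (b' ⊗ a') :=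
  η ≫ a ◁ ((λ_ a').inv ≫ η' ▷ a' ≫ (α_ b b' a').hom) ≫ (α_ a b (b' ⊗ a')).inv

/-- The evaluation of a tensor product. -/
def evTensor {a a' b b' : C} (ε : a' ⊗ a ⟶ 𝟙_ C) (ε' : b' ⊗ b ⟶ 𝟙_ C) :
    (b' ⊗ a') ⊗ (a ⊗ b) ⟶ 𝟙_ C :=
  (α_ b' a' (a ⊗ b)).hom ≫ b' ◁ ((α_ a' a b).inv ≫ ε ▷ b ≫ (λ_ b).hom) ≫ ε'

theorem Zigzag.tensor {a a' b b' : C} {η : 𝟙_ C ⟶ a ⊗ a'} {ε : a' ⊗ a ⟶ 𝟙_ C}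
    {η' : 𝟙_ C ⟶ b ⊗ b'} {ε' : b' ⊗ b ⟶ 𝟙_ C} (h : Zigzag η ε) (h' : Zigzag η' ε') :
    Zigzag (coevTensor η η') (evTensor ε ε') := by
  obtain ⟨p, rfl, rfl⟩ := zigzag_iff_exactPairing.1 h
  obtain ⟨p', rfl, rfl⟩ := zigzag_iff_exactPairing.1 h'
  refine zigzag_iff_exactPairing.2 ⟨ExactPairing.tensor, ?_, ?_⟩
  · have h1 := ExactPairing.tensor_coevaluation (X₁ := a) (X₂ := b) (Y₁ := a') (Y₂ := b')
    refine Eq.trans h1 ?_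
    change _ = coevTensor (η_ a a') (η_ b b')
    rw [coevTensor]
    monoidal
  · have h1 := ExactPairing.tensor_evaluation (X₁ := a) (X₂ := b) (Y₁ := a') (Y₂ := b')
    refine Eq.trans h1 ?_
    change _ = evTensor (ε_ a a') (ε_ b b')
    rw [evTensor]
    monoidal

theorem zigzag_unit : Zigzag (λ_ (𝟙_ C)).inv (λ_ (𝟙_ C)).hom := by
  constructor <;> monoidal

/-- Another coevaluation `η₂` differs from `η` by a morphism of the duals alone. With Schur's lemma
this yields the uniqueness of conjugates. -/
theorem Zigzag.coev_eq {a a' b' : C} {η : 𝟙_ C ⟶ a ⊗ a'} {ε : a' ⊗ a ⟶ 𝟙_ C}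
    (h : Zigzag η ε) (η₂ : 𝟙_ C ⟶ a ⊗ b') :
    η ≫ a ◁ ((ρ_ a').inv ≫ a' ◁ η₂ ≫ (α_ a' a b').inv ≫ ε ▷ b' ≫ (λ_ b').hom) = η₂ := by
  calc _ = 𝟙 _ ⊗≫ (η ▷ (𝟙_ C) ≫ (a ⊗ a') ◁ η₂) ⊗≫ a ◁ (ε ▷ b') ⊗≫ 𝟙 _ := by monoidal
    _ = η₂ ≫ ((λ_ a).inv ≫ η ▷ a ≫ (α_ a a' a).hom ≫ a ◁ ε ≫ (ρ_ a).hom) ▷ b' := by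
      rw [← whisker_exchange]; monoidal
    _ = η₂ := by rw [h.left, id_whiskerRight, Category.comp_id]

variable {w : C}

/-- The composite of `f : a w ⟶ w a` and `g : b w ⟶ w b` on the tensor product. -/
def annComp {a b : C} (f : a ⊗ w ⟶ w ⊗ a) (g : b ⊗ w ⟶ w ⊗ b) : (a ⊗ b) ⊗ w ⟶ w ⊗ (a ⊗ b) :=
  (α_ a b w).hom ≫ (a ◁ g) ≫ (α_ a w b).inv ≫ (f ▷ b) ≫ (α_ w a b).hom

/-- The composite of `f : w a ⟶ a w` and `g : w b ⟶ b w` on the tensor product. -/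
def annOp {a b : C} (f : w ⊗ a ⟶ a ⊗ w) (g : w ⊗ b ⟶ b ⊗ w) : w ⊗ (a ⊗ b) ⟶ (a ⊗ b) ⊗ w :=
  (α_ w a b).inv ≫ (f ▷ b) ≫ (α_ a w b).hom ≫ (a ◁ g) ≫ (α_ a b w).inv

/-- The rotation of `f : w a ⟶ a w` by a duality. -/
def annDual {a a' : C} (η : 𝟙_ C ⟶ a ⊗ a') (ε : a' ⊗ a ⟶ 𝟙_ C) (f : w ⊗ a ⟶ a ⊗ w) :
    a' ⊗ w ⟶ w ⊗ a' :=
  a' ◁ ((ρ_ w).inv ≫ (w ◁ η) ≫ (α_ w a a').inv ≫ (f ▷ a') ≫ (α_ a w a').hom) ≫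
    (α_ a' a (w ⊗ a')).inv ≫ (ε ▷ (w ⊗ a')) ≫ (λ_ (w ⊗ a')).hom

/-- `h` and `f` correspond to each other under the coevaluation `η`. -/
def Mate {a a' : C} (η : 𝟙_ C ⟶ a ⊗ a') (f : w ⊗ a ⟶ a ⊗ w) (h : a' ⊗ w ⟶ w ⊗ a') : Prop :=
  (λ_ w).inv ≫ η ▷ w ≫ (α_ a a' w).hom ≫ a ◁ h =
    (ρ_ w).inv ≫ w ◁ η ≫ (α_ w a a').inv ≫ f ▷ a' ≫ (α_ a w a').hom

theorem Zigzag.mate_annDual {a a' : C} {η : 𝟙_ C ⟶ a ⊗ a'} {ε : a' ⊗ a ⟶ 𝟙_ C}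
    (h : Zigzag η ε) (f : w ⊗ a ⟶ a ⊗ w) : Mate η f (annDual η ε f) := by
  rw [Mate, annDual]
  generalize (ρ_ w).inv ≫ w ◁ η ≫ (α_ w a a').inv ≫ f ▷ a' ≫ (α_ a w a').hom = k
  calc _ = 𝟙 _ ⊗≫ (η ▷ w ≫ (a ⊗ a') ◁ k) ⊗≫ a ◁ (ε ▷ (w ⊗ a')) ⊗≫ 𝟙 _ := by monoidal
    _ = k ≫ ((λ_ a).inv ≫ η ▷ a ≫ (α_ a a' a).hom ≫ a ◁ ε ≫ (ρ_ a).hom) ▷ (w ⊗ a') := by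
      rw [← whisker_exchange]; monoidal
    _ = k := by rw [h.left, id_whiskerRight, Category.comp_id]

/-- The rotated morphism is the only solution of the mate equation, in which `ε` does not occur.
Identities for the involution are proved by verifying that equation. -/
theorem Zigzag.eq_annDual {a a' : C} {η : 𝟙_ C ⟶ a ⊗ a'} {ε : a' ⊗ a ⟶ 𝟙_ C}
    (h : Zigzag η ε) {f : w ⊗ a ⟶ a ⊗ w} {g : a' ⊗ w ⟶ w ⊗ a'} (hg : Mate η f g) :
    g = annDual η ε f := by
  rw [annDual, ← hg]
  symm
  calc _ = 𝟙 _ ⊗≫ a' ◁ (η ▷ w) ⊗≫ ((a' ⊗ a) ◁ g ≫ ε ▷ (w ⊗ a')) ⊗≫ 𝟙 _ := by monoidal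
    _ = ((ρ_ a').inv ≫ a' ◁ η ≫ (α_ a' a a').inv ≫ ε ▷ a' ≫ (λ_ a').hom) ▷ w ≫ g := by
      rw [whisker_exchange]; monoidal
    _ = g := by rw [h.right, id_whiskerRight, Category.id_comp]

theorem Zigzag.annDual_ev {a a' : C} {η : 𝟙_ C ⟶ a ⊗ a'} {ε : a' ⊗ a ⟶ 𝟙_ C}
    (h : Zigzag η ε) (f : w ⊗ a ⟶ a ⊗ w) :
    (α_ a' w a).inv ≫ annDual η ε f ▷ a ≫ (α_ w a' a).hom ≫ w ◁ ε ≫ (ρ_ w).hom =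
      a' ◁ f ≫ (α_ a' a w).inv ≫ ε ▷ w ≫ (λ_ w).hom := by
  rw [annDual]
  calc _ = 𝟙 _ ⊗≫ a' ◁ ((w ◁ η) ▷ a) ⊗≫ a' ◁ (f ▷ (a' ⊗ a)) ⊗≫
        (ε ▷ (w ⊗ (a' ⊗ a)) ≫ 𝟙_ C ◁ (w ◁ ε)) ⊗≫ 𝟙 _ := by monoidal
    _ = 𝟙 _ ⊗≫ a' ◁ ((w ◁ η) ▷ a) ⊗≫ a' ◁ (f ▷ (a' ⊗ a) ≫ (a ⊗ w) ◁ ε) ⊗≫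
        ε ▷ w ⊗≫ 𝟙 _ := by rw [← whisker_exchange]; monoidal
    _ = a' ◁ (w ◁ ((λ_ a).inv ≫ η ▷ a ≫ (α_ a a' a).hom ≫ a ◁ ε ≫ (ρ_ a).hom) ≫ f) ≫
        (α_ a' a w).inv ≫ ε ▷ w ≫ (λ_ w).hom := by
      rw [← whisker_exchange]; monoidal
    _ = _ := by rw [h.left, whiskerLeft_id, Category.id_comp]

theorem Mate.tensor {a a' b b' : C} {η : 𝟙_ C ⟶ a ⊗ a'} {η' : 𝟙_ C ⟶ b ⊗ b'}
    {f : w ⊗ a ⟶ a ⊗ w} {f' : w ⊗ b ⟶ b ⊗ w} {h : a' ⊗ w ⟶ w ⊗ a'} {h' : b' ⊗ w ⟶ w ⊗ b'}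
    (H : Mate η f h) (H' : Mate η' f' h') :
    Mate (coevTensor η η') (annOp f f') (annComp h' h) := by
  rw [Mate] at *
  rw [coevTensor, annOp, annComp]
  calc _ = 𝟙 _ ⊗≫ η ▷ w ⊗≫ a ◁ (η' ▷ (a' ⊗ w) ≫ (b ⊗ b') ◁ h) ⊗≫
        a ◁ b ◁ (h' ▷ a') ⊗≫ 𝟙 _ := by monoidal
    _ = ((λ_ w).inv ≫ η ▷ w ≫ (α_ a a' w).hom ≫ a ◁ h) ⊗≫
        a ◁ (((λ_ w).inv ≫ η' ▷ w ≫ (α_ b b' w).hom ≫ b ◁ h') ▷ a') ⊗≫ 𝟙 _ := by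
      rw [← whisker_exchange]; monoidal
    _ = 𝟙 _ ⊗≫ w ◁ η ⊗≫ (f ▷ (𝟙_ C) ≫ (a ⊗ w) ◁ η') ▷ a' ⊗≫ a ◁ (f' ▷ (b' ⊗ a')) ⊗≫ 𝟙 _ := by
      rw [H, H']; monoidal
    _ = _ := by rw [← whisker_exchange]; monoidal

/-- With its three companions it shows that a slide of one factor is a slide of the composite: each
pair exhibits the same middle morphism, with the whiskered `θ` before it and after it. -/
theorem annComp_whiskerRight_left {a b c : C} (θ : a ⟶ b) (F : b ⊗ w ⟶ w ⊗ a) (g : c ⊗ w ⟶ w ⊗ c) :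
    annComp (θ ▷ w ≫ F) g = (θ ▷ c) ▷ w ≫
      ((α_ b c w).hom ≫ (b ◁ g) ≫ (α_ b w c).inv ≫ (F ▷ c) ≫ (α_ w a c).hom) := by
  rw [annComp]
  calc _ = 𝟙 _ ⊗≫ (a ◁ g ≫ θ ▷ (w ⊗ c)) ⊗≫ F ▷ c ⊗≫ 𝟙 _ := by monoidal
    _ = _ := by rw [whisker_exchange]; monoidal

theorem annComp_whiskerLeft_left {a b c : C} (θ : a ⟶ b) (F : b ⊗ w ⟶ w ⊗ a) (g : c ⊗ w ⟶ w ⊗ c) :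
    annComp (F ≫ w ◁ θ) g =
      ((α_ b c w).hom ≫ (b ◁ g) ≫ (α_ b w c).inv ≫ (F ▷ c) ≫ (α_ w a c).hom) ≫ w ◁ (θ ▷ c) := by
  rw [annComp]
  monoidal

theorem annComp_whiskerRight_right {a b c : C} (θ : a ⟶ b) (F : b ⊗ w ⟶ w ⊗ a)
    (g : c ⊗ w ⟶ w ⊗ c) :
    annComp g (θ ▷ w ≫ F) = (c ◁ θ) ▷ w ≫
      ((α_ c b w).hom ≫ (c ◁ F) ≫ (α_ c w a).inv ≫ (g ▷ a) ≫ (α_ w c a).hom) := by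
  rw [annComp]
  monoidal

theorem annComp_whiskerLeft_right {a b c : C} (θ : a ⟶ b) (F : b ⊗ w ⟶ w ⊗ a)
    (g : c ⊗ w ⟶ w ⊗ c) :
    annComp g (F ≫ w ◁ θ) =
      ((α_ c b w).hom ≫ (c ◁ F) ≫ (α_ c w a).inv ≫ (g ▷ a) ≫ (α_ w c a).hom) ≫ w ◁ (c ◁ θ) := by
  rw [annComp]
  calc _ = 𝟙 _ ⊗≫ c ◁ F ⊗≫ ((c ⊗ w) ◁ θ ≫ g ▷ b) ⊗≫ 𝟙 _ := by monoidal
    _ = _ := by rw [whisker_exchange]; monoidal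

theorem annComp_assoc {a b c : C} (f : a ⊗ w ⟶ w ⊗ a) (g : b ⊗ w ⟶ w ⊗ b) (h : c ⊗ w ⟶ w ⊗ c) :
    annComp (annComp f g) h =
      (α_ a b c).hom ▷ w ≫ annComp f (annComp g h) ≫ w ◁ (α_ a b c).inv := by
  simp only [annComp]
  monoidal

theorem unit_annComp {a : C} (f : a ⊗ w ⟶ w ⊗ a) :
    annComp ((λ_ w).hom ≫ (ρ_ w).inv) f = (λ_ a).hom ▷ w ≫ f ≫ w ◁ (λ_ a).inv := by
  rw [annComp]
  monoidal

theorem annComp_unit {a : C} (f : a ⊗ w ⟶ w ⊗ a) :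
    annComp f ((λ_ w).hom ≫ (ρ_ w).inv) = (ρ_ a).hom ▷ w ≫ f ≫ w ◁ (ρ_ a).inv := by
  rw [annComp]
  monoidal

theorem mate_unit : Mate (λ_ (𝟙_ C)).inv ((ρ_ w).hom ≫ (λ_ w).inv)
    ((λ_ w).hom ≫ (ρ_ w).inv) := by
  rw [Mate]
  monoidal

/-! ### The rotation by `v` and its inverse -/

section Rotation

variable {v v' w₁ w₂ : C} (s₁ : w ≅ v ⊗ w₁) (s₂ : w ≅ w₁ ⊗ v)

/-- The rotation of `w = v w₁ = w₁ v` by `v`. -/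
def rot : v ⊗ w ≅ w ⊗ v :=
  whiskerLeftIso v s₂ ≪≫ (α_ v w₁ v).symm ≪≫ whiskerRightIso s₁.symm v

/-- The inverse rotation of `w = v w₁ = w₁ v`. -/
def rotDual (η : 𝟙_ C ⟶ v ⊗ v') (ε : v' ⊗ v ⟶ 𝟙_ C) : v' ⊗ w ⟶ w ⊗ v' :=
  v' ◁ s₁.hom ≫ (α_ v' v w₁).inv ≫ ε ▷ w₁ ≫ (λ_ w₁).hom ≫ (ρ_ w₁).inv ≫ w₁ ◁ η ≫
    (α_ w₁ v v').inv ≫ s₂.inv ▷ v'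

theorem annDual_rot_inv (η : 𝟙_ C ⟶ v ⊗ v') (ε : v' ⊗ v ⟶ 𝟙_ C) :
    annDual η ε (rot s₁ s₂).inv = rotDual s₁ s₂ η ε := by
  rw [annDual, rotDual, rot]
  simp only [Iso.trans_inv, whiskerLeftIso_inv, whiskerRightIso_inv, Iso.symm_inv]
  calc _ = 𝟙 _ ⊗≫ v' ◁ (w ◁ η ≫ s₁.hom ▷ (v ⊗ v')) ⊗≫ v' ◁ (v ◁ (s₂.inv ▷ v')) ⊗≫
        ε ▷ (w ⊗ v') ⊗≫ 𝟙 _ := by monoidal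
    _ = 𝟙 _ ⊗≫ v' ◁ (s₁.hom ▷ (𝟙_ C)) ⊗≫ ((v' ⊗ v) ◁ (w₁ ◁ η ≫ (α_ w₁ v v').inv ≫ s₂.inv ▷ v') ≫
        ε ▷ (w ⊗ v')) ⊗≫ 𝟙 _ := by rw [whisker_exchange]; monoidal
    _ = _ := by rw [whisker_exchange]; monoidal

/-- The juxtaposition factors as `ε` followed by a rest. Moving `ε` around the annulus to the other
end of the rest produces the unit, by `Zigzag.rotDual_rot_trace`. -/
theorem annComp_rotDual_rot (η : 𝟙_ C ⟶ v ⊗ v') (ε : v' ⊗ v ⟶ 𝟙_ C) :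
    annComp (rotDual s₁ s₂ η ε) (rot s₁ s₂).hom =
      ε ▷ w ≫ ((λ_ w).hom ≫ s₂.hom ≫ w₁ ◁ ((λ_ v).inv ≫ η ▷ v ≫ (α_ v v' v).hom) ≫
        (α_ w₁ v (v' ⊗ v)).inv ≫ s₂.inv ▷ (v' ⊗ v)) := by
  rw [annComp, rotDual, rot]
  simp only [Iso.trans_hom, whiskerLeftIso_hom, whiskerRightIso_hom, Iso.symm_hom]
  calc _ = 𝟙 _ ⊗≫ v' ◁ v ◁ s₂.hom ⊗≫ v' ◁ ((s₁.inv ≫ s₁.hom) ▷ v) ⊗≫ ε ▷ (w₁ ⊗ v) ⊗≫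
        (w₁ ◁ η) ▷ v ⊗≫ s₂.inv ▷ (v' ⊗ v) ⊗≫ 𝟙 _ := by monoidal
    _ = 𝟙 _ ⊗≫ ((v' ⊗ v) ◁ s₂.hom ≫ ε ▷ (w₁ ⊗ v)) ⊗≫ (w₁ ◁ η) ▷ v ⊗≫
        s₂.inv ▷ (v' ⊗ v) ⊗≫ 𝟙 _ := by rw [Iso.inv_hom_id]; monoidal
    _ = _ := by rw [whisker_exchange]; monoidal

theorem Zigzag.rotDual_rot_trace {η : 𝟙_ C ⟶ v ⊗ v'} {ε : v' ⊗ v ⟶ 𝟙_ C} (h : Zigzag η ε) :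
    ((λ_ w).hom ≫ s₂.hom ≫ w₁ ◁ ((λ_ v).inv ≫ η ▷ v ≫ (α_ v v' v).hom) ≫
      (α_ w₁ v (v' ⊗ v)).inv ≫ s₂.inv ▷ (v' ⊗ v)) ≫ w ◁ ε = (λ_ w).hom ≫ (ρ_ w).inv := by
  calc _ = 𝟙 _ ⊗≫ s₂.hom ⊗≫ w₁ ◁ (η ▷ v) ⊗≫ (s₂.inv ▷ (v' ⊗ v) ≫ w ◁ ε) := by monoidal
    _ = (λ_ w).hom ≫ s₂.hom ≫
        w₁ ◁ ((λ_ v).inv ≫ η ▷ v ≫ (α_ v v' v).hom ≫ v ◁ ε ≫ (ρ_ v).hom) ≫ s₂.inv ≫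
        (ρ_ w).inv := by rw [← whisker_exchange]; monoidal
    _ = _ := by rw [h.left]; simp

/-- In the other order `η` appears at the end; moved around to the beginning it is cancelled by `ε`
in `Zigzag.rot_rotDual_trace`. -/
theorem annComp_rot_rotDual (η : 𝟙_ C ⟶ v ⊗ v') (ε : v' ⊗ v ⟶ 𝟙_ C) :
    annComp (rot s₁ s₂).hom (rotDual s₁ s₂ η ε) =
      ((α_ v v' w).hom ≫ v ◁ (v' ◁ s₁.hom ≫ (α_ v' v w₁).inv ≫ ε ▷ w₁ ≫ (λ_ w₁).hom) ≫ s₁.inv ≫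
        (ρ_ w).inv) ≫ w ◁ η := by
  rw [annComp, rotDual, rot]
  simp only [Iso.trans_hom, whiskerLeftIso_hom, whiskerRightIso_hom, Iso.symm_hom]
  calc _ = 𝟙 _ ⊗≫ v ◁ v' ◁ s₁.hom ⊗≫ v ◁ ε ▷ w₁ ⊗≫ v ◁ w₁ ◁ η ⊗≫
        v ◁ ((s₂.inv ≫ s₂.hom) ▷ v') ⊗≫ s₁.inv ▷ (v ⊗ v') ⊗≫ 𝟙 _ := by monoidal
    _ = 𝟙 _ ⊗≫ v ◁ v' ◁ s₁.hom ⊗≫ v ◁ ε ▷ w₁ ⊗≫ ((v ⊗ w₁) ◁ η ≫ s₁.inv ▷ (v ⊗ v')) ⊗≫ 𝟙 _ := by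
      rw [Iso.inv_hom_id]; monoidal
    _ = _ := by rw [whisker_exchange]; monoidal

theorem Zigzag.rot_rotDual_trace {η : 𝟙_ C ⟶ v ⊗ v'} {ε : v' ⊗ v ⟶ 𝟙_ C} (h : Zigzag η ε) :
    η ▷ w ≫ ((α_ v v' w).hom ≫ v ◁ (v' ◁ s₁.hom ≫ (α_ v' v w₁).inv ≫ ε ▷ w₁ ≫ (λ_ w₁).hom) ≫
      s₁.inv ≫ (ρ_ w).inv) = (λ_ w).hom ≫ (ρ_ w).inv := by
  calc _ = 𝟙 _ ⊗≫ (η ▷ w ≫ (v ⊗ v') ◁ s₁.hom) ⊗≫ v ◁ ε ▷ w₁ ⊗≫ s₁.inv ⊗≫ 𝟙 _ := by monoidal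
    _ = (λ_ w).hom ≫ s₁.hom ≫
        ((λ_ v).inv ≫ η ▷ v ≫ (α_ v v' v).hom ≫ v ◁ ε ≫ (ρ_ v).hom) ▷ w₁ ≫ s₁.inv ≫
        (ρ_ w).inv := by rw [← whisker_exchange]; monoidal
    _ = _ := by rw [h.left]; simp

end Rotation

end AnnularDiagrams

/-! ### Conjugates of single letters -/

section LetterDuals

section Diagrams

variable {C : Type u₁} [Category.{v₁} C] [MonoidalCategory C]

theorem Zigzag.eq_of_coev {a a' : C} {η : 𝟙_ C ⟶ a ⊗ a'} {ε : a' ⊗ a ⟶ 𝟙_ C} (h : Zigzag η ε)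
    (f : a' ⟶ a') :
    f = (ρ_ a').inv ≫ a' ◁ (η ≫ a ◁ f) ≫ (α_ a' a a').inv ≫ ε ▷ a' ≫ (λ_ a').hom := by
  symm
  calc _ = 𝟙 _ ⊗≫ a' ◁ η ⊗≫ ((a' ⊗ a) ◁ f ≫ ε ▷ a') ⊗≫ 𝟙 _ := by monoidal
    _ = ((ρ_ a').inv ≫ a' ◁ η ≫ (α_ a' a a').inv ≫ ε ▷ a' ≫ (λ_ a').hom) ≫ f := by
      rw [whisker_exchange]; monoidal
    _ = f := by rw [h.right, Category.id_comp]

theorem Zigzag.coev_whiskerLeft {a a' : C} {η : 𝟙_ C ⟶ a ⊗ a'} {ε : a' ⊗ a ⟶ 𝟙_ C}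
    (h : Zigzag η ε) (f : a' ⟶ a') :
    η ≫ a ◁ f =
      η ≫ ((λ_ a).inv ≫ η ▷ a ≫ (α_ a a' a).hom ≫ a ◁ (f ▷ a ≫ ε) ≫ (ρ_ a).hom) ▷ a' := by
  symm
  calc _ = 𝟙 _ ⊗≫ (𝟙_ C ◁ η ≫ η ▷ (a ⊗ a')) ⊗≫ a ◁ f ▷ a ▷ a' ⊗≫ a ◁ ε ▷ a' ⊗≫ 𝟙 _ := by
        monoidal
    _ = 𝟙 _ ⊗≫ η ⊗≫ a ◁ (a' ◁ η ≫ f ▷ (a ⊗ a')) ⊗≫ a ◁ ε ▷ a' ⊗≫ 𝟙 _ := by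
      rw [whisker_exchange]; monoidal
    _ = η ≫ a ◁ (f ≫ (ρ_ a').inv ≫ a' ◁ η ≫ (α_ a' a a').inv ≫ ε ▷ a' ≫ (λ_ a').hom) := by
      rw [whisker_exchange]; monoidal
    _ = _ := by rw [h.right, Category.comp_id]

end Diagrams

section General

variable {C : Type u₁} [Category.{v₁} C] [MonoidalCategory C] [Preadditive C] [Linear ℂ C]
  [MonoidalPreadditive C] [MonoidalLinear ℂ C]

/-- An endomorphism of `a'` is recovered from its transpose on `a`, and the transpose is a scalar.
-/
theorem Zigzag.isSimpleObj {a a' : C} {η : 𝟙_ C ⟶ a ⊗ a'} {ε : a' ⊗ a ⟶ 𝟙_ C}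
    (h : Zigzag η ε) (ha : IsSimpleObj a) : IsSimpleObj a' := by
  constructor
  · intro h0
    apply ha.1
    have h1 : η = 0 := by
      have : η ≫ a ◁ (𝟙 a') = η := by rw [whiskerLeft_id, Category.comp_id]
      rw [← this, h0, MonoidalPreadditive.whiskerLeft_zero, Limits.comp_zero]
    rw [← h.left, h1]
    simp
  · intro f
    obtain ⟨z, hz⟩ := ha.2
      ((λ_ a).inv ≫ η ▷ a ≫ (α_ a a' a).hom ≫ a ◁ (f ▷ a ≫ ε) ≫ (ρ_ a).hom)
    refine ⟨z, ?_⟩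
    have h1 : η ≫ a ◁ f = z • η := by
      rw [h.coev_whiskerLeft f, hz, MonoidalLinear.smul_whiskerRight, id_whiskerRight,
        Linear.comp_smul, Category.comp_id]
    rw [h.eq_of_coev f, h1, MonoidalLinear.whiskerLeft_smul, Linear.smul_comp, Linear.comp_smul,
      h.right]

/-- The dual is again simple, and it is not the unit, for otherwise uniqueness of duals would
identify `a` with the unit. It may thus be replaced by its representative in `I`. -/
theorem IsNontrivialIrr.exists_zigzag [RigidCStarTensorCategory C] {I : Set C}
    (hI : IsNontrivialIrr I) {a : C} (ha : a ∈ I) :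
    ∃ b ∈ I, ∃ (η : 𝟙_ C ⟶ a ⊗ b) (ε : b ⊗ a ⟶ 𝟙_ C), Zigzag η ε := by
  obtain ⟨a', R, R', hR⟩ := RigidCStarTensorCategory.exists_dual a
  have h : Zigzag R' (adj R) := ⟨hR.1, hR.2⟩
  obtain ⟨p, -, -⟩ := zigzag_iff_exactPairing.1 h
  have h1 : IsEmpty (a' ≅ 𝟙_ C) := ⟨fun i => (hI.1 a ha).2.false
    (leftDualIso (exactPairingCongrRight i.symm) exactPairingUnit)⟩
  obtain ⟨b, ⟨hb, ⟨i⟩⟩, -⟩ := hI.2 a' (h.isSimpleObj (hI.1 a ha).1) h1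
  exact ⟨b, hb, _, _, zigzag_iff_exactPairing.2 ⟨exactPairingCongrRight i.symm, rfl, rfl⟩⟩

end General

variable {C : Type u₁} [Category.{v₁} C] [MonoidalCategory C] [Preadditive C] [Linear ℂ C]
  [MonoidalPreadditive C] [MonoidalLinear ℂ C] [RigidCStarTensorCategory C]
variable {D : Type u₂} [Category.{v₂} D] [MonoidalCategory D] [Preadditive D] [Linear ℂ D]
  [MonoidalPreadditive D] [MonoidalLinear ℂ D] [RigidCStarTensorCategory D]

open Word

instance : (incl (C := C) (D := D)).Full where
  map_surjective f := ⟨f, rfl⟩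

/-- The inclusion of the words into the tensor product category is monoidal. -/
instance : (incl (C := C) (D := D)).Monoidal :=
  Monoidal.fromInducedMonoidal incl
    { μIso := fun σ τ => tensorIso σ τ
      whiskerLeft_eq := fun _ _ _ _ => rfl
      whiskerRight_eq := fun _ _ => rfl
      tensorHom_eq := fun _ _ => rfl
      εIso := emptyIso
      associator_eq := fun _ _ _ => rfl
      leftUnitor_eq := fun _ => rfl
      rightUnitor_eq := fun _ => rfl }

theorem Deligne.nonempty_exactPairing {a a' : C} {b b' : D} (p : ExactPairing a a')
    (q : ExactPairing b b') : Nonempty (ExactPairing (⟨a, b⟩ : Deligne C D) ⟨a', b'⟩) := ⟨{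
  coevaluation' := tmul (X := 𝟙_ (Deligne C D)) (Y := (⟨a, b⟩ : Deligne C D) ⊗ ⟨a', b'⟩)
    p.coevaluation' q.coevaluation'
  evaluation' := tmul (X := (⟨a', b'⟩ : Deligne C D) ⊗ ⟨a, b⟩) (Y := 𝟙_ (Deligne C D))
    p.evaluation' q.evaluation'
  coevaluation_evaluation' := by
    have h := p.coevaluation_evaluation'
    have h' := q.coevaluation_evaluation'
    rw [← tensorHom_id, ← id_tensorHom] at h h'
    exact congrArg₂ tmul h h'
  evaluation_coevaluation' := by
    have h := p.evaluation_coevaluation'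
    have h' := q.evaluation_coevaluation'
    rw [← tensorHom_id, ← id_tensorHom] at h h'
    exact congrArg₂ tmul h h' }⟩

/-- The pairing in one category, tensored with the trivial pairing of the other unit, is lifted
through the fully faithful monoidal functor `incl`. The detour over `a ⊗ 𝟙_` reflects how the word
of one letter is evaluated. -/
theorem Word.exists_zigzag_letter {IC : Set C} {ID : Set D} (hIC : IsNontrivialIrr IC)
    (hID : IsNontrivialIrr ID) {x : C ⊕ D} (hx : Sum.elim (· ∈ IC) (· ∈ ID) x) :
    ∃ y : C ⊕ D, Sum.elim (· ∈ IC) (· ∈ ID) y ∧ y.isLeft = x.isLeft ∧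
      ∃ (η : 𝟙_ (Word C D) ⟶ letter x ⊗ letter y) (ε : letter y ⊗ letter x ⟶ 𝟙_ (Word C D)),
        Zigzag η ε := by
  rcases x with a | a
  · obtain ⟨b, hb, η, ε, h⟩ := hIC.exists_zigzag hx
    obtain ⟨p, -, -⟩ := zigzag_iff_exactPairing.1 h
    let p₁ : ExactPairing (a ⊗ 𝟙_ C) (b ⊗ 𝟙_ C) := exactPairingCongr (ρ_ a) (ρ_ b)
    let _ : ExactPairing (incl.obj (letter (Sum.inl a) : Word C D))
      (incl.obj (letter (Sum.inl b) : Word C D)) :=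
      (Deligne.nonempty_exactPairing p₁ exactPairingUnit).some
    exact ⟨Sum.inl b, hb, rfl, _, _, zigzag_iff_exactPairing.2
      ⟨ExactPairing.ofFullyFaithful incl _ _, rfl, rfl⟩⟩
  · obtain ⟨b, hb, η, ε, h⟩ := hID.exists_zigzag hx
    obtain ⟨p, -, -⟩ := zigzag_iff_exactPairing.1 h
    let p₁ : ExactPairing (a ⊗ 𝟙_ D) (b ⊗ 𝟙_ D) := exactPairingCongr (ρ_ a) (ρ_ b)
    let _ : ExactPairing (incl.obj (letter (Sum.inr a) : Word C D))
      (incl.obj (letter (Sum.inr b) : Word C D)) :=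
      (Deligne.nonempty_exactPairing exactPairingUnit p₁).some
    exact ⟨Sum.inr b, hb, rfl, _, _, zigzag_iff_exactPairing.2
      ⟨ExactPairing.ofFullyFaithful incl _ _, rfl, rfl⟩⟩

end LetterDuals

/-! ### Conjugates of words, their uniqueness, and the involution -/

section WordDuals

open Word

variable {C : Type u₁} [Category.{v₁} C] [MonoidalCategory C] [Preadditive C] [Linear ℂ C]
  [MonoidalPreadditive C] [MonoidalLinear ℂ C] [RigidCStarTensorCategory C]
variable {D : Type u₂} [Category.{v₂} D] [MonoidalCategory D] [Preadditive D] [Linear ℂ D]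
  [MonoidalPreadditive D] [MonoidalLinear ℂ D] [RigidCStarTensorCategory D]
variable {IC : Set C} {ID : Set D}

theorem mem_ncpHom_of_mono {c : Bool} {α β : Word C D} (hα : Mono c α) (hβ : Mono c β)
    (g : α ⟶ β) : g ∈ ncpHom α β := by
  have h := (isStr_rightUnitor α).inv.comp_mem ((isStr_rightUnitor β).mem_comp
    (whiskerRight_mem_of_mono (𝟙_ (Word C D)) hα hβ g))
  simpa using h

/-- Solutions of the duality equations for the words `σ` and `σ'` in the category of non-crossing
partitions. -/
structure Word.Duality (σ σ' : Word C D) where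
  R : 𝟙_ (Word C D) ⟶ σ' ⊗ σ
  R' : 𝟙_ (Word C D) ⟶ σ ⊗ σ'
  R_mem : R ∈ ncpHom _ _
  R'_mem : R' ∈ ncpHom _ _
  zigzag : Zigzag R' (adj R)

theorem Word.zigzag_adj {σ σ' : Word C D} {η : 𝟙_ (Word C D) ⟶ σ ⊗ σ'}
    {ε : σ' ⊗ σ ⟶ 𝟙_ (Word C D)} (h : Zigzag η ε) : Zigzag (adj ε) (adj η) := by
  constructor
  · have h1 := congrArg adj h.right
    simpa [StarCategory.adj_comp, adj_id] using h1
  · have h1 := congrArg adj h.left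
    simpa [StarCategory.adj_comp, adj_id] using h1

namespace Word.Duality

/-- The dual of the dual. -/
def symm {σ σ' : Word C D} (d : Duality σ σ') : Duality σ' σ where
  R := d.R'
  R' := d.R
  R_mem := d.R'_mem
  R'_mem := d.R_mem
  zigzag := by
    have h := zigzag_adj d.zigzag
    rwa [StarCategory.adj_adj] at h

/-- The duality of the empty word. -/
def empty : Duality (𝟙_ (Word C D)) (𝟙_ (Word C D)) where
  R := (λ_ _).inv
  R' := (λ_ _).inv
  R_mem := (isStr_leftUnitor _).inv.mem
  R'_mem := (isStr_leftUnitor _).inv.mem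
  zigzag := by
    rw [adj_leftUnitor_inv]
    exact zigzag_unit

theorem coevTensor_mem {σ σ' τ τ' : Word C D} {η : 𝟙_ (Word C D) ⟶ σ ⊗ σ'}
    {η' : 𝟙_ (Word C D) ⟶ τ ⊗ τ'} (h : η ∈ ncpHom _ _) (h' : η' ∈ ncpHom _ _) :
    coevTensor η η' ∈ ncpHom _ _ :=
  comp_mem_ncpHom h ((isStr_associator _ _ _).inv.mem_comp (whiskerLeft_mem
    ((isStr_leftUnitor _).inv.comp_mem ((isStr_associator _ _ _).mem_comp (whiskerRight_mem _ h'))) _))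

theorem evTensor_mem {σ σ' τ τ' : Word C D} {ε : σ' ⊗ σ ⟶ 𝟙_ (Word C D)}
    {ε' : τ' ⊗ τ ⟶ 𝟙_ (Word C D)} (h : ε ∈ ncpHom _ _) (h' : ε' ∈ ncpHom _ _) :
    evTensor ε ε' ∈ ncpHom _ _ :=
  (isStr_associator _ _ _).comp_mem (comp_mem_ncpHom (whiskerLeft_mem
    ((isStr_associator _ _ _).inv.comp_mem ((isStr_leftUnitor _).mem_comp (whiskerRight_mem _ h))) _)
    h')

/-- The duality of a tensor product. -/
def tensor {σ σ' τ τ' : Word C D} (d : Duality σ σ') (d' : Duality τ τ') :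
    Duality (σ ⊗ τ) (τ' ⊗ σ') where
  R := adj (evTensor (adj d.R) (adj d'.R))
  R' := coevTensor d.R' d'.R'
  R_mem := adj_mem (evTensor_mem (adj_mem d.R_mem) (adj_mem d'.R_mem))
  R'_mem := coevTensor_mem d.R'_mem d'.R'_mem
  zigzag := by
    rw [StarCategory.adj_adj]
    exact d.zigzag.tensor d'.zigzag

end Word.Duality

theorem Word.exists_duality_letter (hIC : IsNontrivialIrr IC) (hID : IsNontrivialIrr ID)
    {x : C ⊕ D} (hx : Sum.elim (· ∈ IC) (· ∈ ID) x) :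
    ∃ y : C ⊕ D, Sum.elim (· ∈ IC) (· ∈ ID) y ∧ y.isLeft = x.isLeft ∧
      Nonempty (Duality (letter x : Word C D) (letter y)) := by
  obtain ⟨y, hy, hxy, η, ε, h⟩ := exists_zigzag_letter hIC hID hx
  have hmx : Mono x.isLeft (letter x : Word C D) := mono_letter x
  have hmy : Mono x.isLeft (letter y : Word C D) := hxy ▸ mono_letter y
  have h0 : Mono x.isLeft (𝟙_ (Word C D)) := mono_empty _
  exact ⟨y, hy, hxy, ⟨adj ε, η, adj_mem (mem_ncpHom_of_mono (mono_tensor.2 ⟨hmy, hmx⟩) h0 ε),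
    mem_ncpHom_of_mono h0 (mono_tensor.2 ⟨hmx, hmy⟩) η, by rwa [StarCategory.adj_adj]⟩⟩

/-- The colours of the letters of a word. -/
def Word.colours {C : Type u₁} {D : Type u₂} (σ : Word C D) : List Bool := σ.letters.map Sum.isLeft

/-- Duals are taken letter by letter in reverse order. Only the colours are recorded, since they are
all that alternation and the later case distinctions require. -/
theorem Word.exists_duality (hIC : IsNontrivialIrr IC) (hID : IsNontrivialIrr ID) :
    ∀ σ : Word C D, LettersIn IC ID σ → ∃ σ' : Word C D, LettersIn IC ID σ' ∧
      σ'.colours = σ.colours.reverse ∧ Nonempty (Duality σ σ')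
  | [], _ => ⟨[], fun x hx => absurd hx List.not_mem_nil, rfl, ⟨Duality.empty⟩⟩
  | x :: σ, h => by
    obtain ⟨σ', h', hc, ⟨d⟩⟩ := exists_duality hIC hID σ fun y hy => h y (List.mem_cons_of_mem _ hy)
    obtain ⟨y, hy, hxy, ⟨d'⟩⟩ := exists_duality_letter hIC hID (h x List.mem_cons_self)
    refine ⟨σ' ⊗ letter y, lettersIn_tensor.2 ⟨h', fun z hz => ?_⟩, ?_, ⟨d'.tensor d⟩⟩
    · rw [List.mem_singleton.1 hz]
      exact hy
    · have h1 : (σ' ⊗ letter y : Word C D).colours = σ'.colours ++ [y.isLeft] := List.map_append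
      rw [h1, hc, hxy]
      exact List.reverse_cons.symm

theorem Word.alternating_iff {σ : Word C D} : Alternating σ ↔ σ.colours.IsChain (· ≠ ·) :=
  (List.isChain_map _).symm

theorem Word.alternating_of_colours_reverse {σ σ' : Word C D} (h : σ'.colours = σ.colours.reverse)
    (hσ : Alternating σ) : Alternating σ' := by
  rw [alternating_iff] at *
  rw [h, List.isChain_reverse]
  exact hσ.imp fun _ _ h => h.symm

theorem Deligne.tmul_ne_zero {X Y : Deligne C D} {a : X.fst ⟶ Y.fst} {b : X.snd ⟶ Y.snd}
    (ha : a ≠ 0) (hb : b ≠ 0) : (tmul a b : X ⟶ Y) ≠ 0 := by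
  intro h
  obtain ⟨t₁, h₁⟩ := RigidCStarTensorCategory.exists_trace_core X.fst
  obtain ⟨t₂, h₂⟩ := RigidCStarTensorCategory.exists_trace_core X.snd
  obtain ⟨c₁, -⟩ := h₁ Y.fst
  obtain ⟨c₂, -⟩ := h₂ Y.snd
  obtain ⟨c, hc⟩ := c₁.exists_tensor c₂
  have h0 : (a ⊗ₜ[ℂ] b) = (0 : ℂ) • (a ⊗ₜ[ℂ] b) := by
    rw [zero_smul]
    exact h
  have h3 := hc a b a b
  rw [h0, c.smul_left, map_zero, zero_mul] at h3
  rcases mul_eq_zero.1 h3.symm with h4 | h4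
  · exact ha (c₁.definite a h4)
  · exact hb (c₂.definite b h4)

theorem id_tensor_unit_ne_zero {E : Type*} [Category E] [MonoidalCategory E] [Preadditive E] {a : E}
    (h : 𝟙 a ≠ 0) : 𝟙 (a ⊗ 𝟙_ E) ≠ 0 := by
  intro h0
  apply h
  rw [← (ρ_ a).inv_hom_id, ← Category.id_comp (ρ_ a).hom, h0, Limits.zero_comp, Limits.comp_zero]

theorem Word.id_letter_ne_zero (hIC : IsNontrivialIrr IC) (hID : IsNontrivialIrr ID)
    {x : C ⊕ D} (hx : Sum.elim (· ∈ IC) (· ∈ ID) x) : 𝟙 (letter x : Word C D) ≠ 0 := by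
  rcases x with a | a
  · exact Deligne.tmul_ne_zero (X := toDeligne (letter (Sum.inl a) : Word C D))
      (Y := toDeligne (letter (Sum.inl a) : Word C D)) (id_tensor_unit_ne_zero (hIC.1 a hx).1.1)
      RigidCStarTensorCategory.simple_unit.1
  · exact Deligne.tmul_ne_zero (X := toDeligne (letter (Sum.inr a) : Word C D))
      (Y := toDeligne (letter (Sum.inr a) : Word C D)) RigidCStarTensorCategory.simple_unit.1
      (id_tensor_unit_ne_zero (hID.1 a hx).1.1)

/-- If `letter x ⊗ σ` were zero, then so would be `R ▷ σ`, hence the scalar `R* R` times `1_σ`. But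
`1_σ ≠ 0`, and a vanishing scalar would give `R = 0`, contradicting the zigzag equation for `x`. -/
theorem Word.id_letter_tensor_ne_zero (hIC : IsNontrivialIrr IC) (hID : IsNontrivialIrr ID)
    {x : C ⊕ D} (hx : Sum.elim (· ∈ IC) (· ∈ ID) x) {σ : Word C D} (hσ : 𝟙 σ ≠ 0) :
    𝟙 (letter x ⊗ σ) ≠ 0 := by
  intro h0
  obtain ⟨y, -, -, ⟨d⟩⟩ := exists_duality_letter hIC hID hx
  obtain ⟨z, hz⟩ := exists_smul_id_empty (d.R ≫ adj d.R)
  have hz' : d.R ≫ adj d.R = z • 𝟙 (𝟙_ (Word C D)) := hz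
  have h1 : d.R ▷ σ = 0 := by
    have : d.R ▷ σ = d.R ▷ σ ≫ (α_ _ _ _).hom ≫ letter y ◁ 𝟙 (letter x ⊗ σ) ≫ (α_ _ _ _).inv := by
      simp
    rw [this, h0]
    simp
  have h2 : z • 𝟙 σ = 0 := by
    have : z • 𝟙 σ = (λ_ σ).inv ≫ (d.R ▷ σ ≫ adj d.R ▷ σ) ≫ (λ_ σ).hom := by
      rw [← comp_whiskerRight, hz']
      simp
    rw [this, h1]
    simp
  rcases smul_eq_zero.1 h2 with rfl | h2
  · have hR : d.R = 0 := eq_zero_of_comp_adj (by rw [hz', zero_smul])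
    apply id_letter_ne_zero hIC hID hx
    rw [← d.zigzag.left, hR]
    simp
  · exact hσ h2

theorem Word.id_ne_zero (hIC : IsNontrivialIrr IC) (hID : IsNontrivialIrr ID) :
    ∀ σ : Word C D, LettersIn IC ID σ → 𝟙 σ ≠ 0
  | [], _ => Deligne.tmul_ne_zero (X := toDeligne (Word.empty : Word C D))
      (Y := toDeligne (Word.empty : Word C D)) RigidCStarTensorCategory.simple_unit.1
      RigidCStarTensorCategory.simple_unit.1
  | _ :: σ, h => id_letter_tensor_ne_zero hIC hID (h _ List.mem_cons_self)
      (id_ne_zero hIC hID σ fun y hy => h y (List.mem_cons_of_mem _ hy))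

/-! ### Independence of the involution from the chosen duals -/

section Uniqueness

variable {σ σ' τ' : Word C D}

theorem Word.Duality.mate_mem (d : Duality σ σ') (d' : Duality σ τ') :
    (ρ_ σ').inv ≫ σ' ◁ d'.R' ≫ (α_ σ' σ τ').inv ≫ adj d.R ▷ τ' ≫ (λ_ τ').hom ∈ ncpHom σ' τ' :=
  (isStr_rightUnitor _).inv.comp_mem (comp_mem_ncpHom (whiskerLeft_mem d'.R'_mem _)
    ((isStr_associator _ _ _).inv.comp_mem ((isStr_leftUnitor _).mem_comp
      (whiskerRight_mem _ (adj_mem d.R_mem)))))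

/-- If the conjugates differed, the comparison morphism between them would vanish by Schur's lemma;
then the second coevaluation would be zero and with it the identity of `σ`. -/
theorem Word.Duality.eq_of_alternating (hIC : IsNontrivialIrr IC) (hID : IsNontrivialIrr ID)
    (d : Duality σ σ') (d' : Duality σ τ') (hσ : LettersIn IC ID σ)
    (h1 : LettersIn IC ID σ') (h2 : LettersIn IC ID τ') (h1' : Alternating σ')
    (h2' : Alternating τ') : σ' = τ' := by
  by_contra hne
  have h0 := ncpHom_eq_zero hIC hID h1 h2 h1' h2' hne (d.mate_mem d')
  have h3 := d.zigzag.coev_eq d'.R'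
  rw [h0, MonoidalPreadditive.whiskerLeft_zero, Limits.comp_zero] at h3
  apply id_ne_zero hIC hID σ hσ
  rw [← d'.zigzag.left, ← h3]
  simp

/-- The two coevaluations differ by a scalar `z`. Both sides of the mate equation are linear in the
coevaluation, so a solution for one is a solution for the other. -/
theorem Word.Duality.annDual_eq (hIC : IsNontrivialIrr IC) (hID : IsNontrivialIrr ID)
    (d d' : Duality σ σ') (h1 : LettersIn IC ID σ') (h1' : Alternating σ') {w : Word C D}
    (f : w ⊗ σ ⟶ σ ⊗ w) : annDual d.R' (adj d.R) f = annDual d'.R' (adj d'.R) f := by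
  obtain ⟨z, hz⟩ := ncpHom_eq_smul hIC hID h1 h1' rfl (d.mate_mem d')
  have h3 := d.zigzag.coev_eq d'.R'
  rw [hz, eqToHom_refl, MonoidalLinear.whiskerLeft_smul, whiskerLeft_id, Linear.comp_smul,
    Category.comp_id] at h3
  refine d'.zigzag.eq_annDual ?_
  have h4 := d.zigzag.mate_annDual f
  rw [Mate] at *
  rw [← h3]
  simp only [MonoidalLinear.whiskerLeft_smul, MonoidalLinear.smul_whiskerRight, Linear.smul_comp,
    Linear.comp_smul]
  rw [h4]

/-- The adjoint of `Zigzag.annDual_ev` is the mate equation for the reversed duality. -/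
theorem Word.Duality.annDual_annDual (d : Duality σ σ') {w : Word C D} (f : σ ⊗ w ⟶ w ⊗ σ) :
    annDual d.symm.R' (adj d.symm.R) (adj (annDual d.R' (adj d.R) (adj f))) = f := by
  symm
  refine d.symm.zigzag.eq_annDual ?_
  have h := congrArg adj (d.zigzag.annDual_ev (adj f))
  simpa [StarCategory.adj_comp, StarCategory.adj_adj, Mate, symm] using h.symm

theorem Word.adj_annComp {w : Word C D} (f : σ ⊗ w ⟶ w ⊗ σ) (g : τ' ⊗ w ⟶ w ⊗ τ') :
    adj (annComp f g) = annOp (adj f) (adj g) := by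
  simp [annComp, annOp, StarCategory.adj_comp]

theorem Word.Duality.annDual_tensor {τ : Word C D} (d : Duality σ σ') (d' : Duality τ τ')
    {w : Word C D} (f : σ ⊗ w ⟶ w ⊗ σ) (g : τ ⊗ w ⟶ w ⊗ τ) :
    annDual (d.tensor d').R' (adj (d.tensor d').R) (adj (annComp f g)) =
      annComp (annDual d'.R' (adj d'.R) (adj g)) (annDual d.R' (adj d.R) (adj f)) := by
  symm
  refine (d.tensor d').zigzag.eq_annDual ?_
  rw [adj_annComp]
  exact (d.zigzag.mate_annDual _).tensor (d'.zigzag.mate_annDual _)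

theorem Word.Duality.annDual_mem (d : Duality σ σ') {w : Word C D} {f : σ ⊗ w ⟶ w ⊗ σ}
    (hf : f ∈ ncpHom _ _) : annDual d.R' (adj d.R) (adj f) ∈ ncpHom _ _ :=
  comp_mem_ncpHom (whiskerLeft_mem ((isStr_rightUnitor _).inv.comp_mem (comp_mem_ncpHom
    (whiskerLeft_mem d.R'_mem _) ((isStr_associator _ _ _).inv.comp_mem
      ((isStr_associator _ _ _).mem_comp (whiskerRight_mem _ (adj_mem hf)))))) _)
    ((isStr_associator _ _ _).inv.comp_mem ((isStr_leftUnitor _).mem_comp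
      (whiskerRight_mem _ (adj_mem d.R_mem))))

end Uniqueness

end WordDuals

/-! ### Morphisms up to sliding around the annulus -/

section Annulus

open Word

variable {C : Type u₁} [Category.{v₁} C] [MonoidalCategory C] [Preadditive C] [Linear ℂ C]
  [MonoidalPreadditive C] [MonoidalLinear ℂ C] [RigidCStarTensorCategory C]
variable {D : Type u₂} [Category.{v₂} D] [MonoidalCategory D] [Preadditive D] [Linear ℂ D]
  [MonoidalPreadditive D] [MonoidalLinear ℂ D] [RigidCStarTensorCategory D]
variable {IC : Set C} {ID : Set D}

theorem IsOnb.sum_eq {c τ : Word C D} {s : Finset (c ⟶ τ)} (hs : IsOnb c τ s) {f : c ⟶ τ}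
    (hf : f ∈ ncpHom c τ) : ∑ v ∈ s, (f ≫ adj v) ≫ v = f := by
  rw [← FreeProd.wordHoms_eq, ← hs.span_eq] at hf
  induction hf using Submodule.span_induction with
  | mem u hu =>
    rw [Finset.sum_eq_single_of_mem u hu fun v hv hne => ?_, hs.norm_one u hu, Category.id_comp]
    rw [hs.orthogonal u hu v hv hne.symm, Limits.zero_comp]
  | zero => simp
  | add f g _ _ hf hg =>
    simp only [Preadditive.add_comp, Finset.sum_add_distrib]
    rw [hf, hg]
  | smul z f _ hf =>
    simp only [Linear.smul_comp, ← Finset.smul_sum]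
    rw [hf]

theorem IsOnb.mem {c τ : Word C D} {s : Finset (c ⟶ τ)} (hs : IsOnb c τ s) {u : c ⟶ τ}
    (hu : u ∈ s) : u ∈ ncpHom c τ := by
  rw [← FreeProd.wordHoms_eq, ← hs.span_eq]
  exact Submodule.subset_span hu

/-- The component at `c` of the element of the annular algebra that is represented by `F`. -/
def annProj {w a : Word C D} (c : Word C D) (F : a ⊗ w ⟶ w ⊗ a) : c ⊗ w ⟶ w ⊗ c :=
  ∑ u ∈ onb c a, u ▷ w ≫ F ≫ w ◁ adj u

/-- Expanding `u ≫ θ` in the basis of `(c, b)` and `v ≫ adj θ` in the basis of `(c, a)` turns both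
sides into the same double sum. The coefficients `u θ v*` are endomorphisms of the simple `c`, hence
scalars, which may stand on either side of `F`. -/
theorem annProj_slide (hIC : IsNontrivialIrr IC) (hID : IsNontrivialIrr ID) {c : Word C D}
    (hc : LettersIn IC ID c) (hc' : Alternating c) {w a b : Word C D} {θ : a ⟶ b}
    (hθ : θ ∈ ncpHom a b) (F : b ⊗ w ⟶ w ⊗ a) :
    annProj c (θ ▷ w ≫ F) = annProj c (F ≫ w ◁ θ) := by
  have h1 := id_ne_zero hIC hID c hc
  have ha := onb_isOnb hIC hID hc hc' h1 a
  have hb := onb_isOnb hIC hID hc hc' h1 b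
  have e1 : ∀ u ∈ onb c a, u ▷ w ≫ (θ ▷ w ≫ F) ≫ w ◁ adj u =
      ∑ v ∈ onb c b, (((u ≫ θ) ≫ adj v) ≫ v) ▷ w ≫ F ≫ w ◁ adj u := by
    intro u hu
    have h2 := hb.sum_eq (comp_mem_ncpHom (ha.mem hu) hθ)
    have h3 : u ▷ w ≫ (θ ▷ w ≫ F) ≫ w ◁ adj u = (u ≫ θ) ▷ w ≫ F ≫ w ◁ adj u := by
      rw [comp_whiskerRight, Category.assoc, Category.assoc]
    rw [h3]
    conv_lhs => rw [← h2]
    have h4 : ∀ (s : Finset (c ⟶ b)) (k : (c ⟶ b) → (c ⟶ b)),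
        (∑ v ∈ s, k v) ▷ w = ∑ v ∈ s, (k v) ▷ w := fun s k => sum_whiskerRight s k w
    rw [h4, Preadditive.sum_comp]
  have e2 : ∀ v ∈ onb c b, v ▷ w ≫ (F ≫ w ◁ θ) ≫ w ◁ adj v =
      ∑ u ∈ onb c a, v ▷ w ≫ F ≫ w ◁ (adj u ≫ ((u ≫ θ) ≫ adj v)) := by
    intro v hv
    have h2 := congrArg adj (ha.sum_eq (comp_mem_ncpHom (hb.mem hv) (adj_mem hθ)))
    rw [map_sum, StarCategory.adj_comp, StarCategory.adj_adj] at h2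
    have h3 : v ▷ w ≫ (F ≫ w ◁ θ) ≫ w ◁ adj v = v ▷ w ≫ F ≫ w ◁ (θ ≫ adj v) := by
      rw [whiskerLeft_comp, Category.assoc]
    have h4 : ∀ (s : Finset (c ⟶ a)) (k : (c ⟶ a) → (a ⟶ c)),
        w ◁ (∑ v ∈ s, k v) = ∑ v ∈ s, w ◁ (k v) := fun s k => whiskerLeft_sum w s k
    rw [h3, ← h2, h4, Preadditive.comp_sum, Preadditive.comp_sum]
    refine Finset.sum_congr rfl fun u _ => ?_
    simp only [StarCategory.adj_comp, StarCategory.adj_adj, Category.assoc]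
  rw [annProj, annProj, Finset.sum_congr rfl e1, Finset.sum_congr rfl e2, Finset.sum_comm]
  refine Finset.sum_congr rfl fun v hv => Finset.sum_congr rfl fun u hu => ?_
  obtain ⟨z, hz⟩ := ncpHom_eq_smul hIC hID hc hc' rfl
    (comp_mem_ncpHom (comp_mem_ncpHom (ha.mem hu) hθ) (adj_mem (hb.mem hv)))
  rw [hz, eqToHom_refl]
  simp

theorem annProj_of_ne (hIC : IsNontrivialIrr IC) (hID : IsNontrivialIrr ID) {c a : Word C D}
    (hc : LettersIn IC ID c) (hc' : Alternating c) (ha : LettersIn IC ID a) (ha' : Alternating a)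
    (hne : c ≠ a) {w : Word C D} (F : a ⊗ w ⟶ w ⊗ a) : annProj c F = 0 := by
  refine Finset.sum_eq_zero fun u hu => ?_
  have h := (onb_isOnb hIC hID hc hc' (id_ne_zero hIC hID c hc) a).mem hu
  rw [ncpHom_eq_zero hIC hID hc ha hc' ha' hne h]
  simp

/-- Every basis vector of `(c, c)` is a scalar, so it commutes past `F`, and the sum of the `u* u`
is the identity. -/
theorem annProj_self (hIC : IsNontrivialIrr IC) (hID : IsNontrivialIrr ID) {c : Word C D}
    (hc : LettersIn IC ID c) (hc' : Alternating c) {w : Word C D} (F : c ⊗ w ⟶ w ⊗ c) :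
    annProj c F = F := by
  have hb := onb_isOnb hIC hID hc hc' (id_ne_zero hIC hID c hc) c
  have h1 : ∀ u ∈ onb c c, u ▷ w ≫ F ≫ w ◁ adj u = F ≫ w ◁ (adj u ≫ u) := by
    intro u hu
    obtain ⟨z, hz⟩ := ncpHom_eq_smul hIC hID hc hc' rfl (hb.mem hu)
    rw [hz, eqToHom_refl]
    simp [smul_comm z]
  have h2 := hb.sum_eq (id_mem_ncpHom c)
  rw [annProj, Finset.sum_congr rfl h1, ← Preadditive.comp_sum]
  have h4 : ∀ (s : Finset (c ⟶ c)) (k : (c ⟶ c) → (c ⟶ c)),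
      ∑ v ∈ s, w ◁ (k v) = w ◁ (∑ v ∈ s, k v) := fun s k => (whiskerLeft_sum w s k).symm
  simp only [Category.id_comp] at h2
  rw [h4, h2, whiskerLeft_id, Category.comp_id]

/-- A morphism `a w ⟶ w a` together with the word `a`. -/
structure AnnularMor (w : Word C D) where
  word : Word C D
  hom : word ⊗ w ⟶ w ⊗ word

namespace AnnularMor

variable {w : Word C D}

/-- Two morphisms are related if they differ by moving a morphism around the annulus. -/
inductive Slide : AnnularMor w → AnnularMor w → Prop
  | mk {a b : Word C D} (θ : a ⟶ b) (hθ : θ ∈ ncpHom a b) (F : b ⊗ w ⟶ w ⊗ a) :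
      Slide ⟨a, θ ▷ w ≫ F⟩ ⟨b, F ≫ w ◁ θ⟩

theorem Slide.of_eq {a b : Word C D} {θ : a ⟶ b} (hθ : θ ∈ ncpHom a b) {F : b ⊗ w ⟶ w ⊗ a}
    {f : a ⊗ w ⟶ w ⊗ a} {g : b ⊗ w ⟶ w ⊗ b} (hf : f = θ ▷ w ≫ F) (hg : g = F ≫ w ◁ θ) :
    Slide ⟨a, f⟩ ⟨b, g⟩ := by
  rw [hf, hg]
  exact .mk θ hθ F

/-- Composition on the tensor product of the words. -/
def comp (x y : AnnularMor w) : AnnularMor w := ⟨x.word ⊗ y.word, annComp x.hom y.hom⟩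

/-- The identity of `w`. -/
def unit (w : Word C D) : AnnularMor w := ⟨𝟙_ (Word C D), (λ_ w).hom ≫ (ρ_ w).inv⟩

theorem Slide.comp_left {x y : AnnularMor w} (h : Slide x y) (z : AnnularMor w) :
    Slide (x.comp z) (y.comp z) := by
  obtain ⟨θ, hθ, F⟩ := h
  exact .of_eq (whiskerRight_mem _ hθ) (annComp_whiskerRight_left θ F z.hom)
    (annComp_whiskerLeft_left θ F z.hom)

theorem Slide.comp_right {x y : AnnularMor w} (h : Slide x y) (z : AnnularMor w) :
    Slide (z.comp x) (z.comp y) := by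
  obtain ⟨θ, hθ, F⟩ := h
  exact .of_eq (whiskerLeft_mem hθ _) (annComp_whiskerRight_right θ F z.hom)
    (annComp_whiskerLeft_right θ F z.hom)

theorem slide_assoc (x y z : AnnularMor w) : Slide ((x.comp y).comp z) (x.comp (y.comp z)) := by
  refine .of_eq (isStr_associator _ _ _).mem (annComp_assoc x.hom y.hom z.hom) ?_
  rw [Category.assoc, ← whiskerLeft_comp, Iso.inv_hom_id, whiskerLeft_id, Category.comp_id]
  rfl

theorem slide_unit_comp (x : AnnularMor w) : Slide ((unit w).comp x) x := by
  refine .of_eq (isStr_leftUnitor _).mem (unit_annComp x.hom) ?_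
  rw [Category.assoc, ← whiskerLeft_comp, Iso.inv_hom_id, whiskerLeft_id, Category.comp_id]

theorem slide_comp_unit (x : AnnularMor w) : Slide (x.comp (unit w)) x := by
  refine .of_eq (isStr_rightUnitor _).mem (annComp_unit x.hom) ?_
  rw [Category.assoc, ← whiskerLeft_comp, Iso.inv_hom_id, whiskerLeft_id, Category.comp_id]

variable (w) in
/-- The morphisms `a w ⟶ w a` up to moving morphisms around the annulus. -/
def Classes : Type _ := Quot (Slide (w := w))

/-- The class of a morphism. -/
def toClass (x : AnnularMor w) : Classes w := Quot.mk _ x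

/-- Since arbitrary words are admitted, products need no decomposition into simple objects, and
associativity is a slide by an associator. The components are extracted only at the end, by
`annProj`. -/
instance : Monoid (Classes w) where
  mul := Quot.map₂ comp (fun z _ _ h => h.comp_right z) (fun _ _ z h => h.comp_left z)
  one := toClass (unit w)
  mul_assoc := by
    rintro ⟨x⟩ ⟨y⟩ ⟨z⟩
    exact Quot.sound (slide_assoc x y z)
  one_mul := by
    rintro ⟨x⟩
    exact Quot.sound (slide_unit_comp x)
  mul_one := by
    rintro ⟨x⟩
    exact Quot.sound (slide_comp_unit x)

theorem toClass_comp (x y : AnnularMor w) : toClass (x.comp y) = toClass x * toClass y := rfl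

theorem annProj_eq_of_toClass_eq (hIC : IsNontrivialIrr IC) (hID : IsNontrivialIrr ID)
    {c : Word C D} (hc : LettersIn IC ID c) (hc' : Alternating c) {x y : AnnularMor w}
    (h : toClass x = toClass y) : annProj c x.hom = annProj c y.hom := by
  let P : Classes w → (c ⊗ w ⟶ w ⊗ c) := Quot.lift (fun x => annProj c x.hom) (by
    rintro _ _ ⟨θ, hθ, F⟩
    exact annProj_slide hIC hID hc hc' hθ F)
  exact congrArg P h

/-- The powers of a morphism. -/
def pow (x : AnnularMor w) : ℕ → AnnularMor w
  | 0 => unit w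
  | n + 1 => (pow x n).comp x

/-- The powers of a morphism, with the opposite bracketing. -/
def pow' (x : AnnularMor w) : ℕ → AnnularMor w
  | 0 => unit w
  | n + 1 => x.comp (pow' x n)

theorem toClass_pow (x : AnnularMor w) (n : ℕ) : toClass (x.pow n) = toClass x ^ n := by
  induction n with
  | zero => rw [pow_zero]; rfl
  | succ n ih => rw [pow, toClass_comp, ih, pow_succ]

theorem toClass_pow' (x : AnnularMor w) (n : ℕ) : toClass (x.pow' n) = toClass x ^ n := by
  induction n with
  | zero => rw [pow_zero]; rfl
  | succ n ih => rw [pow', toClass_comp, ih, pow_succ']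

/-- The powers of `x`, where `y` plays the role of the inverse. -/
def zpow (x y : AnnularMor w) : ℤ → AnnularMor w
  | .ofNat n => x.pow n
  | .negSucc n => y.pow' (n + 1)

theorem toClass_zpow {x y : AnnularMor w} (u : (Classes w)ˣ) (hx : toClass x = u)
    (hy : toClass y = ↑u⁻¹) (n : ℤ) : toClass (zpow x y n) = ↑(u ^ n) := by
  cases n with
  | ofNat n => simp [zpow, toClass_pow, hx]
  | negSucc n => rw [zpow, toClass_pow', hy, zpow_negSucc, ← inv_pow, Units.val_pow_eq_pow_val]

/-- `y` is the image of `x` under the involution. -/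
def IsDual (x y : AnnularMor w) : Prop :=
  ∃ d : Duality x.word y.word, y.hom = annDual d.R' (adj d.R) (adj x.hom)

theorem IsDual.symm {x y : AnnularMor w} (h : IsDual x y) : IsDual y x := by
  obtain ⟨d, hd⟩ := h
  refine ⟨d.symm, ?_⟩
  rw [hd, d.annDual_annDual]

theorem IsDual.comp {x x' y y' : AnnularMor w} (h : IsDual x x') (h' : IsDual y y') :
    IsDual (x.comp y) (y'.comp x') := by
  obtain ⟨d, hd⟩ := h
  obtain ⟨d', hd'⟩ := h'
  refine ⟨d.tensor d', ?_⟩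
  have h := d.annDual_tensor d' x.hom y.hom
  rw [← hd, ← hd'] at h
  exact h.symm

theorem isDual_unit : IsDual (unit w) (unit w) := by
  refine ⟨Duality.empty, ?_⟩
  refine Duality.empty.zigzag.eq_annDual ?_
  have h : adj ((λ_ w).hom ≫ (ρ_ w).inv) = (ρ_ w).hom ≫ (λ_ w).inv := by
    rw [StarCategory.adj_comp, adj_rightUnitor_inv, adj_leftUnitor_hom]
  change Mate (λ_ (𝟙_ (Word C D))).inv (adj ((λ_ w).hom ≫ (ρ_ w).inv)) _
  rw [h]
  exact mate_unit

/-- The involution reverses products, which is why the powers of `y` carry the opposite bracketing.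
-/
theorem IsDual.pow {x y : AnnularMor w} (h : IsDual x y) (n : ℕ) : IsDual (x.pow n) (y.pow' n) := by
  induction n with
  | zero => exact isDual_unit
  | succ n ih => exact ih.comp h

theorem IsDual.zpow {x y : AnnularMor w} (h : IsDual x y) : ∀ n : ℤ,
    IsDual (x.zpow y n) (x.zpow y (-n))
  | .ofNat 0 => isDual_unit
  | .ofNat (n + 1) => h.pow (n + 1)
  | .negSucc n => (h.pow (n + 1)).symm

variable {v v' w₁ : Word C D} (s₁ : w ≅ v ⊗ w₁) (s₂ : w ≅ w₁ ⊗ v) (d : Duality v v')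

/-- The rotation of `w = v w₁ = w₁ v` by `v`. -/
def rotation : AnnularMor w := ⟨v, (rot s₁ s₂).hom⟩

/-- The rotation of `w = v w₁ = w₁ v` by the dual of `v`. -/
def rotationInv : AnnularMor w := ⟨v', rotDual s₁ s₂ d.R' (adj d.R)⟩

theorem rotationInv_mul_rotation :
    toClass (rotationInv s₁ s₂ d) * toClass (rotation s₁ s₂) = 1 :=
  Quot.sound (.of_eq (adj_mem d.R_mem) (annComp_rotDual_rot s₁ s₂ d.R' (adj d.R))
    (d.zigzag.rotDual_rot_trace s₂).symm)

theorem rotation_mul_rotationInv :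
    toClass (rotation s₁ s₂) * toClass (rotationInv s₁ s₂ d) = 1 :=
  (Quot.sound (.of_eq d.R'_mem (d.zigzag.rot_rotDual_trace s₁).symm
    (annComp_rot_rotDual s₁ s₂ d.R' (adj d.R)))).symm

/-- The rotation is structural, hence unitary, and rotating its inverse by the duality gives
`rotDual`. -/
theorem isDual_rotation (h₁ : IsStr s₁.hom) (h₂ : IsStr s₂.hom) :
    IsDual (rotation s₁ s₂) (rotationInv s₁ s₂ d) := by
  refine ⟨d, ?_⟩
  have h : adj (rot s₁ s₂).hom = (rot s₁ s₂).inv :=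
    IsStr.adj_hom ((h₂.whiskerLeft _).comp
      ((isStr_associator _ _ _).inv.comp (h₁.inv.whiskerRight _)))
  change rotDual s₁ s₂ d.R' (adj d.R) = annDual d.R' (adj d.R) (adj (rot s₁ s₂).hom)
  rw [h, annDual_rot_inv]

end AnnularMor

end Annulus

/-! ### Words commuting with a given word -/

section ListPowers

variable {α : Type*}

theorem List.append_flatten_replicate_comm {a w : List α} (h : a ++ w = w ++ a) (n : ℕ) :
    a ++ (List.replicate n w).flatten = (List.replicate n w).flatten ++ a := by
  induction n with
  | zero => simp
  | succ n ih =>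
    rw [List.replicate_succ, List.flatten_cons, ← List.append_assoc, h, List.append_assoc, ih,
      List.append_assoc]

theorem List.length_flatten_replicate (n : ℕ) (w : List α) :
    (List.replicate n w).flatten.length = n * w.length := by
  simp

/-- From `a wⁿ = wⁿ a` both `a` and `wⁿ` are prefixes of one word, and `wⁿ` is the longer one. -/
theorem List.prefix_flatten_replicate {a w : List α} (hw : w ≠ []) (h : a ++ w = w ++ a) {n : ℕ}
    (hn : a.length ≤ n) : a <+: (List.replicate n w).flatten := by
  have h1 : a <+: (List.replicate n w).flatten ++ a :=
    ⟨_, List.append_flatten_replicate_comm h n⟩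
  refine List.prefix_of_prefix_length_le h1 (List.prefix_append _ _) ?_
  rw [List.length_flatten_replicate]
  exact hn.trans (Nat.le_mul_of_pos_right n (List.length_pos_iff.2 hw))

theorem List.flatten_replicate_succ' (n : ℕ) (v : List α) :
    (List.replicate (n + 1) v).flatten = (List.replicate n v).flatten ++ v := by
  simp [List.replicate_succ']

/-- The words that commute with a nonempty word `w` are the powers of a single word. -/
theorem List.exists_root_of_commuting {w : List α} (hw : w ≠ []) :
    ∃ v : List α, v ≠ [] ∧ v ++ w = w ++ v ∧
      ∀ a : List α, a ++ w = w ++ a → ∃ n, a = (List.replicate n v).flatten := by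
  have hex : ∃ l, ∃ v : List α, v ≠ [] ∧ v ++ w = w ++ v ∧ v.length = l := ⟨_, w, hw, rfl, rfl⟩
  classical
  -- The root `v` is a shortest nonempty word commuting with `w`.
  obtain ⟨v, hv, hvw, hl⟩ := Nat.find_spec hex
  refine ⟨v, hv, hvw, fun a => ?_⟩
  induction hn : a.length using Nat.strong_induction_on generalizing a with
  | _ n ih =>
    intro ha
    by_cases h0 : a = []
    · exact ⟨0, by simp [h0]⟩
    have hle : v.length ≤ a.length := by
      rw [hl]
      exact Nat.find_min' hex ⟨a, h0, ha, rfl⟩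
    -- Both `v` and `a` are prefixes of a high power of `w`, so the shorter `v` is a prefix of `a`.
    -- The remainder again commutes with `w`, and the induction applies to it.
    obtain ⟨a', rfl⟩ := List.prefix_of_prefix_length_le
      (List.prefix_flatten_replicate hw hvw hle) (List.prefix_flatten_replicate hw ha le_rfl) hle
    have ha' : a' ++ w = w ++ a' := by
      apply List.append_cancel_left (as := v)
      rw [← List.append_assoc, ha, ← List.append_assoc, ← List.append_assoc, hvw]
    obtain ⟨m, hm⟩ := ih a'.length (by
      rw [← hn, List.length_append]
      have := List.length_pos_iff.2 hv
      omega) a' rfl ha'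
    exact ⟨m + 1, by rw [List.replicate_succ, List.flatten_cons, ← hm]⟩

end ListPowers

/-! ### Alternating colour patterns -/

section Colours

/-- An alternating list of colours that is empty or starts with `b` and ends with `!b`. -/
structure AltFrom (b : Bool) (l : List Bool) : Prop where
  chain : l.IsChain (· ≠ ·)
  head : ∀ x ∈ l.head?, x = b
  last : ∀ x ∈ l.getLast?, x = !b

theorem AltFrom.nil (b : Bool) : AltFrom b [] := ⟨List.isChain_nil, by simp, by simp⟩

theorem AltFrom.append {b : Bool} {l l' : List Bool} (h : AltFrom b l) (h' : AltFrom b l') :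
    AltFrom b (l ++ l') := by
  refine ⟨List.isChain_append.2 ⟨h.chain, h'.chain, fun x hx y hy => ?_⟩, ?_, ?_⟩
  · rw [h.last x hx, h'.head y hy]
    simp
  · intro x hx
    rw [List.head?_append] at hx
    cases hl : l.head? with
    | none => exact h'.head x (by simpa [hl] using hx)
    | some y => exact h.head x (by simpa [hl] using hx)
  · intro x hx
    rw [List.getLast?_append] at hx
    cases hl : l'.getLast? with
    | none => exact h.last x (by simpa [hl] using hx)
    | some y => exact h'.last x (by simpa [hl] using hx)

theorem AltFrom.reverse {b : Bool} {l : List Bool} (h : AltFrom b l) : AltFrom (!b) l.reverse := by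
  refine ⟨List.isChain_reverse.2 (h.chain.imp fun _ _ h => h.symm), ?_, ?_⟩
  · intro x hx
    exact h.last x (by simpa using hx)
  · intro x hx
    rw [Bool.not_not]
    exact h.head x (by simpa using hx)

theorem AltFrom.of_even {b : Bool} : ∀ {l : List Bool}, l.IsChain (· ≠ ·) → Even l.length →
    (∀ x ∈ l.head?, x = b) → AltFrom b l
  | [], _, _, _ => .nil b
  | [_], _, h, _ => by simp at h
  | x :: y :: l, hl, he, hx => by
    obtain ⟨h1, h2⟩ := List.isChain_cons_cons.1 hl
    have hxb : x = b := hx x (by simp)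
    have hyb : y = !b := by
      rw [← hxb]
      cases x <;> cases y <;> simp_all
    have he' : Even l.length := by
      simp only [List.length_cons] at he
      rw [Nat.even_add_one, Nat.not_even_iff_odd, Nat.odd_add_one, Nat.not_odd_iff_even] at he
      exact he
    have hl' : AltFrom b l := by
      refine of_even h2.tail he' fun z hz => ?_
      cases l with
      | nil => simp at hz
      | cons t l =>
        have h3 := (List.isChain_cons_cons.1 h2).1
        obtain rfl : t = z := by simpa using hz
        rw [hyb] at h3
        cases t <;> cases b <;> simp_all
    have h4 : AltFrom b [x, y] := ⟨by simpa using h1, by simp [hxb], by simp [hyb]⟩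
    exact h4.append hl'

/-- As `l` is both an initial and a final segment of `m`, it inherits the first and the last colour.
-/
theorem AltFrom.of_append {b : Bool} {l l' m : List Bool} (h : AltFrom b m) (hm : m = l ++ l')
    (hm' : m = l' ++ l) : AltFrom b l := by
  refine ⟨?_, ?_, ?_⟩
  · have h1 := h.chain
    rw [hm] at h1
    exact (List.isChain_append.1 h1).1
  · intro x hx
    apply h.head x
    rw [hm, List.head?_append, Option.mem_def.1 hx]
    simp
  · intro x hx
    apply h.last x
    rw [hm', List.getLast?_append, Option.mem_def.1 hx]
    simp

theorem AltFrom.flatten_replicate {b : Bool} {l : List Bool} (h : AltFrom b l) (n : ℕ) :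
    AltFrom b (List.replicate n l).flatten := by
  induction n with
  | zero => exact .nil b
  | succ n ih =>
    rw [List.replicate_succ, List.flatten_cons]
    exact h.append ih

theorem AltFrom.eq_nil {b : Bool} {l : List Bool} (h : AltFrom b l) (h' : AltFrom (!b) l) :
    l = [] := by
  cases l with
  | nil => rfl
  | cons x l =>
    have h1 := h.head x (by simp)
    have h2 := h'.head x (by simp)
    rw [h1] at h2
    simp at h2

end Colours

/-! ### Letters and colours of powers -/

section Powers

open Word

variable {C : Type u₁} [Category.{v₁} C] [MonoidalCategory C] [Preadditive C] [Linear ℂ C]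
  [MonoidalPreadditive C] [MonoidalLinear ℂ C] [RigidCStarTensorCategory C]
variable {D : Type u₂} [Category.{v₂} D] [MonoidalCategory D] [Preadditive D] [Linear ℂ D]
  [MonoidalPreadditive D] [MonoidalLinear ℂ D] [RigidCStarTensorCategory D]
variable {IC : Set C} {ID : Set D}

theorem Word.colours_tensor (σ τ : Word C D) : (σ ⊗ τ).colours = σ.colours ++ τ.colours :=
  List.map_append

theorem IsStr.annComp {w a b : Word C D} {f : a ⊗ w ⟶ w ⊗ a} {g : b ⊗ w ⟶ w ⊗ b} (hf : IsStr f)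
    (hg : IsStr g) : IsStr (annComp f g) :=
  (isStr_associator _ _ _).comp ((hg.whiskerLeft _).comp ((isStr_associator _ _ _).inv.comp
    ((hf.whiskerRight _).comp (isStr_associator _ _ _))))

namespace AnnularMor

variable {w : Word C D}

theorem isStr_unit : IsStr (unit w).hom :=
  (isStr_leftUnitor w).comp (isStr_rightUnitor w).inv

theorem isStr_pow {x : AnnularMor w} (h : IsStr x.hom) (n : ℕ) : IsStr (x.pow n).hom := by
  induction n with
  | zero => exact isStr_unit
  | succ n ih => exact ih.annComp h

theorem letters_pow (x : AnnularMor w) (n : ℕ) :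
    (x.pow n).word.letters = (List.replicate n x.word.letters).flatten := by
  induction n with
  | zero => rfl
  | succ n ih =>
    rw [List.flatten_replicate_succ', ← ih]
    rfl

theorem letters_pow' (x : AnnularMor w) (n : ℕ) :
    (x.pow' n).word.letters = (List.replicate n x.word.letters).flatten := by
  induction n with
  | zero => rfl
  | succ n ih =>
    rw [List.replicate_succ, List.flatten_cons, ← ih]
    rfl

theorem colours_of_letters_eq {σ τ : Word C D} {n : ℕ}
    (h : σ.letters = (List.replicate n τ.letters).flatten) :
    σ.colours = (List.replicate n τ.colours).flatten := by
  rw [colours, h, List.map_flatten, List.map_replicate]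
  rfl

theorem lettersIn_of_letters_eq {σ τ : Word C D} {n : ℕ}
    (h : σ.letters = (List.replicate n τ.letters).flatten) (hτ : LettersIn IC ID τ) :
    LettersIn IC ID σ := by
  intro x hx
  rw [h] at hx
  obtain ⟨l, hl, hx⟩ := List.mem_flatten.1 hx
  rw [List.eq_of_mem_replicate hl] at hx
  exact hτ x hx

end AnnularMor

end Powers

/-! ### All morphisms from `aw` to `wa` for a simple object `a` -/

section Classification

open Word

variable {C : Type u₁} [Category.{v₁} C] [MonoidalCategory C] [Preadditive C] [Linear ℂ C]
  [MonoidalPreadditive C] [MonoidalLinear ℂ C] [RigidCStarTensorCategory C]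
variable {D : Type u₂} [Category.{v₂} D] [MonoidalCategory D] [Preadditive D] [Linear ℂ D]
  [MonoidalPreadditive D] [MonoidalLinear ℂ D] [RigidCStarTensorCategory D]
variable {IC : Set C} {ID : Set D}

theorem IsStr.ne_zero {σ τ : Word C D} {f : σ ⟶ τ} (h : IsStr f) (h1 : 𝟙 σ ≠ 0) : f ≠ 0 := by
  obtain ⟨rfl, rfl⟩ := h
  exact h1

namespace AnnularMor

variable {w : Word C D}

/-- A scalar multiple. -/
def smul (z : ℂ) (x : AnnularMor w) : AnnularMor w := ⟨x.word, z • x.hom⟩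

theorem IsDual.smul {x y : AnnularMor w} (h : IsDual x y) (z : ℂ) :
    IsDual (x.smul z) (y.smul (starRingEnd ℂ z)) := by
  obtain ⟨d, hd⟩ := h
  refine ⟨d, ?_⟩
  change (starRingEnd ℂ z) • y.hom = annDual d.R' (adj d.R) (adj (z • x.hom))
  rw [hd, map_smulₛₗ, annDual, annDual]
  simp

/-- Uniqueness of the conjugate word together with independence of the duality. -/
theorem IsDual.eq (hIC : IsNontrivialIrr IC) (hID : IsNontrivialIrr ID) {x y y' : AnnularMor w}
    (h : IsDual x y) (h' : IsDual x y') (hx : LettersIn IC ID x.word) (hy : LettersIn IC ID y.word)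
    (hy' : LettersIn IC ID y'.word) (ha : Alternating y.word) (ha' : Alternating y'.word) :
    y = y' := by
  obtain ⟨d, hd⟩ := h
  obtain ⟨d', hd'⟩ := h'
  obtain ⟨b, f⟩ := y
  obtain ⟨b', f'⟩ := y'
  obtain rfl : b = b' := d.eq_of_alternating hIC hID d' hx hy hy' ha ha'
  congr 1
  exact hd.trans ((d.annDual_eq hIC hID d' hy ha _).trans hd'.symm)

theorem IsDual.hom_mem {x y : AnnularMor w} (h : IsDual x y) (hx : x.hom ∈ ncpHom _ _) :
    y.hom ∈ ncpHom _ _ := by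
  obtain ⟨d, hd⟩ := h
  rw [hd]
  exact d.annDual_mem hx

theorem IsDual.hom_eq_zero {x y : AnnularMor w} (h : IsDual x y) (hx : x.hom = 0) : y.hom = 0 := by
  obtain ⟨d, hd⟩ := h
  rw [hd, hx, map_zero, annDual]
  simp

theorem ext_of_isStr {a b : Word C D} {f : a ⊗ w ⟶ w ⊗ a}
    {g : b ⊗ w ⟶ w ⊗ b} (h : a = b) (hf : IsStr f) (hg : IsStr g) :
    (⟨a, f⟩ : AnnularMor w) = ⟨b, g⟩ := by
  subst h
  rw [hf.eq hg]

end AnnularMor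

/-- The primitive period `v` of an alternating word `w`, together with a dual of `v`. -/
structure RotationData (IC : Set C) (ID : Set D) (w : Word C D) where
  v : Word C D
  v' : Word C D
  w₁ : Word C D
  s₁ : w ≅ v ⊗ w₁
  s₂ : w ≅ w₁ ⊗ v
  isStr₁ : IsStr s₁.hom
  isStr₂ : IsStr s₂.hom
  dual : Duality v v'
  lettersIn : LettersIn IC ID v
  lettersIn' : LettersIn IC ID v'
  lettersIn_w : LettersIn IC ID w
  alt : AltFrom true v.colours
  alt' : AltFrom false v'.colours
  alt_w : AltFrom true w.colours
  ne_empty : v ≠ empty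
  exists_pow : ∀ a : Word C D, a ⊗ w = w ⊗ a → ∃ n, a.letters = (List.replicate n v.letters).flatten

namespace RotationData

open AnnularMor

variable {w : Word C D} (P : RotationData IC ID w)

/-- The rotation by the `n`th power of `v`. -/
def mor (n : ℤ) : AnnularMor w :=
  (rotation P.s₁ P.s₂).zpow (rotationInv P.s₁ P.s₂ P.dual) n

theorem isDual_mor (n : ℤ) : IsDual (P.mor n) (P.mor (-n)) :=
  (isDual_rotation P.s₁ P.s₂ P.dual P.isStr₁ P.isStr₂).zpow n

/-- The class of the rotation. -/
def classUnit : (Classes w)ˣ where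
  val := toClass (rotation P.s₁ P.s₂)
  inv := toClass (rotationInv P.s₁ P.s₂ P.dual)
  val_inv := rotation_mul_rotationInv P.s₁ P.s₂ P.dual
  inv_val := rotationInv_mul_rotation P.s₁ P.s₂ P.dual

theorem toClass_mor (n : ℤ) : toClass (P.mor n) = ↑(P.classUnit ^ n) :=
  toClass_zpow P.classUnit rfl rfl n

theorem toClass_mor_comp (m n : ℤ) :
    toClass ((P.mor m).comp (P.mor n)) = toClass (P.mor (m + n)) := by
  rw [toClass_comp, toClass_mor, toClass_mor, toClass_mor, zpow_add, Units.val_mul]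

theorem letters_mor_natCast (n : ℕ) :
    (P.mor n).word.letters = (List.replicate n P.v.letters).flatten :=
  letters_pow (rotation P.s₁ P.s₂) n

theorem letters_mor_negSucc (n : ℕ) :
    (P.mor (Int.negSucc n)).word.letters = (List.replicate (n + 1) P.v'.letters).flatten :=
  letters_pow' (rotationInv P.s₁ P.s₂ P.dual) (n + 1)

theorem altFrom_mor_natCast (n : ℕ) : AltFrom true (P.mor n).word.colours := by
  rw [colours_of_letters_eq (P.letters_mor_natCast n)]
  exact P.alt.flatten_replicate n

theorem altFrom_mor_negSucc (n : ℕ) : AltFrom false (P.mor (Int.negSucc n)).word.colours := by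
  rw [colours_of_letters_eq (P.letters_mor_negSucc n)]
  exact P.alt'.flatten_replicate (n + 1)

theorem lettersIn_mor : ∀ n : ℤ, LettersIn IC ID (P.mor n).word
  | .ofNat n => lettersIn_of_letters_eq (P.letters_mor_natCast n) P.lettersIn
  | .negSucc n => lettersIn_of_letters_eq (P.letters_mor_negSucc n) P.lettersIn'

theorem alternating_mor : ∀ n : ℤ, Alternating (P.mor n).word
  | .ofNat n => alternating_iff.2 (P.altFrom_mor_natCast n).chain
  | .negSucc n => alternating_iff.2 (P.altFrom_mor_negSucc n).chain

theorem isStr_mor_natCast (n : ℕ) : IsStr (P.mor n).hom :=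
  isStr_pow (x := rotation P.s₁ P.s₂) ((P.isStr₂.whiskerLeft _).comp
    ((isStr_associator _ _ _).inv.comp (P.isStr₁.inv.whiskerRight _))) n

/-- Negative powers are not structural; their membership is obtained by the involution from the
positive ones. -/
theorem mor_hom_mem : ∀ n : ℤ, (P.mor n).hom ∈ ncpHom _ _
  | .ofNat n => (P.isStr_mor_natCast n).mem
  | .negSucc n => (P.isDual_mor (n + 1 : ℕ)).hom_mem (P.isStr_mor_natCast (n + 1)).mem

theorem mor_natCast_ne_zero (hIC : IsNontrivialIrr IC) (hID : IsNontrivialIrr ID) (n : ℕ) :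
    (P.mor n).hom ≠ 0 :=
  (P.isStr_mor_natCast n).ne_zero (id_ne_zero hIC hID _
    (lettersIn_tensor.2 ⟨P.lettersIn_mor n, P.lettersIn_w⟩))

theorem mor_hom_ne_zero (hIC : IsNontrivialIrr IC) (hID : IsNontrivialIrr ID) :
    ∀ n : ℤ, (P.mor n).hom ≠ 0
  | .ofNat n => P.mor_natCast_ne_zero hIC hID n
  | .negSucc n => fun h => P.mor_natCast_ne_zero hIC hID (n + 1)
      ((P.isDual_mor (Int.negSucc n)).hom_eq_zero h)

theorem v_length_pos : 0 < P.v.letters.length := List.length_pos_iff.2 P.ne_empty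

theorem v'_length_pos (hIC : IsNontrivialIrr IC) (hID : IsNontrivialIrr ID) :
    0 < P.v'.letters.length := by
  refine List.length_pos_iff.2 fun h => P.ne_empty ?_
  have h' : P.v' = 𝟙_ (Word C D) := h
  have h1 : LettersIn IC ID (𝟙_ (Word C D)) := fun x hx => absurd hx List.not_mem_nil
  have h2 : Alternating (𝟙_ (Word C D)) := List.isChain_nil
  have d := P.dual
  rw [h'] at d
  exact d.symm.eq_of_alternating hIC hID Duality.empty h1 P.lettersIn h1
    (alternating_iff.2 P.alt.chain) h2

/-- Powers of the same sign are told apart by their length. Nonnegative powers are empty or start in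
`C`, and negative ones are nonempty and start in `D`. -/
theorem mor_word_injective (hIC : IsNontrivialIrr IC) (hID : IsNontrivialIrr ID) {m n : ℤ}
    (h : (P.mor m).word = (P.mor n).word) : m = n := by
  have hv := P.v_length_pos
  have hv' := P.v'_length_pos hIC hID
  have mixed : ∀ i j : ℕ, (P.mor i).word ≠ (P.mor (Int.negSucc j)).word := by
    intro i j h
    have h1 := P.altFrom_mor_natCast i
    rw [h] at h1
    have h2 := (P.altFrom_mor_negSucc j).eq_nil h1
    have h3 := congrArg List.length (P.letters_mor_negSucc j)
    rw [colours, List.map_eq_nil_iff] at h2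
    rw [h2, List.length_flatten_replicate, List.length_nil] at h3
    exact absurd h3.symm (Nat.mul_pos j.succ_pos hv').ne'
  cases m with
  | ofNat i =>
    cases n with
    | ofNat j =>
      have h1 := congrArg (fun σ => List.length (letters σ)) h
      change (P.mor i).word.letters.length = (P.mor j).word.letters.length at h1
      rw [letters_mor_natCast, letters_mor_natCast, List.length_flatten_replicate,
        List.length_flatten_replicate] at h1
      rw [Nat.eq_of_mul_eq_mul_right hv h1]
    | negSucc j => exact absurd h (mixed i j)
  | negSucc i =>
    cases n with
    | ofNat j => exact absurd h.symm (mixed j i)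
    | negSucc j =>
      have h1 := congrArg (fun σ => List.length (letters σ)) h
      change (P.mor (Int.negSucc i)).word.letters.length =
        (P.mor (Int.negSucc j)).word.letters.length at h1
      rw [letters_mor_negSucc, letters_mor_negSucc, List.length_flatten_replicate,
        List.length_flatten_replicate] at h1
      have h2 := Nat.eq_of_mul_eq_mul_right hv' h1
      rw [Nat.succ_injective h2]

/-- The case of words `a` that do not start with a letter of `D`. -/
theorem classification_of_head (hIC : IsNontrivialIrr IC) (hID : IsNontrivialIrr ID)
    {x : AnnularMor w} (hx : LettersIn IC ID x.word) (hx' : Alternating x.word)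
    (hh : ∀ c ∈ x.word.colours.head?, c = true) (hf : x.hom ∈ ncpHom _ _) (h0 : x.hom ≠ 0) :
    ∃ (n : ℤ) (z : ℂ), x = (P.mor n).smul z := by
  obtain ⟨a, f⟩ := x
  -- `w` ends in `D` and `a` does not start in `D`.
  have h1 : Alternating (w ⊗ a) := by
    rw [alternating_iff, colours_tensor]
    refine List.isChain_append.2 ⟨P.alt_w.chain, alternating_iff.1 hx', fun x hx y hy => ?_⟩
    rw [P.alt_w.last x hx, hh y hy]
    simp
  have h2 : a ⊗ w = w ⊗ a := by
    by_contra hne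
    refine h0 (ncpHom_eq_zero_of_ne hIC hID (lettersIn_tensor.2 ⟨hx, P.lettersIn_w⟩)
      (lettersIn_tensor.2 ⟨P.lettersIn_w, hx⟩) h1 ?_ hne hf)
    rw [len_tensor, len_tensor, add_comm]
  obtain ⟨n, hn⟩ := P.exists_pow a h2
  have h3 : a = (P.mor n).word := hn.trans (P.letters_mor_natCast n).symm
  obtain ⟨z, hz⟩ := ncpHom_eq_smul hIC hID (lettersIn_tensor.2 ⟨hx, P.lettersIn_w⟩)
    (h2 ▸ h1) h2 hf
  refine ⟨n, z, ?_⟩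
  have h4 : (⟨a, eqToHom h2⟩ : AnnularMor w) = P.mor n :=
    ext_of_isStr h3 (isStr_eqToHom h2) (P.isStr_mor_natCast n)
  rw [← h4]
  exact congrArg _ hz

/-- A word starting in `D` is handled through its conjugate, which ends in `D`. If the conjugate
starts in `C`, the previous case applies and the involution carries the result back. -/
theorem classification (hIC : IsNontrivialIrr IC) (hID : IsNontrivialIrr ID)
    {x : AnnularMor w} (hx : LettersIn IC ID x.word) (hx' : Alternating x.word)
    (hf : x.hom ∈ ncpHom _ _) (h0 : x.hom ≠ 0) :
    ∃ (n : ℤ) (z : ℂ), x = (P.mor n).smul z := by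
  by_cases hh : ∀ c ∈ x.word.colours.head?, c = true
  · exact P.classification_of_head hIC hID hx hx' hh hf h0
  obtain ⟨b, hb, hc, ⟨d⟩⟩ := exists_duality hIC hID x.word hx
  have hb' := alternating_of_colours_reverse hc hx'
  obtain ⟨y, hy, rfl⟩ : ∃ y : AnnularMor w, IsDual x y ∧ y.word = b :=
    ⟨⟨b, annDual d.R' (adj d.R) (adj x.hom)⟩, ⟨d, rfl⟩, rfl⟩
  have hy0 : y.hom ≠ 0 := fun h => h0 (hy.symm.hom_eq_zero h)
  have hy1 := hy.hom_mem hf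
  have hlast : ∀ c ∈ y.word.colours.getLast?, c = false := by
    intro c h1
    rw [hc, List.getLast?_reverse] at h1
    by_contra h2
    apply hh
    intro c' h3
    rw [Option.mem_def] at h1 h3
    rw [h1] at h3
    simp_all
  by_cases hh' : ∀ c ∈ y.word.colours.head?, c = true
  · obtain ⟨n, z, rfl⟩ := P.classification_of_head hIC hID hb hb' hh' hy1 hy0
    refine ⟨-n, starRingEnd ℂ z, ?_⟩
    exact hy.symm.eq hIC hID ((P.isDual_mor n).smul z) hb hx (P.lettersIn_mor (-n)) hx'
      (P.alternating_mor (-n))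
  -- The conjugate starts and ends in `D`. Then `y.word ⊗ w` alternates but starts with another
  -- colour than `w ⊗ y.word`, so Schur's lemma makes the morphism zero.
  · exfalso
    have h1 : Alternating (y.word ⊗ w) := by
      rw [alternating_iff, colours_tensor]
      refine List.isChain_append.2 ⟨alternating_iff.1 hb', P.alt_w.chain, fun x hx y hy => ?_⟩
      rw [hlast x hx, P.alt_w.head y hy]
      simp
    have h2 : y.word ⊗ w ≠ w ⊗ y.word := by
      intro h3
      apply hh'
      intro c hc
      apply P.alt_w.head
      have h4 := congrArg (fun σ => List.head? (colours σ)) h3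
      simp only [colours_tensor, List.head?_append] at h4
      rw [Option.mem_def.1 hc] at h4
      cases hw : w.colours with
      | nil =>
        exfalso
        have h5 : w.letters = [] := List.map_eq_nil_iff.1 hw
        have h6 : w.letters = P.v.letters ++ P.w₁.letters := P.isStr₁.choose
        have h7 := P.v_length_pos
        rw [h5] at h6
        rw [(List.append_eq_nil_iff.1 h6.symm).1] at h7
        exact lt_irrefl _ h7
      | cons t l =>
        rw [hw] at h4
        simpa using h4.symm
    refine hy0 (ncpHom_eq_zero_of_ne' hIC hID (lettersIn_tensor.2 ⟨hb, P.lettersIn_w⟩)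
      (lettersIn_tensor.2 ⟨P.lettersIn_w, hb⟩) h1 ?_ h2 hy1)
    rw [len_tensor, len_tensor, add_comm]

end RotationData

end Classification

/-! ### The isomorphism with the group algebra -/

section GroupAlgebra

open Word

variable {C : Type u₁} [Category.{v₁} C] [MonoidalCategory C] [Preadditive C] [Linear ℂ C]
  [MonoidalPreadditive C] [MonoidalLinear ℂ C] [RigidCStarTensorCategory C]
variable {D : Type u₂} [Category.{v₂} D] [MonoidalCategory D] [Preadditive D] [Linear ℂ D]
  [MonoidalPreadditive D] [MonoidalLinear ℂ D] [RigidCStarTensorCategory D]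
variable {IC : Set C} {ID : Set D}

theorem IrrWord.lettersIn (a : IrrWord IC ID) : LettersIn IC ID a.word := a.2.2

theorem IrrWord.alternating (a : IrrWord IC ID) : Alternating a.word := a.2.1

/-- The duality of words that is given by a dual of a simple object. -/
def DualData.duality {a : IrrWord IC ID} (d : DualData a) : Duality a.word d.bar.word where
  R := d.R
  R' := d.R'
  R_mem := FreeProd.wordHoms_eq (C := C) (D := D) _ _ ▸ d.R_mem
  R'_mem := FreeProd.wordHoms_eq (C := C) (D := D) _ _ ▸ d.R'_mem
  zigzag := ⟨d.solves.1, d.solves.2⟩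

/-- The root of the words commuting with `w` is its primitive period: if `w = u ^ j`, then `u`
commutes with `w`, so `u = v ^ i` with `i > 0`, and comparing lengths bounds `j`. Evenness of the
length makes `w` end in `D`. -/
theorem exists_rotationData (hIC : IsNontrivialIrr IC) (hID : IsNontrivialIrr ID)
    {w : IrrWord IC ID} (hw : w ∈ evenWords IC ID) :
    ∃ (P : RotationData IC ID w.word) (k : ℕ), IsPrimitivePeriod P.v k w.word ∧
      P.v ⊗ w.word = w.word ⊗ P.v := by
  obtain ⟨heven, c, -, hhead⟩ := hw
  have hw0 : w.word.letters ≠ [] := by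
    intro h
    rw [h] at hhead
    simp at hhead
  obtain ⟨v, hv0, hvw, hroot⟩ := List.exists_root_of_commuting hw0
  obtain ⟨k, hk⟩ := hroot w.word.letters rfl
  obtain ⟨k, rfl⟩ : ∃ k', k = k' + 1 := by
    cases k with
    | zero => exact absurd hk (by simpa using hw0)
    | succ k => exact ⟨k, rfl⟩
  let v₀ : Word C D := v
  let w₁ : Word C D := (List.replicate k v).flatten
  have e1 : w.word = v₀ ⊗ w₁ := by
    refine hk.trans ?_
    rw [List.replicate_succ, List.flatten_cons]
    rfl
  have e2 : w.word = w₁ ⊗ v₀ := by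
    refine hk.trans ?_
    rw [List.flatten_replicate_succ']
    rfl
  have hlw := w.lettersIn
  have hlv : LettersIn IC ID v₀ := by
    rw [e1] at hlw
    exact (lettersIn_tensor.1 hlw).1
  have haw : AltFrom true w.word.colours := by
    refine AltFrom.of_even (alternating_iff.1 w.alternating) ?_ ?_
    · rw [colours, List.length_map]
      exact heven
    · intro x hx
      rw [colours, List.head?_map, hhead] at hx
      simpa using hx.symm
  have hav : AltFrom true v₀.colours := by
    refine haw.of_append (l' := w₁.colours) ?_ ?_
    · rw [← colours_tensor, ← e1]
    · rw [← colours_tensor, ← e2]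
  obtain ⟨v', hv', hc, ⟨d⟩⟩ := exists_duality hIC hID v₀ hlv
  refine ⟨⟨v₀, v', w₁, eqToIso e1, eqToIso e2, isStr_eqToHom e1, isStr_eqToHom e2, d, hlv, hv', hlw,
    hav, ?_, haw, hv0, hroot⟩, k + 1, ⟨hk, fun u j hu => ?_⟩, hvw⟩
  · rw [hc]
    exact hav.reverse
  · by_cases hu0 : u.letters = []
    · rw [hu0] at hu
      exact absurd hu (by simpa using hw0)
    obtain ⟨i, hi⟩ := hroot u.letters (by
      rw [hu]
      exact List.append_flatten_replicate_comm rfl j)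
    have h1 := congrArg List.length hk
    rw [hu, List.length_flatten_replicate, List.length_flatten_replicate, hi,
      List.length_flatten_replicate, ← mul_assoc] at h1
    have h2 := Nat.eq_of_mul_eq_mul_right (List.length_pos_iff.2 hv0) h1
    rw [← h2]
    refine Nat.le_mul_of_pos_right j (Nat.pos_of_ne_zero ?_)
    rintro rfl
    exact hu0 (by simpa using hi)

theorem annularMul_apply {w : Word C D} (f g : AnnularFamily IC ID w) (c : IrrWord IC ID) :
    annularMul f g c = ∑ᶠ (a₁ : IrrWord IC ID) (a₂ : IrrWord IC ID),
      annProj c.word (annComp (f a₁) (g a₂)) := by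
  refine finsum_congr fun a₁ => finsum_congr fun a₂ => Finset.sum_congr rfl fun u _ => ?_
  simp only [annularTerm, annComp, Category.assoc]

theorem annProj_zero {w a : Word C D} (c : Word C D) : annProj c (0 : a ⊗ w ⟶ w ⊗ a) = 0 := by
  simp [annProj]

theorem annProj_smul {w a : Word C D} (c : Word C D) (z : ℂ) (F : a ⊗ w ⟶ w ⊗ a) :
    annProj c (z • F) = z • annProj c F := by
  simp [annProj, Finset.smul_sum]

theorem annComp_smul_smul {w a b : Word C D} (z z' : ℂ) (f : a ⊗ w ⟶ w ⊗ a)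
    (g : b ⊗ w ⟶ w ⊗ b) : annComp (z • f) (z' • g) = (z * z') • annComp f g := by
  simp [annComp, mul_smul, smul_comm z z']

theorem zero_annComp {w a b : Word C D} (g : b ⊗ w ⟶ w ⊗ b) :
    annComp (0 : a ⊗ w ⟶ w ⊗ a) g = 0 := by
  simp [annComp]

theorem annComp_zero {w a b : Word C D} (f : a ⊗ w ⟶ w ⊗ a) :
    annComp f (0 : b ⊗ w ⟶ w ⊗ b) = 0 := by
  simp [annComp]

namespace RotationData

open AnnularMor

variable {w : Word C D} (P : RotationData IC ID w)

/-- The simple object `v ^ n`. -/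
def irr (n : ℤ) : IrrWord IC ID := ⟨(P.mor n).word, P.alternating_mor n, P.lettersIn_mor n⟩

theorem irr_injective (hIC : IsNontrivialIrr IC) (hID : IsNontrivialIrr ID) :
    Function.Injective P.irr := fun _ _ h =>
  P.mor_word_injective hIC hID (congrArg IrrWord.word h)

/-- The rotation by `v ^ n`, as a morphism in the summand of `v ^ n`. -/
def irrHom (n : ℤ) : (P.irr n).word ⊗ w ⟶ w ⊗ (P.irr n).word := (P.mor n).hom

theorem irrHom_ne_zero (hIC : IsNontrivialIrr IC) (hID : IsNontrivialIrr ID) (n : ℤ) :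
    P.irrHom n ≠ 0 := P.mor_hom_ne_zero hIC hID n

open Classical in
/-- The rotation by `v ^ n` as an element of the annular algebra. -/
def family (n : ℤ) : AnnularFamily IC ID w := Pi.single (P.irr n) (P.irrHom n)

/-- The linear map from the group algebra to the annular algebra. -/
def toFamily : MonoidAlgebra ℂ (Multiplicative ℤ) →ₗ[ℂ] AnnularFamily IC ID w :=
  Finsupp.linearCombination ℂ (fun g : Multiplicative ℤ => P.family g.toAdd) ∘ₗ
    (MonoidAlgebra.coeffLinearEquiv ℂ).toLinearMap

theorem toFamily_apply (x : MonoidAlgebra ℂ (Multiplicative ℤ)) :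
    P.toFamily x = ∑ g ∈ x.coeff.support, x.coeff g • P.family g.toAdd := rfl

theorem toFamily_single (g : Multiplicative ℤ) (z : ℂ) :
    P.toFamily (MonoidAlgebra.single g z) = z • P.family g.toAdd :=
  Finsupp.linearCombination_single ℂ z g

theorem family_self (n : ℤ) : P.family n (P.irr n) = P.irrHom n := by
  classical
  rw [family]
  exact Pi.single_eq_same
    (M := fun a : IrrWord IC ID => (a.word ⊗ w ⟶ w ⊗ a.word)) (P.irr n) (P.irrHom n)

theorem family_of_ne {n : ℤ} {a : IrrWord IC ID} (h : a ≠ P.irr n) : P.family n a = 0 := by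
  classical
  rw [family]
  exact Pi.single_eq_of_ne
    (M := fun a : IrrWord IC ID => (a.word ⊗ w ⟶ w ⊗ a.word)) h (P.irrHom n)

theorem toFamily_irr (hIC : IsNontrivialIrr IC) (hID : IsNontrivialIrr ID)
    (x : MonoidAlgebra ℂ (Multiplicative ℤ)) (g : Multiplicative ℤ) :
    P.toFamily x (P.irr g.toAdd) = x.coeff g • P.irrHom g.toAdd := by
  rw [toFamily_apply, Finset.sum_apply, Finset.sum_eq_single g]
  · rw [Pi.smul_apply, family_self]
  · intro h _ hne
    rw [Pi.smul_apply, family_of_ne, smul_zero]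
    exact fun h' => hne (P.irr_injective hIC hID h').symm
  · intro h
    rw [Finsupp.notMem_support_iff.1 h, zero_smul]
    rfl

theorem toFamily_of_notMem (x : MonoidAlgebra ℂ (Multiplicative ℤ)) {a : IrrWord IC ID}
    (h : ∀ g ∈ x.coeff.support, P.irr g.toAdd ≠ a) : P.toFamily x a = 0 := by
  rw [toFamily_apply, Finset.sum_apply]
  refine Finset.sum_eq_zero fun g hg => ?_
  rw [Pi.smul_apply, family_of_ne P (h g hg).symm, smul_zero]

theorem toFamily_mem (x : MonoidAlgebra ℂ (Multiplicative ℤ)) :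
    P.toFamily x ∈ centralizerAlgebra IC ID w := by
  rw [toFamily_apply]
  refine Submodule.sum_mem _ fun g _ => Submodule.smul_mem _ _ ⟨?_, fun a => ?_⟩
  · refine (Set.finite_singleton (P.irr g.toAdd)).subset fun a ha => ?_
    by_contra h
    exact ha (P.family_of_ne h)
  · rw [FreeProd.wordHoms_eq]
    by_cases h : a = P.irr g.toAdd
    · subst h
      rw [family_self]
      exact P.mor_hom_mem _
    · rw [P.family_of_ne h]
      exact zero_mem _

/-- Reduces the sums over all simple objects in the product and the involution to finite sums over
group elements. -/
theorem finsum_toFamily (hIC : IsNontrivialIrr IC) (hID : IsNontrivialIrr ID) {M : Type*}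
    [AddCommMonoid M] (x : MonoidAlgebra ℂ (Multiplicative ℤ)) (φ : IrrWord IC ID → M)
    (hφ : ∀ a, P.toFamily x a = 0 → φ a = 0) :
    ∑ᶠ a, φ a = ∑ g ∈ x.coeff.support, φ (P.irr g.toAdd) := by
  classical
  rw [finsum_eq_sum_of_support_subset (s := x.coeff.support.image fun g => P.irr g.toAdd)]
  · exact Finset.sum_image fun g _ h _ hgh => P.irr_injective hIC hID hgh
  · intro a ha
    by_contra h
    refine ha (hφ a (P.toFamily_of_notMem x fun g hg hga => h ?_))
    exact Finset.mem_coe.2 (Finset.mem_image.2 ⟨g, hg, hga⟩)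

/-- The juxtaposition has the same annular class as the rotation by `v ^ (m + n)`. That word is
simple, so its only nonzero component is the rotation itself. -/
theorem annProj_family (hIC : IsNontrivialIrr IC) (hID : IsNontrivialIrr ID) (m n : ℤ)
    (c : IrrWord IC ID) :
    annProj c.word (annComp (P.irrHom m) (P.irrHom n)) = P.family (m + n) c := by
  have h := annProj_eq_of_toClass_eq hIC hID c.lettersIn c.alternating (P.toClass_mor_comp m n)
  refine h.trans ?_
  by_cases hc : c = P.irr (m + n)
  · subst hc
    rw [family_self]
    exact annProj_self hIC hID (P.lettersIn_mor _) (P.alternating_mor _) _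
  · rw [P.family_of_ne hc]
    refine annProj_of_ne hIC hID c.lettersIn c.alternating (P.lettersIn_mor _)
      (P.alternating_mor _) (fun h => hc (Subtype.ext h)) _

theorem toFamily_mul (hIC : IsNontrivialIrr IC) (hID : IsNontrivialIrr ID)
    (x y : MonoidAlgebra ℂ (Multiplicative ℤ)) :
    P.toFamily (x * y) = annularMul (P.toFamily x) (P.toFamily y) := by
  funext c
  rw [annularMul_apply, P.finsum_toFamily hIC hID x]
  swap
  · intro a ha
    rw [ha]
    simp only [zero_annComp, annProj_zero, finsum_zero]
  have h1 : ∀ g ∈ x.coeff.support, (∑ᶠ a₂, annProj c.word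
      (annComp (P.toFamily x (P.irr g.toAdd)) (P.toFamily y a₂))) =
      ∑ h ∈ y.coeff.support, (x.coeff g * y.coeff h) • P.family (g * h).toAdd c := by
    intro g _
    rw [P.finsum_toFamily hIC hID y]
    · refine Finset.sum_congr rfl fun h _ => ?_
      rw [P.toFamily_irr hIC hID, P.toFamily_irr hIC hID]
      have h2 := annComp_smul_smul (x.coeff g) (y.coeff h) (P.irrHom g.toAdd) (P.irrHom h.toAdd)
      have h3 := congrArg (annProj c.word) h2
      refine h3.trans ?_
      rw [annProj_smul, P.annProj_family hIC hID, toAdd_mul]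
    · intro a ha
      rw [ha, annComp_zero, annProj_zero]
  rw [Finset.sum_congr rfl h1, MonoidAlgebra.mul_def, Finsupp.sum, map_sum, Finset.sum_apply]
  refine Finset.sum_congr rfl fun g _ => ?_
  rw [Finsupp.sum, map_sum, Finset.sum_apply]
  refine Finset.sum_congr rfl fun h _ => ?_
  rw [toFamily_single]
  rfl

theorem nonempty_dualData (n : ℤ) : Nonempty (DualData (P.irr n)) := by
  obtain ⟨d, -⟩ := P.isDual_mor n
  refine ⟨⟨P.irr (-n), d.R, d.R', ?_, ?_, ⟨d.zigzag.left, d.zigzag.right⟩⟩⟩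
  · rw [FreeProd.wordHoms_eq]
    exact d.R_mem
  · rw [FreeProd.wordHoms_eq]
    exact d.R'_mem

open Classical in
-- Valid for every dual `d`, since `annularAdj` uses an unspecified choice.
theorem single_annularAdjTerm (hIC : IsNontrivialIrr IC) (hID : IsNontrivialIrr ID) (n : ℤ)
    (d : DualData (P.irr n)) (z : ℂ) :
    (Pi.single d.bar (annularAdjTerm d (z • P.irrHom n)) : AnnularFamily IC ID w) =
      starRingEnd ℂ z • P.family (-n) := by
  have h1 : IsDual ((P.mor n).smul z) ⟨d.bar.word, annularAdjTerm d (z • P.irrHom n)⟩ :=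
    ⟨d.duality, rfl⟩
  have h2 := h1.eq hIC hID ((P.isDual_mor n).smul z) (P.lettersIn_mor n) d.bar.lettersIn
    (P.lettersIn_mor (-n)) d.bar.alternating (P.alternating_mor (-n))
  have h3 : ∀ (a : IrrWord IC ID) (f : a.word ⊗ w ⟶ w ⊗ a.word),
      (⟨a.word, f⟩ : AnnularMor w) = (P.mor (-n)).smul (starRingEnd ℂ z) →
      (Pi.single a f : AnnularFamily IC ID w) = starRingEnd ℂ z • P.family (-n) := by
    intro a f h
    obtain rfl : a = P.irr (-n) := Subtype.ext (congrArg AnnularMor.word h)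
    have hf : f = starRingEnd ℂ z • P.irrHom (-n) := by
      injection h
    rw [hf, family, Pi.single_smul]
  exact h3 _ _ h2

theorem toFamily_star (hIC : IsNontrivialIrr IC) (hID : IsNontrivialIrr ID)
    (x : MonoidAlgebra ℂ (Multiplicative ℤ)) :
    P.toFamily (groupAlgebraStar x) = annularAdj (P.toFamily x) := by
  classical
  rw [annularAdj, P.finsum_toFamily hIC hID x]
  · rw [groupAlgebraStar, Finsupp.sum, map_sum]
    refine Finset.sum_congr rfl fun g _ => ?_
    rw [toFamily_single, dif_pos (P.nonempty_dualData g.toAdd), P.toFamily_irr hIC hID, toAdd_inv]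
    exact (P.single_annularAdjTerm hIC hID g.toAdd _ (x.coeff g)).symm
  · intro a ha
    split_ifs with h
    · rw [ha]
      simp [annularAdjTerm]
    · rfl

theorem toFamily_injective (hIC : IsNontrivialIrr IC) (hID : IsNontrivialIrr ID) :
    Function.Injective P.toFamily := by
  rw [injective_iff_map_eq_zero]
  intro x hx
  refine MonoidAlgebra.ext (Finsupp.ext fun g => ?_)
  have h := P.toFamily_irr hIC hID x g
  rw [hx] at h
  exact (smul_eq_zero.1 h.symm).resolve_right (P.irrHom_ne_zero hIC hID _)

theorem exists_toFamily_eq (hIC : IsNontrivialIrr IC) (hID : IsNontrivialIrr ID)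
    {f : AnnularFamily IC ID w} (hf : f ∈ centralizerAlgebra IC ID w) : ∃ x, P.toFamily x = f := by
  classical
  have hmem : ∀ a : IrrWord IC ID, f a ∈ ncpHom (a.word ⊗ w) (w ⊗ a.word) := fun a => by
    rw [← FreeProd.wordHoms_eq]
    exact hf.2 a
  have hcl : ∀ a : IrrWord IC ID, f a ≠ 0 → ∃ (n : ℤ) (z : ℂ), a = P.irr n ∧
      (⟨a.word, f a⟩ : AnnularMor w) = (P.mor n).smul z := by
    intro a ha
    obtain ⟨n, z, h⟩ := P.classification (x := ⟨a.word, f a⟩) hIC hID a.lettersIn a.alternating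
      (hmem a) ha
    exact ⟨n, z, Subtype.ext (congrArg AnnularMor.word h), h⟩
  have hz : ∀ n : ℤ, ∃ z : ℂ, f (P.irr n) = z • P.irrHom n := by
    intro n
    by_cases h0 : f (P.irr n) = 0
    · exact ⟨0, by rw [h0, zero_smul]⟩
    · obtain ⟨m, z, hm, h⟩ := hcl _ h0
      obtain rfl := P.irr_injective hIC hID hm
      injection h with _ h
      exact ⟨z, h⟩
  choose z hz using hz
  -- Finiteness of the support is pulled back along the injection `n ↦ v ^ n`.
  have hfin : {g : Multiplicative ℤ | f (P.irr g.toAdd) ≠ 0}.Finite :=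
    hf.1.preimage (f := fun g : Multiplicative ℤ => P.irr g.toAdd)
      (fun g _ h _ hgh => P.irr_injective hIC hID hgh)
  let x : MonoidAlgebra ℂ (Multiplicative ℤ) := .ofCoeff (Finsupp.onFinset hfin.toFinset
    (fun g => z g.toAdd) (fun g hg => by
      rw [Set.Finite.mem_toFinset]
      intro h
      rw [hz] at h
      exact (smul_eq_zero.1 h).elim hg (P.irrHom_ne_zero hIC hID _)))
  refine ⟨x, funext fun a => ?_⟩
  by_cases ha : ∃ n, P.irr n = a
  · obtain ⟨n, rfl⟩ := ha
    rw [hz n]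
    exact P.toFamily_irr hIC hID x (Multiplicative.ofAdd n)
  · push Not at ha
    rw [P.toFamily_of_notMem x fun g _ => ha _]
    by_contra h
    obtain ⟨n, _, hn, -⟩ := hcl a (Ne.symm h)
    exact ha n hn.symm

/-- The isomorphism from the group algebra onto the centralizer algebra. -/
def groupAlgebraEquiv (hIC : IsNontrivialIrr IC) (hID : IsNontrivialIrr ID) :
    MonoidAlgebra ℂ (Multiplicative ℤ) ≃ₗ[ℂ] centralizerAlgebra IC ID w :=
  LinearEquiv.ofBijective (P.toFamily.codRestrict _ P.toFamily_mem)
    ⟨fun _ _ h => P.toFamily_injective hIC hID (congrArg Subtype.val h), fun f => by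
      obtain ⟨x, hx⟩ := P.exists_toFamily_eq hIC hID f.2
      exact ⟨x, Subtype.ext hx⟩⟩

theorem family_one (v : IrrWord IC ID) (hv : v.word = P.v) (h : v.word ⊗ w = w ⊗ v.word) :
    P.family 1 = wordRotation v h := by
  classical
  -- The first power is the unit composed with the rotation, so its word is `v` with the empty word
  -- in front.
  have h1 : v = P.irr 1 := Subtype.ext (hv.trans (empty_tensor P.v).symm)
  subst h1
  have h2 : IsStr (P.irrHom 1) := P.isStr_mor_natCast 1
  rw [family, wordRotation, h2.eq (isStr_eqToHom h)]

end RotationData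

end GroupAlgebra

theorem mainTheorem7
    {C : Type u₁} [Category.{v₁} C] [MonoidalCategory C] [Preadditive C] [Linear ℂ C]
    [MonoidalPreadditive C] [MonoidalLinear ℂ C] [RigidCStarTensorCategory C]
    {D : Type u₂} [Category.{v₂} D] [MonoidalCategory D] [Preadditive D] [Linear ℂ D]
    [MonoidalPreadditive D] [MonoidalLinear ℂ D] [RigidCStarTensorCategory D]
    (IC : Set C) (hIC : IsNontrivialIrr IC) (ID : Set D) (hID : IsNontrivialIrr ID)
    (w : IrrWord IC ID) (hw : w ∈ evenWords IC ID) :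
    ∃ (v : IrrWord IC ID) (k : ℕ) (h : v.word ⊗ w.word = w.word ⊗ v.word)
      (e : MonoidAlgebra ℂ (Multiplicative ℤ) ≃ₗ[ℂ] centralizerAlgebra IC ID w.word),
      IsPrimitivePeriod v.word k w.word ∧
      (∀ x y, (e (x * y) : AnnularFamily IC ID w.word) = annularMul (e x) (e y)) ∧
      (∀ x, (e (groupAlgebraStar x) : AnnularFamily IC ID w.word) = annularAdj (e x)) ∧
      (e (MonoidAlgebra.single (Multiplicative.ofAdd 1) 1) : AnnularFamily IC ID w.word) =
        wordRotation v h := by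
  obtain ⟨P, k, hk, h⟩ := exists_rotationData hIC hID hw
  refine ⟨⟨P.v, Word.alternating_iff.2 P.alt.chain, P.lettersIn⟩, k, h,
    P.groupAlgebraEquiv hIC hID, hk, P.toFamily_mul hIC hID, P.toFamily_star hIC hID, ?_⟩
  have h1 := P.toFamily_single (Multiplicative.ofAdd 1) 1
  rw [one_smul] at h1
  exact h1.trans (P.family_one ⟨P.v, _⟩ rfl h)

end
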